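/- **Cable systems.** Let $(V,E)$ be a countable, locally bounded, connected simple graph. Its cable space $X$ is obtained by replacing each edge by a copy of $[0,1]$ (glued at the common vertices), with its geodesic metric $d$ (each cable has length $1$) and the measure $m$ that is Lebesgue measure on each cable; $B(x,r)$ denotes the open ball. Let $\mathcal K$ be the set of continuous compactly supported $u:X\to\mathbb R$ that are differentiable along each closed cable (one-sidedly at its ends) with essentially bounded derivative $\nabla u$. Let $\mathcal E(u,v)=\sum_{e\in E}\int_e\nabla u\,\nabla v\,dm$ and let $\mathcal F\subseteq L^2(X;m)$ be the closure of $\mathcal K$ with respect to $\mathcal E_1(u,u)=\mathcal E(u,u)+\|u\|_2^2$; $\nabla u$ and $\mathcal E$ extend to $\mathcal F$ by $L^2$-limits of gradients. A function $u\in\mathcal F$ is harmonic in an open set $D$ if $\mathcal E(u,\varphi)=0$ for every $\varphi\in\mathcal F\cap C_c(D)$. For $\alpha,\beta>0$ put $\Phi(r)=r$, $\Psi(r)=r^2$ for $0<r<1$ and $\Phi(r)=r^\alpha$, $\Psi(r)=r^\beta$ for $r\ge1$. The generalized reverse Hölder inequality $\mathrm{GRH}(\Phi,\Psi)$ says: there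 is $C_H\in(0,\infty)$ such that for every ball $B=B(x_0,r)$, $r>0$, and every $u\in\mathcal F$ that is harmonic in $2B=B(x_0,2r)$, $$\big\||\nabla u|\big\|_{L^\infty(B)}\le C_H\,\frac{\Phi(r)}{\Psi(r)}\,\frac1{m(2B)}\int_{2B}|u|\,dm .$$ **The graphs.** (a) *$N$-dimensional Vicsek graph*, $N\ge2$: let $p_1=0,\dots,p_{2^N}$ be the vertices of the cube $[0,2/\sqrt N]^N$ and $p_{2^N+1}$ its centre, $f_i(x)=\frac13x+\frac23p_i$ for $1\le i\le 2^N+1$, $V_0=\{p_1,\dots,p_{2^N+1}\}$, and $E_0=\{\{p_i,p_{2^N+1}\}:1\le i\le 2^N\}$. With $V_{n+1}=\bigcup_if_i(V_n)$ and $E_{n+1}=\bigcup_if_i(E_n)$, the graph has vertex set $\bigcup_n3^nV_n$ and edge set $\bigcup_n3^nE_n$. (b) *Sierpiński graph*: let $p_1=(0,0)$, $p_2=(1,0)$, $p_3=(\frac12,\frac{\sqrt3}2)$, $f_i(x)=\frac12(x+p_i)$ for $i=1,2,3$, $V_0=\{p_1,p_2,p_3\}$, and let $E_0$ be the set of all pairs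 of distinct points of $V_0$. With $V_{n+1}=\bigcup_if_i(V_n)$ and $E_{n+1}=\bigcup_if_i(E_n)$, the graph has vertex set $\bigcup_n2^nV_n$ and edge set $\bigcup_n2^nE_n$. **Proposition.** $\mathrm{GRH}(\Phi,\Psi)$ holds 1. on the cable system of the $N$-dimensional Vicsek graph for every $N\ge2$, with $\alpha=\log(2^N+1)/\log3$ and $\beta=\log(3(2^N+1))/\log3$ (the constant $C_H$ may depend on $N$); 2. on the cable system of the Sierpiński graph, with $\alpha=\log3/\log2$ and $\beta=\log5/\log2$. -/

import Mathlib

open Set Filter MeasureTheory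
open scoped unitInterval Topology ENNReal

noncomputable section

/-! ### The cable space of a graph -/

namespace SimpleGraph

variable {V : Type*} (G : SimpleGraph V)

/-- `(e, a)` is an end of the oriented edge `e`, sitting at the vertex `v`. -/
def IsCableEnd (x : G.Dart × I) (v : V) : Prop :=
  (x.2 = 0 ∧ x.1.fst = v) ∨ (x.2 = 1 ∧ x.1.snd = v)

/-- Gluing of the intervals `{e} × [0,1]`. Every edge is represented by its two orientations,
which are identified by `(e, a) ∼ (ē, 1 - a)`; ends sitting at the same vertex are identified. -/
def CableRel (x y : G.Dart × I) : Prop :=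
  x = y ∨ (y.1 = x.1.symm ∧ y.2 = σ x.2) ∨ ∃ v, G.IsCableEnd x v ∧ G.IsCableEnd y v

variable {G} in
lemma IsCableEnd.unique {x : G.Dart × I} {v w : V} (hv : G.IsCableEnd x v)
    (hw : G.IsCableEnd x w) : v = w := by
  rcases hv with ⟨h1, h2⟩ | ⟨h1, h2⟩ <;> rcases hw with ⟨h3, h4⟩ | ⟨h3, h4⟩
  · exact h2.symm.trans h4
  · exact absurd (h1.symm.trans h3) (by simp)
  · exact absurd (h3.symm.trans h1) (by simp)
  · exact h2.symm.trans h4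

variable {G} in
lemma IsCableEnd.flip {x y : G.Dart × I} {v : V} (hv : G.IsCableEnd x v)
    (h1 : y.1 = x.1.symm) (h2 : y.2 = σ x.2) : G.IsCableEnd y v := by
  rcases hv with ⟨h3, h4⟩ | ⟨h3, h4⟩
  · right
    rw [h2, h3, h1]
    exact ⟨by simp, h4⟩
  · left
    rw [h2, h3, h1]
    exact ⟨by simp, h4⟩

lemma cableRel_symm {x y : G.Dart × I} (h : G.CableRel x y) : G.CableRel y x := by
  rcases h with h | ⟨h1, h2⟩ | ⟨v, h1, h2⟩
  · exact Or.inl h.symm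
  · exact Or.inr (Or.inl ⟨by rw [h1, Dart.symm_symm], by rw [h2, unitInterval.symm_symm]⟩)
  · exact Or.inr (Or.inr ⟨v, h2, h1⟩)

lemma cableRel_equivalence : Equivalence G.CableRel where
  refl _ := Or.inl rfl
  symm h := G.cableRel_symm h
  trans := by
    rintro x y z h h'
    rcases h with rfl | h | ⟨v, h1, h2⟩
    · exact h'
    · rcases h' with rfl | h' | ⟨v, h1, h2⟩
      · exact Or.inr (Or.inl h)
      · left
        refine Prod.ext ?_ ?_
        · rw [h'.1, h.1, Dart.symm_symm]
        · rw [h'.2, h.2, unitInterval.symm_symm]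
      · refine Or.inr (Or.inr ⟨v, ?_, h2⟩)
        refine h1.flip ?_ ?_
        · rw [h.1, Dart.symm_symm]
        · rw [h.2, unitInterval.symm_symm]
    · rcases h' with rfl | h' | ⟨w, h3, h4⟩
      · exact Or.inr (Or.inr ⟨v, h1, h2⟩)
      · exact Or.inr (Or.inr ⟨v, h1, h2.flip h'.1 h'.2⟩)
      · obtain rfl := h2.unique h3
        exact Or.inr (Or.inr ⟨v, h1, h4⟩)

/-- The cable space `X`: every edge of `G` is replaced by a copy of `[0,1]`. -/
def CableSpace : Type _ := Quotient (⟨G.CableRel, G.cableRel_equivalence⟩ : Setoid (G.Dart × I))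

variable {G}

/-- The point at distance `a` from `e.fst` on the cable of the oriented edge `e`. -/
def Dart.point (e : G.Dart) (a : I) : G.CableSpace := Quotient.mk _ (e, a)

/-- `Dart.point` with a real parameter (only values in `[0,1]` matter). -/
def Dart.cable (e : G.Dart) (a : ℝ) : G.CableSpace := e.point (projIcc 0 1 zero_le_one a)

namespace CableSpace

lemma point_eq_point {e f : G.Dart} {a b : I} :
    e.point a = f.point b ↔ G.CableRel (e, a) (f, b) :=
  Quotient.eq (r := ⟨G.CableRel, G.cableRel_equivalence⟩)

lemma exists_point (x : G.CableSpace) : ∃ (e : G.Dart) (a : I), x = e.point a := by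
  induction x using Quotient.inductionOn with
  | h p => exact ⟨p.1, p.2, rfl⟩

lemma symm_point (e : G.Dart) (a : I) : e.symm.point (σ a) = e.point a :=
  point_eq_point.2 (G.cableRel_symm (Or.inr (Or.inl ⟨rfl, rfl⟩)))

/-- The candidates for the distance from `x` to `y`: the length `|a - b|` of the segment between
them when they lie on a common cable, and the lengths of the routes that leave `x` through an end
of its cable, follow a shortest path of the graph, and reach `y` through an end of its cable.
(As `e` and `f` run over oriented edges, all choices of ends are covered.) -/
def lengths (x y : G.CableSpace) : Set ℝ :=
  {l | ∃ (e : G.Dart) (a b : I), x = e.point a ∧ y = e.point b ∧ l = |(a : ℝ) - b|} ∪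
  {l | ∃ (e : G.Dart) (a : I) (f : G.Dart) (b : I), x = e.point a ∧ y = f.point b ∧
    l = a + G.dist e.fst f.fst + b}

lemma lengths_nonempty (x y : G.CableSpace) : (lengths x y).Nonempty := by
  obtain ⟨e, a, rfl⟩ := exists_point x
  obtain ⟨f, b, rfl⟩ := exists_point y
  exact ⟨_, Or.inr ⟨e, a, f, b, rfl, rfl, rfl⟩⟩

lemma lengths_nonneg {x y : G.CableSpace} {l : ℝ} (h : l ∈ lengths x y) : 0 ≤ l := by
  rcases h with ⟨e, a, b, -, -, rfl⟩ | ⟨e, a, f, b, -, -, rfl⟩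
  · positivity
  · have := a.2.1
    have := b.2.1
    positivity

lemma lengths_bddBelow (x y : G.CableSpace) : BddBelow (lengths x y) :=
  ⟨0, fun _ h => lengths_nonneg h⟩

lemma lengths_comm {x y : G.CableSpace} {l : ℝ} (h : l ∈ lengths x y) : l ∈ lengths y x := by
  rcases h with ⟨e, a, b, h1, h2, rfl⟩ | ⟨e, a, f, b, h1, h2, rfl⟩
  · exact Or.inl ⟨e, b, a, h2, h1, abs_sub_comm _ _⟩
  · exact Or.inr ⟨f, b, e, a, h2, h1, by rw [dist_comm]; ring⟩

instance : Dist G.CableSpace := ⟨fun x y => sInf (lengths x y)⟩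

lemma dist_def (x y : G.CableSpace) : Dist.dist x y = sInf (lengths x y) := rfl

lemma dist_le_of_rel {e f : G.Dart} {a b : I} (h : e.point a = f.point b) :
    (G.dist e.fst f.fst : ℝ) ≤ a + b := by
  have ha := a.2.1
  have hb := b.2.1
  rcases point_eq_point.1 h with h | ⟨h1, h2⟩ | ⟨v, h1, h2⟩
  · obtain ⟨rfl, rfl⟩ := Prod.mk.inj h
    simp only [dist_self, Nat.cast_zero]
    linarith
  · simp only at h1 h2
    subst h1 h2
    have : G.dist e.fst e.symm.fst = 1 := dist_eq_one_iff_adj.2 e.adj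
    rw [this]
    simp
  · rcases h1 with ⟨h1, h3⟩ | ⟨h1, h3⟩ <;> rcases h2 with ⟨h2, h4⟩ | ⟨h2, h4⟩ <;>
      simp only at h1 h2 h3 h4 <;> subst h1 h2
    · simp [h3, h4]
    · have : G.dist e.fst f.fst = 1 := by
        rw [h3, ← h4]; exact dist_eq_one_iff_adj.2 f.adj.symm
      simp [this]
    · have : G.dist e.fst f.fst = 1 := by
        rw [h4, ← h3]; exact dist_eq_one_iff_adj.2 e.adj
      simp [this]
    · obtain h | h := eq_or_ne e.fst f.fst
      · simp [h]
      · have h5 : (e.snd : V) = f.snd := h3.trans h4.symm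
        have : G.dist e.fst f.fst ≤ 2 := by
          have := dist_le (Walk.cons e.adj (Walk.cons (by rw [h5]; exact f.adj.symm) Walk.nil) :
            G.Walk e.fst f.fst)
          simpa using this
        have h6 : (G.dist e.fst f.fst : ℝ) ≤ 2 := by exact_mod_cast this
        simp only [Icc.coe_one]
        linarith

/-- Moving along a cable before leaving it costs at least as much as leaving it directly. -/
lemma exists_leave {e f : G.Dart} {a b c : I} (h : e.point b = f.point c) :
    (∃ c' : I, e.point a = f.point c' ∧ |(a : ℝ) - b| = |(c' : ℝ) - c|) ∨
    ∃ (g : G.Dart) (s : I), e.point a = g.point s ∧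
      (((s : ℝ) ≤ |(a : ℝ) - b| ∧ g.fst = f.fst ∧ c = 0) ∨
        ((s : ℝ) ≤ |(a : ℝ) - b| ∧ g.fst = f.snd ∧ c = 1)) := by
  have ha := a.2
  rcases point_eq_point.1 h with h | ⟨h1, h2⟩ | ⟨v, h1, h2⟩
  · obtain ⟨rfl, rfl⟩ := Prod.mk.inj h
    exact Or.inl ⟨a, rfl, rfl⟩
  · simp only at h1 h2
    subst h1 h2
    refine Or.inl ⟨σ a, (symm_point e a).symm, ?_⟩
    simp only [unitInterval.coe_symm_eq]
    rw [abs_sub_comm]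
    congr 1
    ring
  · right
    rcases h1 with ⟨h1, h3⟩ | ⟨h1, h3⟩ <;> simp only at h1 h3 <;> subst h1
    · refine ⟨e, a, rfl, ?_⟩
      have : (a : ℝ) ≤ |(a : ℝ) - (0 : I)| := by
        simp only [Icc.coe_zero, sub_zero]
        exact le_abs_self _
      rcases h2 with ⟨h2, h4⟩ | ⟨h2, h4⟩
      · exact Or.inl ⟨this, h3.trans h4.symm, h2⟩
      · exact Or.inr ⟨this, h3.trans h4.symm, h2⟩
    · refine ⟨e.symm, σ a, (symm_point e a).symm, ?_⟩
      have : ((σ a : I) : ℝ) ≤ |(a : ℝ) - (1 : I)| := by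
        simp only [Icc.coe_one, unitInterval.coe_symm_eq]
        rw [abs_sub_comm]
        exact le_abs_self _
      rcases h2 with ⟨h2, h4⟩ | ⟨h2, h4⟩
      · exact Or.inl ⟨this, h3.trans h4.symm, h2⟩
      · exact Or.inr ⟨this, h3.trans h4.symm, h2⟩

lemma dist_fst_snd (e : G.Dart) : G.dist e.fst e.snd = 1 := dist_eq_one_iff_adj.2 e.adj

variable [hG : Fact G.Connected]

lemma dist_tri (u v w : V) : (G.dist u w : ℝ) ≤ G.dist u v + G.dist v w := by
  exact_mod_cast hG.out.dist_triangle

lemma lengths_seg_route {x y z : G.CableSpace} {e g k : G.Dart} {a b c d : I}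
    (hx : x = e.point a) (hy : y = e.point b) (hy' : y = g.point c) (hz : z = k.point d) :
    ∃ l ∈ lengths x z, l ≤ |(a : ℝ) - b| + (c + G.dist g.fst k.fst + d) := by
  have hc := c.2.1
  subst hx hz
  rcases exists_leave (a := a) (hy.symm.trans hy') with ⟨c', h1, h2⟩ | ⟨f, s, h1, h2⟩
  · refine ⟨_, Or.inr ⟨g, c', k, d, h1, rfl, rfl⟩, ?_⟩
    have := le_abs_self ((c' : ℝ) - c)
    linarith
  · refine ⟨_, Or.inr ⟨f, s, k, d, h1, rfl, rfl⟩, ?_⟩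
    rcases h2 with ⟨h3, h4, h5⟩ | ⟨h3, h4, h5⟩
    · rw [h4]
      linarith
    · rw [h4]
      have h6 := dist_tri (G := G) g.snd g.fst k.fst
      rw [dist_comm (u := g.snd) (v := g.fst), dist_fst_snd] at h6
      simp only [h5, Icc.coe_one]
      push_cast at h6
      linarith

lemma lengths_triangle {x y z : G.CableSpace} {l m : ℝ} (hl : l ∈ lengths x y)
    (hm : m ∈ lengths y z) : ∃ k ∈ lengths x z, k ≤ l + m := by
  rcases hl with ⟨e, a, b, h1, h2, rfl⟩ | ⟨e, a, f, b, h1, h2, rfl⟩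
  · rcases hm with ⟨g, c, d, h3, h4, rfl⟩ | ⟨g, c, k, d, h3, h4, rfl⟩
    · subst h1 h4
      rcases exists_leave (a := a) (h2.symm.trans h3) with ⟨c', h5, h6⟩ | ⟨f, s, h5, h6⟩
      · exact ⟨_, Or.inl ⟨g, c', d, h5, rfl, rfl⟩, by rw [h6]; exact abs_sub_le _ _ _⟩
      · rcases h6 with ⟨h6, h7, h8⟩ | ⟨h6, h7, h8⟩
        · refine ⟨_, Or.inr ⟨f, s, g, d, h5, rfl, rfl⟩, ?_⟩
          have := neg_abs_le ((c : ℝ) - d)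
          simp only [h8, Icc.coe_zero] at this ⊢
          rw [h7, SimpleGraph.dist_self]
          push_cast
          linarith
        · refine ⟨_, Or.inr ⟨f, s, g.symm, σ d, h5, (symm_point g d).symm, rfl⟩, ?_⟩
          have := le_abs_self ((c : ℝ) - d)
          simp only [h8, Icc.coe_one] at this ⊢
          have h9 : g.symm.fst = g.snd := rfl
          rw [h7, h9, SimpleGraph.dist_self]
          simp only [unitInterval.coe_symm_eq]
          push_cast
          linarith
    · exact lengths_seg_route h1 h2 h3 h4
  · rcases hm with ⟨g, c, d, h3, h4, rfl⟩ | ⟨g, c, k, d, h3, h4, rfl⟩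
    · obtain ⟨k, hk, hk'⟩ := lengths_seg_route h4 h3 h2 h1
      refine ⟨k, lengths_comm hk, hk'.trans (le_of_eq ?_)⟩
      rw [abs_sub_comm, SimpleGraph.dist_comm]
      ring
    · refine ⟨_, Or.inr ⟨e, a, k, d, h1, h4, rfl⟩, ?_⟩
      have h5 := dist_le_of_rel (h2.symm.trans h3)
      have h6 := dist_tri (G := G) e.fst f.fst k.fst
      have h7 := dist_tri (G := G) f.fst g.fst k.fst
      linarith

lemma eq_of_lengths_lt {x y : G.CableSpace} {e f : G.Dart} {a b : I}
    (hx : x = e.point a) (hy : y = f.point b)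
    (h : ∀ ε > 0, ∃ l ∈ lengths x y, l < ε) : x = y := by
  -- a positive number smaller than every positive candidate
  classical
  have key : ∀ (t : I), ∃ δ : ℝ, 0 < δ ∧ δ ≤ 1 ∧ (t ≠ 0 → δ ≤ t) ∧ (t ≠ 1 → δ ≤ 1 - (t : ℝ)) := by
    intro t
    have ht := t.2
    rcases eq_or_ne t 0 with rfl | h0
    · exact ⟨1, one_pos, le_rfl, fun h => absurd rfl h, fun _ => by simp⟩
    rcases eq_or_ne t 1 with rfl | h1
    · exact ⟨1, one_pos, le_rfl, fun _ => by simp, fun h => absurd rfl h⟩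
    have h0' : 0 < (t : ℝ) := lt_of_le_of_ne ht.1 (fun h => h0 (Subtype.ext h.symm))
    have h1' : (t : ℝ) < 1 := lt_of_le_of_ne ht.2 (fun h => h1 (Subtype.ext h))
    refine ⟨min t (1 - t), lt_min h0' (by linarith), (min_le_left _ _).trans h1'.le,
      fun _ => min_le_left _ _, fun _ => min_le_right _ _⟩
  have rep : ∀ {x : G.CableSpace} {e g : G.Dart} {a c : I}, x = e.point a → x = g.point c →
      c = 0 ∨ c = 1 ∨ c = a ∨ c = σ a := by
    intro x e g a c h1 h2
    rcases point_eq_point.1 (h1.symm.trans h2) with h | ⟨-, h⟩ | ⟨v, -, h | h⟩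
    · exact Or.inr (Or.inr (Or.inl (Prod.mk.inj h).2.symm))
    · exact Or.inr (Or.inr (Or.inr h))
    · exact Or.inl h.1
    · exact Or.inr (Or.inl h.1)
  have small : ∀ {x : G.CableSpace} {e : G.Dart} {a : I}, x = e.point a → ∃ δ : ℝ, 0 < δ ∧
      ∀ (g : G.Dart) (c : I), x = g.point c → (c ≠ 0 → δ ≤ c) ∧ (c ≠ 1 → δ ≤ 1 - (c : ℝ)) := by
    intro x e a h1
    obtain ⟨δ, h2, h3, h4, h5⟩ := key a
    refine ⟨δ, h2, fun g c hc => ?_⟩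
    rcases rep h1 hc with rfl | rfl | rfl | rfl
    · exact ⟨fun h => absurd rfl h, fun _ => by simpa using h3⟩
    · exact ⟨fun _ => by simpa using h3, fun h => absurd rfl h⟩
    · exact ⟨h4, h5⟩
    · refine ⟨fun h => ?_, fun h => ?_⟩
      · simpa using h5 (by rintro rfl; simp at h)
      · simpa using h4 (by rintro rfl; simp at h)
  obtain ⟨δ, hδ, H⟩ := small hx
  obtain ⟨η, hη, K⟩ := small hy
  by_contra hne
  have hab : ∀ {s t : I}, s ≠ t → 0 < |(s : ℝ) - t| := fun h =>
    abs_pos.2 (sub_ne_zero.2 fun h' => h (Subtype.ext h'))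
  -- a third bound, for the pairs of interior parameters
  have third : ∃ θ : ℝ, 0 < θ ∧ ∀ s ∈ ({a, σ a, b, σ b, 0, 1} : Set I),
      ∀ t ∈ ({a, σ a, b, σ b, 0, 1} : Set I), s ≠ t → θ ≤ |(s : ℝ) - t| := by
    set F : Finset I := {a, σ a, b, σ b, 0, 1}
    set P := (F ×ˢ F).filter fun p => p.1 ≠ p.2
    have hP : P.Nonempty := ⟨(0, 1), by simp [P, F]⟩
    obtain ⟨p, hp, hmin⟩ := P.exists_min_image (fun p => |(p.1 : ℝ) - p.2|) hP
    refine ⟨|(p.1 : ℝ) - p.2|, hab (Finset.mem_filter.1 hp).2, fun s hs t ht hst => ?_⟩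
    refine hmin (s, t) (Finset.mem_filter.2 ⟨Finset.mem_product.2 ⟨?_, ?_⟩, hst⟩)
    · simpa [F] using hs
    · simpa [F] using ht
  obtain ⟨θ, hθ, T⟩ := third
  obtain ⟨l, hl, hlt⟩ := h (min (min δ η) (min θ 1)) (by positivity)
  simp only [lt_min_iff] at hlt
  obtain ⟨⟨hl1, hl2⟩, hl3, hl4⟩ := hlt
  rcases hl with ⟨g, s, t, h1, h2, rfl⟩ | ⟨g, s, k, t, h1, h2, rfl⟩
  · have hst : s ≠ t := by
      rintro rfl
      exact hne (h1.trans h2.symm)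
    refine absurd (T s ?_ t ?_ hst) (not_le.2 hl3)
    · rcases rep hx h1 with h | h | h | h <;> simp [h]
    · rcases rep hy h2 with h | h | h | h <;> simp [h]
  · have hs := s.2.1
    have ht := t.2.1
    have hd : (0 : ℝ) ≤ G.dist g.fst k.fst := Nat.cast_nonneg _
    have hs0 : s = 0 := by
      by_contra h
      linarith [(H g s h1).1 h]
    have ht0 : t = 0 := by
      by_contra h
      linarith [(K k t h2).1 h]
    have hd0 : G.dist g.fst k.fst = 0 := by
      have : (G.dist g.fst k.fst : ℝ) < 1 := by linarith
      have : G.dist g.fst k.fst < 1 := by exact_mod_cast this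
      omega
    have hv : g.fst = k.fst := (hG.out.dist_eq_zero_iff).1 hd0
    apply hne
    rw [h1, h2]
    exact point_eq_point.2 (Or.inr (Or.inr ⟨k.fst, Or.inl ⟨hs0, hv⟩, Or.inl ⟨ht0, rfl⟩⟩))

/-- The cable space of a connected graph with its geodesic metric; all cables have length one. -/
instance : MetricSpace G.CableSpace where
  dist_self x := by
    obtain ⟨e, a, hx⟩ := exists_point x
    refine le_antisymm (csInf_le (lengths_bddBelow x x) (Or.inl ⟨e, a, a, hx, hx, by simp⟩)) ?_
    exact le_csInf (lengths_nonempty x x) fun _ h => lengths_nonneg h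
  dist_comm x y := by
    rw [dist_def, dist_def]
    congr 1
    ext l
    exact ⟨lengths_comm, lengths_comm⟩
  dist_triangle x y z := by
    refine le_of_forall_pos_le_add fun ε hε => ?_
    obtain ⟨l, hl, hl'⟩ := exists_lt_of_csInf_lt (lengths_nonempty x y)
      (lt_add_of_pos_right (Dist.dist x y) (half_pos hε))
    obtain ⟨m, hm, hm'⟩ := exists_lt_of_csInf_lt (lengths_nonempty y z)
      (lt_add_of_pos_right (Dist.dist y z) (half_pos hε))
    obtain ⟨k, hk, hk'⟩ := lengths_triangle hl hm
    have := csInf_le (lengths_bddBelow x z) hk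
    rw [← dist_def] at this
    linarith
  eq_of_dist_eq_zero {x y} h := by
    obtain ⟨e, a, hx⟩ := exists_point x
    obtain ⟨f, b, hy⟩ := exists_point y
    refine eq_of_lengths_lt hx hy fun ε hε => ?_
    refine exists_lt_of_csInf_lt (lengths_nonempty x y) ?_
    rw [← dist_def, h]
    exact hε

instance : MeasurableSpace G.CableSpace := borel _

instance : BorelSpace G.CableSpace := ⟨rfl⟩

end CableSpace

/-! ### Measure, Dirichlet form, harmonic functions -/

instance : MeasurableSpace G.Dart := ⊤

variable (G) in
/-- Lebesgue measure on the disjoint union of the intervals `{e} × [0,1]`, `e` running over the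
oriented edges; every edge of the (countable) graph occurs twice. -/
def dartMeasure : Measure (G.Dart × ℝ) :=
  (Measure.count : Measure G.Dart).prod (volume.restrict (Icc 0 1))

/-- The gluing map. -/
def cableMap (z : G.Dart × ℝ) : G.CableSpace := z.1.cable z.2

variable [Fact G.Connected]

variable (G) in
/-- The measure `m` on the cable space: Lebesgue measure on every cable. The factor `1/2`
compensates that every cable occurs with both of its orientations. -/
def cableMeasure : Measure G.CableSpace :=
  (2⁻¹ : ℝ≥0∞) • (G.dartMeasure.map cableMap)

/-- The derivative of `u` along the oriented edge `e` at the parameter `a`; it is one-sided at the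
two ends. Reversing `e` changes its sign only. -/
def edgeDeriv (u : G.CableSpace → ℝ) (z : G.Dart × ℝ) : ℝ :=
  derivWithin (fun s => u (z.1.cable s)) (Icc 0 1) z.2

/-- The class `𝒦`: continuous compactly supported functions that are differentiable along every
closed cable, with essentially bounded derivative. -/
def IsCore (u : G.CableSpace → ℝ) : Prop :=
  Continuous u ∧ HasCompactSupport u ∧
    (∀ e : G.Dart, DifferentiableOn ℝ (fun s => u (e.cable s)) (Icc 0 1)) ∧
    eLpNorm (edgeDeriv u) ∞ G.dartMeasure < ∞

/-- `g` is the gradient of `u` in the sense of the closure of the form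
`ℰ(φ, φ) = ∑ ∫ |∇φ|²` on `𝒦`: for some sequence in `𝒦` the functions converge to `u` and their
derivatives converge to `g`, both in `L²`. -/
def IsGradient (u : G.CableSpace → ℝ) (g : G.Dart × ℝ → ℝ) : Prop :=
  MemLp u 2 G.cableMeasure ∧ MemLp g 2 G.dartMeasure ∧
    ∃ φ : ℕ → G.CableSpace → ℝ, (∀ n, IsCore (φ n)) ∧
      Tendsto (fun n => eLpNorm (φ n - u) 2 G.cableMeasure) atTop (𝓝 0) ∧
      Tendsto (fun n => eLpNorm (edgeDeriv (φ n) - g) 2 G.dartMeasure) atTop (𝓝 0)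

/-- Membership in the domain `ℱ` of the Dirichlet form, the `ℰ₁`-closure of `𝒦` in `L²`. -/
def MemForm (u : G.CableSpace → ℝ) : Prop := ∃ g, IsGradient u g

open Classical in
/-- The gradient of `u ∈ ℱ` along oriented edges (unique almost everywhere). -/
def gradient (u : G.CableSpace → ℝ) : G.Dart × ℝ → ℝ :=
  if h : MemForm u then h.choose else 0

/-- The Dirichlet form `ℰ(u, v) = ∫ ∇u ∇v dm`, a sum over unoriented edges. -/
def energy (u v : G.CableSpace → ℝ) : ℝ :=
  2⁻¹ * ∫ z, gradient u z * gradient v z ∂G.dartMeasure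

/-- `u ∈ ℱ` is harmonic in the open set `D`: `ℰ(u, φ) = 0` for all `φ ∈ ℱ ∩ C_c(D)`. -/
def IsHarmonicIn (u : G.CableSpace → ℝ) (D : Set G.CableSpace) : Prop :=
  MemForm u ∧ ∀ φ : G.CableSpace → ℝ, MemForm φ → Continuous φ → HasCompactSupport φ →
    tsupport φ ⊆ D → energy u φ = 0

/-- The norm `‖|∇u|‖` in `L^∞(B)`. -/
def gradientSupNorm (u : G.CableSpace → ℝ) (B : Set G.CableSpace) : ℝ≥0∞ :=
  eLpNorm (gradient u) ∞ (G.dartMeasure.restrict (cableMap ⁻¹' B))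

variable (G) in
/-- The generalized reverse Hölder inequality `GRH(Φ, Ψ)` on the cable system of `G`. -/
def GeneralizedReverseHolder (Φ Ψ : ℝ → ℝ) : Prop :=
  ∃ C : ℝ, 0 < C ∧ ∀ (x : G.CableSpace) (r : ℝ), 0 < r → ∀ u : G.CableSpace → ℝ,
    IsHarmonicIn u (Metric.ball x (2 * r)) →
      gradientSupNorm u (Metric.ball x r) ≤
        ENNReal.ofReal (C * (Φ r / Ψ r) * ⨍ y in Metric.ball x (2 * r), |u y| ∂G.cableMeasure)

end SimpleGraph

/-- `Φ(r) = r` for `r < 1` and `r ^ α` for `r ≥ 1`. -/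
def scalePhi (α : ℝ) (r : ℝ) : ℝ := if r < 1 then r else r ^ α

/-- `Ψ(r) = r ^ 2` for `r < 1` and `r ^ β` for `r ≥ 1`. -/
def scalePsi (β : ℝ) (r : ℝ) : ℝ := if r < 1 then r ^ 2 else r ^ β

/-! ### Infinite graphs obtained by blowing up a self-similar set -/

/-- `S₀ = S` and `Sₙ₊₁ = ⋃ᵢ fᵢ(Sₙ)`. -/
def ifsIter {α ι : Type*} (f : ι → α → α) (S : Set α) : ℕ → Set α
  | 0 => S
  | n + 1 => ⋃ i, f i '' ifsIter f S n

/-- The vertex set `⋃ₙ cⁿ Vₙ`. -/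
def blowUpVertices {d : ℕ} {ι : Type*} (c : ℝ) (f : ι → (Fin d → ℝ) → (Fin d → ℝ))
    (S : Set (Fin d → ℝ)) : Set (Fin d → ℝ) :=
  ⋃ n, (fun x => c ^ n • x) '' ifsIter f S n

/-- The graph on `⋃ₙ cⁿ Vₙ` with edge set `⋃ₙ cⁿ Eₙ`, where `E₀ = E` and `Eₙ₊₁ = ⋃ᵢ fᵢ(Eₙ)`. -/
def blowUpGraph {d : ℕ} {ι : Type*} (c : ℝ) (f : ι → (Fin d → ℝ) → (Fin d → ℝ))
    (S : Set (Fin d → ℝ)) (E : Set ((Fin d → ℝ) × (Fin d → ℝ))) :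
    SimpleGraph (blowUpVertices c f S) :=
  SimpleGraph.fromRel fun p q => ∃ n, ∃ e ∈ ifsIter (fun i => Prod.map (f i) (f i)) E n,
    (p : Fin d → ℝ) = c ^ n • e.1 ∧ (q : Fin d → ℝ) = c ^ n • e.2

section Connected

variable {d : ℕ} {ι : Type*} {c : ℝ} {f : ι → (Fin d → ℝ) → (Fin d → ℝ)} {P : ι → Fin d → ℝ}
  {E : Set ((Fin d → ℝ) × (Fin d → ℝ))}

lemma mem_ifsIter_of_fixed (hfix : ∀ i, f i (P i) = P i) (i : ι) (n : ℕ) :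
    P i ∈ ifsIter f (range P) n := by
  induction n with
  | zero => exact ⟨i, rfl⟩
  | succ n ih => exact mem_iUnion.2 ⟨i, P i, ih, hfix i⟩

lemma eqvGen_ifsIter (hfix : ∀ i, f i (P i) = P i)
    (hE : ∀ i j, Relation.EqvGen (fun x y => (x, y) ∈ E) (P i) (P j))
    (o : ι) (hub : ∀ i, ∃ j k, f i (P j) = f o (P k)) (n : ℕ) :
    ∀ x ∈ ifsIter f (range P) n, ∀ y ∈ ifsIter f (range P) n,
      Relation.EqvGen (fun x y => (x, y) ∈ ifsIter (fun i => Prod.map (f i) (f i)) E n) x y := by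
  induction n with
  | zero =>
    rintro _ ⟨i, rfl⟩ _ ⟨j, rfl⟩
    exact hE i j
  | succ n ih =>
    have step : ∀ i x, x ∈ ifsIter f (range P) n → ∀ y ∈ ifsIter f (range P) n,
        Relation.EqvGen (fun x y => (x, y) ∈ ifsIter (fun i => Prod.map (f i) (f i)) E (n + 1))
          (f i x) (f i y) := by
      intro i x hx y hy
      have := ih x hx y hy
      clear hx hy
      induction this with
      | rel x y h => exact .rel _ _ (mem_iUnion.2 ⟨i, (x, y), h, rfl⟩)
      | refl x => exact .refl _
      | symm x y _ h => exact h.symm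
      | trans x y z _ _ h1 h2 => exact h1.trans _ _ _ h2
    have toHub : ∀ i x, x ∈ ifsIter f (range P) n → ∀ y ∈ ifsIter f (range P) n,
        Relation.EqvGen (fun x y => (x, y) ∈ ifsIter (fun i => Prod.map (f i) (f i)) E (n + 1))
          (f i x) (f o y) := by
      intro i x hx y hy
      obtain ⟨j, k, h⟩ := hub i
      refine (step i x hx _ (mem_ifsIter_of_fixed hfix j n)).trans _ _ _ ?_
      rw [h]
      exact step o _ (mem_ifsIter_of_fixed hfix k n) y hy
    intro x hx y hy
    obtain ⟨i, x', hx', rfl⟩ := mem_iUnion.1 hx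
    obtain ⟨j, y', hy', rfl⟩ := mem_iUnion.1 hy
    exact (toHub i x' hx' x' hx').trans _ _ _ (toHub j y' hy' x' hx').symm

lemma blowUp_mono (hc : c ≠ 0) {z : ι} (hz : ∀ x, f z x = c⁻¹ • x) {S : Set (Fin d → ℝ)}
    {n m : ℕ} (h : n ≤ m) :
    (fun x => c ^ n • x) '' ifsIter f S n ⊆ (fun x => c ^ m • x) '' ifsIter f S m := by
  induction m, h using Nat.le_induction with
  | base => exact subset_rfl
  | succ m _ ih =>
    refine ih.trans ?_
    rintro _ ⟨x, hx, rfl⟩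
    refine ⟨f z x, mem_iUnion.2 ⟨z, x, hx, rfl⟩, ?_⟩
    simp only [hz, smul_smul, pow_succ]
    rw [mul_assoc, mul_inv_cancel₀ hc, mul_one]

lemma blowUpGraph_connected (hc : c ≠ 0) {z : ι} (hz : ∀ x, f z x = c⁻¹ • x)
    (hfix : ∀ i, f i (P i) = P i) (hE0 : ∀ e ∈ E, e.1 ∈ range P ∧ e.2 ∈ range P)
    (hE : ∀ i j, Relation.EqvGen (fun x y => (x, y) ∈ E) (P i) (P j))
    (o : ι) (hub : ∀ i, ∃ j k, f i (P j) = f o (P k)) :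
    (blowUpGraph c f (range P) E).Connected := by
  have hmem : ∀ n, ∀ e ∈ ifsIter (fun i => Prod.map (f i) (f i)) E n,
      e.1 ∈ ifsIter f (range P) n ∧ e.2 ∈ ifsIter f (range P) n := by
    intro n
    induction n with
    | zero => exact hE0
    | succ n ih =>
      intro e he
      obtain ⟨i, e', he', rfl⟩ := mem_iUnion.1 he
      exact ⟨mem_iUnion.2 ⟨i, _, (ih e' he').1, rfl⟩, mem_iUnion.2 ⟨i, _, (ih e' he').2, rfl⟩⟩
  have hreach : ∀ n x y, Relation.EqvGen
      (fun x y => (x, y) ∈ ifsIter (fun i => Prod.map (f i) (f i)) E n) x y →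
      x = y ∨ ∃ (hx : c ^ n • x ∈ blowUpVertices c f (range P))
        (hy : c ^ n • y ∈ blowUpVertices c f (range P)),
        (blowUpGraph c f (range P) E).Reachable ⟨_, hx⟩ ⟨_, hy⟩ := by
    intro n x y h
    induction h with
    | rel x y h =>
      rcases eq_or_ne (c ^ n • x) (c ^ n • y) with h' | h'
      · exact Or.inl (smul_right_injective _ (pow_ne_zero n hc) h')
      · refine Or.inr ⟨mem_iUnion.2 ⟨n, x, (hmem n _ h).1, rfl⟩,
          mem_iUnion.2 ⟨n, y, (hmem n _ h).2, rfl⟩, SimpleGraph.Adj.reachable ?_⟩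
        refine (SimpleGraph.fromRel_adj _ _ _).2 ⟨fun h => h' (Subtype.ext_iff.1 h), Or.inl ?_⟩
        exact ⟨n, (x, y), h, rfl, rfl⟩
    | refl x => exact Or.inl rfl
    | symm x y _ h =>
      rcases h with rfl | ⟨h1, h2, h3⟩
      · exact Or.inl rfl
      · exact Or.inr ⟨h2, h1, h3.symm⟩
    | trans x y z _ _ h h' =>
      rcases h with rfl | ⟨h1, h2, h3⟩
      · exact h'
      · rcases h' with rfl | ⟨h4, h5, h6⟩
        · exact Or.inr ⟨h1, h2, h3⟩
        · exact Or.inr ⟨h1, h5, h3.trans h6⟩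
  refine (SimpleGraph.connected_iff _).2 ⟨?_, ⟨P z, mem_iUnion.2 ⟨0, P z, ⟨z, rfl⟩, by simp⟩⟩⟩
  rintro ⟨p, hp⟩ ⟨q, hq⟩
  obtain ⟨n, hn⟩ := mem_iUnion.1 hp
  obtain ⟨m, hm⟩ := mem_iUnion.1 hq
  obtain ⟨x, hx, rfl⟩ := blowUp_mono hc hz (le_max_left n m) hn
  obtain ⟨y, hy, rfl⟩ := blowUp_mono hc hz (le_max_right n m) hm
  rcases hreach _ _ _ (eqvGen_ifsIter hfix hE o hub _ x hx y hy) with rfl | ⟨_, _, h⟩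
  · rfl
  · exact h

end Connected

/-! ### The Vicsek graphs -/

/-- The vertices of the cube `[0, 2/√N]^N` (indexed by `some ε`) and its centre (`none`). -/
def vicsekPoint (N : ℕ) : Option (Fin N → Bool) → Fin N → ℝ
  | some ε => fun j => if ε j then 2 / √N else 0
  | none => fun _ => 1 / √N

/-- The contractions `fᵢ(x) = x / 3 + (2 / 3) pᵢ` of the `N`-dimensional Vicsek set. -/
def vicsekMap (N : ℕ) (i : Option (Fin N → Bool)) (x : Fin N → ℝ) : Fin N → ℝ :=
  (1 / 3 : ℝ) • x + (2 / 3 : ℝ) • vicsekPoint N i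

/-- The `N`-dimensional Vicsek graph: in the smallest cells, which are translates of `V₀`, the
centre is joined to every corner. -/
def vicsekGraph (N : ℕ) :
    SimpleGraph (blowUpVertices 3 (vicsekMap N) (range (vicsekPoint N))) :=
  blowUpGraph 3 (vicsekMap N) (range (vicsekPoint N))
    (range fun ε => (vicsekPoint N (some ε), vicsekPoint N none))

instance (N : ℕ) : Fact (vicsekGraph N).Connected := by
  refine ⟨blowUpGraph_connected (z := some fun _ => false) (by norm_num) ?_ ?_ ?_ ?_ none ?_⟩
  · intro x
    ext j
    simp [vicsekMap, vicsekPoint]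
  · intro i
    ext j
    simp only [vicsekMap, Pi.add_apply, Pi.smul_apply, smul_eq_mul]
    ring
  · rintro _ ⟨ε, rfl⟩
    exact ⟨⟨some ε, rfl⟩, ⟨none, rfl⟩⟩
  · have h : ∀ i, Relation.EqvGen (fun x y => (x, y) ∈
        range fun ε => (vicsekPoint N (some ε), vicsekPoint N none))
        (vicsekPoint N i) (vicsekPoint N none) := by
      rintro (_ | ε)
      · exact .refl _
      · exact .rel _ _ ⟨ε, rfl⟩
    exact fun i j => (h i).trans _ _ _ (h j).symm
  · rintro (_ | ε)
    · exact ⟨none, none, rfl⟩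
    · refine ⟨some fun j => !ε j, some ε, ?_⟩
      ext j
      simp only [vicsekMap, vicsekPoint, Pi.add_apply, Pi.smul_apply, smul_eq_mul]
      rcases Bool.eq_false_or_eq_true (ε j) with h | h <;> simp only [h] <;> simp <;> ring

/-! ### The Sierpiński graph -/

/-- The vertices of the unit equilateral triangle. -/
def sierpinskiPoint : Fin 3 → Fin 2 → ℝ := ![![0, 0], ![1, 0], ![1 / 2, √3 / 2]]

/-- The contractions `fᵢ(x) = (x + pᵢ) / 2` of the Sierpiński gasket. -/
def sierpinskiMap (i : Fin 3) (x : Fin 2 → ℝ) : Fin 2 → ℝ :=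
  (1 / 2 : ℝ) • (x + sierpinskiPoint i)

/-- The Sierpiński graph: in the smallest cells, which are translates of `V₀`, any two distinct
vertices are joined. -/
def sierpinskiGraph :
    SimpleGraph (blowUpVertices 2 sierpinskiMap (range sierpinskiPoint)) :=
  blowUpGraph 2 sierpinskiMap (range sierpinskiPoint)
    {e | ∃ i j, i ≠ j ∧ e = (sierpinskiPoint i, sierpinskiPoint j)}

instance : Fact sierpinskiGraph.Connected := by
  refine ⟨blowUpGraph_connected (z := 0) (by norm_num) ?_ ?_ ?_ ?_ 0 ?_⟩
  · intro x
    ext j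
    fin_cases j <;> simp [sierpinskiMap, sierpinskiPoint, Matrix.vecHead, Matrix.vecTail]
  · intro i
    ext j
    simp only [sierpinskiMap, Pi.add_apply, Pi.smul_apply, smul_eq_mul]
    ring
  · rintro _ ⟨i, j, -, rfl⟩
    exact ⟨⟨_, rfl⟩, ⟨_, rfl⟩⟩
  · intro i j
    rcases eq_or_ne i j with rfl | h
    · exact .refl _
    · exact .rel _ _ ⟨i, j, h, rfl⟩
  · intro i
    refine ⟨0, i, ?_⟩
    simp only [sierpinskiMap, add_comm]

end

/-!
Both graphs are made of cells: an `n`-cell is the union of finitely many `(n - 1)`-cells, and two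
cells of the same level meet at corners only. The scales of the inequality are such that
`Φ(cⁿ) / Ψ(cⁿ) = ρⁿ`, where `c` is the scaling factor of the graph (`3` or `2`) and `ρ < 1` is a
renormalization constant (`1 / 3` for the Vicsek graphs, `3 / 5` for the Sierpiński graph).

*Reduction to the vertices.* A harmonic function has a continuous representative that is affine on
the parts of the cables inside the domain (`IsRep.exists_slope`, from the du Bois-Reymond lemma),
and at the vertices its slopes satisfy Kirchhoff's law (`IsRep.sum_increments_eq_zero`). Hence its
gradient on a cable is the difference of the values at the ends, and on a cell inside the domain the
values at the vertices form a function that is harmonic, for the graph Laplacian, off the corners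
of the cell (`CellData.IsCellGraph.isHarmonicCell`).

*Renormalization.* Consider a function on an `(n + 1)`-cell that is harmonic off its corners.
The flux out of a corner of an `n`-cell is `ρⁿ` times the flux in the graph formed by the corners
of that cell (`lap_eq_pow`), so that the values at the corners of the `n`-cells solve the harmonic
extension problem of the once subdivided basic cell. This finite linear problem is solved explicitly
for each family of graphs (`vicsekCells.extension`, `sierpinskiCells.midpoint_eq`); in both cases
the increments shrink at least by the factor `ρ`. If `M` is the largest increment between corners of
an `n`-cell, the gradient is therefore at most `ρⁿ M` on the cell (`abs_edge_le`), and the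
oscillation on the cell is at most `2 M / (1 - ρ)`, a geometric series (`abs_sub_corner_le`).

*Comparison with the mean.* At some corner the absolute value is at least `M / 2`; on the subcell at
this corner that is `m` levels smaller, with `m` fixed, the oscillation is at most `M / 4`, and so
the absolute value is at least `M / 4` there (`exists_large_cell`). This subcell carries a fixed
proportion of the mass of the ball, because a ball of radius comparable to `cⁿ` meets a bounded
number of `n`-cells (`CellData.IsCellGraph.exists_card_le`). Thus `M` is bounded by the mean of the
absolute value over the ball, which proves the inequality for large radii
(`CellData.IsCellGraph.abs_gradient_le_of_ge`). For bounded radii the affine function on a single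
cable already gives the bound (`abs_gradient_le_of_le`).

The properties of the cells on which this relies are collected in `CellData.IsHarmonicStructure`.
-/

noncomputable section

namespace SimpleGraph

variable {V : Type*} {G : SimpleGraph V}

/-! ### Functions on the cable space given by profiles along the edges -/

lemma Dart.cable_of_mem (e : G.Dart) {t : ℝ} (ht : t ∈ Icc (0 : ℝ) 1) :
    e.cable t = e.point ⟨t, ht⟩ := by
  rw [Dart.cable, projIcc_of_mem]

lemma Dart.cable_coe (e : G.Dart) (a : I) : e.cable a = e.point a :=
  e.cable_of_mem a.2

lemma Dart.symm_cable (e : G.Dart) {t : ℝ} (ht : t ∈ Icc (0 : ℝ) 1) :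
    e.symm.cable (1 - t) = e.cable t := by
  have ht' : 1 - t ∈ Icc (0 : ℝ) 1 := ⟨by linarith [ht.2], by linarith [ht.1]⟩
  rw [e.cable_of_mem ht, e.symm.cable_of_mem ht']
  exact CableSpace.symm_point e ⟨t, ht⟩

lemma Dart.cable_zero_eq {e f : G.Dart} (h : e.fst = f.fst) : e.cable 0 = f.cable 0 := by
  have h0 : (0 : ℝ) ∈ Icc (0 : ℝ) 1 := by simp
  rw [e.cable_of_mem h0, f.cable_of_mem h0]
  exact CableSpace.point_eq_point.2 (Or.inr (Or.inr ⟨f.fst, Or.inl ⟨rfl, h⟩, Or.inl ⟨rfl, rfl⟩⟩))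

lemma CableSpace.exists_cable (x : G.CableSpace) :
    ∃ (e : G.Dart) (t : ℝ), t ∈ Icc (0 : ℝ) 1 ∧ x = e.cable t := by
  obtain ⟨e, a, rfl⟩ := CableSpace.exists_point x
  exact ⟨e, a, a.2, (e.cable_coe a).symm⟩

/-- A family of functions on `[0,1]`, one for every oriented edge, that is compatible with the
gluing of the cables; `f` gives the values at the vertices. -/
structure IsProfile (q : G.Dart → ℝ → ℝ) (f : V → ℝ) : Prop where
  zero : ∀ e, q e 0 = f e.fst
  flip : ∀ e, ∀ t ∈ Icc (0 : ℝ) 1, q e.symm (1 - t) = q e t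

namespace IsProfile

variable {q : G.Dart → ℝ → ℝ} {f : V → ℝ}

lemma one (hq : IsProfile q f) (e : G.Dart) : q e 1 = f e.snd := by
  have h := hq.flip e 1 (by simp)
  rw [sub_self, hq.zero] at h
  exact h.symm

lemma eq_of_isCableEnd (hq : IsProfile q f) {x : G.Dart × I} {v : V} (h : G.IsCableEnd x v) :
    q x.1 x.2 = f v := by
  rcases h with ⟨h1, h2⟩ | ⟨h1, h2⟩
  · rw [h1, Icc.coe_zero, hq.zero, h2]
  · rw [h1, Icc.coe_one, hq.one, h2]

/-- The function on the cable space with the given profiles. -/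
def glue (hq : IsProfile q f) (x : G.CableSpace) : ℝ :=
  Quotient.liftOn x (fun p : G.Dart × I => q p.1 p.2) <| by
    rintro ⟨e, a⟩ ⟨e', b⟩ (h | ⟨h1, h2⟩ | ⟨v, h1, h2⟩)
    · rw [h]
    · simp only at h1 h2
      subst h1 h2
      exact (hq.flip e a a.2).symm
    · exact (hq.eq_of_isCableEnd h1).trans (hq.eq_of_isCableEnd h2).symm

lemma glue_point (hq : IsProfile q f) (e : G.Dart) (a : I) : hq.glue (e.point a) = q e a := rfl

lemma glue_cable (hq : IsProfile q f) (e : G.Dart) {t : ℝ} (ht : t ∈ Icc (0 : ℝ) 1) :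
    hq.glue (e.cable t) = q e t := by
  rw [e.cable_of_mem ht, glue_point]

/-- Profiles with a common Lipschitz constant are glued to a Lipschitz function: the oscillation is
summed up along a shortest path. -/
lemma abs_sub_le_dist [Fact G.Connected] (hq : IsProfile q f) {L : ℝ} (hL : 0 ≤ L)
    (h : ∀ e, ∀ s ∈ Icc (0 : ℝ) 1, ∀ t ∈ Icc (0 : ℝ) 1, |q e s - q e t| ≤ L * |s - t|)
    (x y : G.CableSpace) : |hq.glue x - hq.glue y| ≤ L * Dist.dist x y := by
  have hwalk : ∀ v w : V, |f v - f w| ≤ L * G.dist v w := by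
    intro v w
    obtain ⟨p, hp⟩ := (Fact.out : G.Connected).exists_walk_length_eq_dist v w
    rw [← hp]
    clear hp
    induction p with
    | nil => simp
    | @cons u v w huv p ih =>
      have h1 := h ⟨(u, v), huv⟩ 0 (by simp) 1 (by simp)
      rw [hq.zero, hq.one] at h1
      simp only [zero_sub, abs_neg, abs_one, mul_one] at h1
      rw [Walk.length_cons]
      push_cast
      have h2 := abs_sub_le (f u) (f v) (f w)
      linarith
  have hend : ∀ (e : G.Dart) (a : I), |q e a - f e.fst| ≤ L * a := by
    intro e a
    have h1 := h e a a.2 0 (by simp)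
    rwa [hq.zero, sub_zero, abs_of_nonneg a.2.1] at h1
  have hlen : ∀ l ∈ CableSpace.lengths x y, |hq.glue x - hq.glue y| ≤ L * l := by
    rintro l (⟨e, a, b, rfl, rfl, rfl⟩ | ⟨e, a, e', b, rfl, rfl, rfl⟩)
    · exact h e a a.2 b b.2
    · rw [glue_point, glue_point]
      have h1 := hend e a
      have h2 := hend e' b
      have h3 := hwalk e.fst e'.fst
      rw [abs_sub_comm] at h2
      have h4 := abs_sub_le (q e a) (f e.fst) (q e' b)
      have h5 := abs_sub_le (f e.fst) (f e'.fst) (q e' b)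
      linarith
  rw [CableSpace.dist_def]
  rcases hL.eq_or_lt with rfl | hL
  · obtain ⟨l, hl⟩ := CableSpace.lengths_nonempty x y
    simpa using hlen l hl
  · rw [← div_le_iff₀' hL]
    refine le_csInf (CableSpace.lengths_nonempty x y) fun l hl => ?_
    rw [div_le_iff₀' hL]
    exact hlen l hl

lemma continuous_glue [Fact G.Connected] (hq : IsProfile q f) {L : ℝ} (hL : 0 ≤ L)
    (h : ∀ e, ∀ s ∈ Icc (0 : ℝ) 1, ∀ t ∈ Icc (0 : ℝ) 1, |q e s - q e t| ≤ L * |s - t|) :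
    Continuous hq.glue := by
  refine (LipschitzWith.of_dist_le_mul (K := ⟨L, hL⟩) fun x y => ?_).continuous
  exact hq.abs_sub_le_dist hL h x y

end IsProfile

/-- Linear interpolation of a function on the vertices. -/
lemma isProfile_linear (f : V → ℝ) :
    IsProfile (fun (e : G.Dart) t => f e.fst + t * (f e.snd - f e.fst)) f where
  zero e := by simp
  flip e t _ := by
    have h1 : e.symm.fst = e.snd := rfl
    have h2 : e.symm.snd = e.fst := rfl
    rw [h1, h2]
    ring

lemma abs_linear_sub_le_dist [Fact G.Connected] {f : V → ℝ} {L : ℝ} (hL : 0 ≤ L)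
    (h : ∀ e : G.Dart, |f e.snd - f e.fst| ≤ L) (x y : G.CableSpace) :
    |(isProfile_linear (G := G) f).glue x - (isProfile_linear f).glue y| ≤ L * Dist.dist x y := by
  refine (isProfile_linear f).abs_sub_le_dist hL (fun e s _ t _ => ?_) x y
  rw [show f e.fst + s * (f e.snd - f e.fst) - (f e.fst + t * (f e.snd - f e.fst)) =
    (f e.snd - f e.fst) * (s - t) by ring, abs_mul]
  exact mul_le_mul_of_nonneg_right (h e) (abs_nonneg _)

/-! ### The metric along a cable -/

lemma Dart.dist_cable_zero_le (e f : G.Dart) :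
    Dist.dist (e.cable 0) (f.cable 0) ≤ G.dist e.fst f.fst := by
  rw [CableSpace.dist_def]
  have h0 : (0 : ℝ) ∈ Icc (0 : ℝ) 1 := by simp
  refine csInf_le (CableSpace.lengths_bddBelow _ _)
      (Or.inr ⟨e, 0, f, 0, e.cable_of_mem h0, f.cable_of_mem h0, by simp⟩)

section Metric

variable [Fact G.Connected]

/-- Cables are isometrically embedded intervals: a lower bound for the distance comes from the
interpolation of the graph distance to an end of the cable. -/
lemma Dart.dist_cable (e : G.Dart) {s t : ℝ} (hs : s ∈ Icc (0 : ℝ) 1) (ht : t ∈ Icc (0 : ℝ) 1) :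
    Dist.dist (e.cable s) (e.cable t) = |s - t| := by
  refine le_antisymm ?_ ?_
  · rw [CableSpace.dist_def]
    exact csInf_le (CableSpace.lengths_bddBelow _ _)
      (Or.inl ⟨e, ⟨s, hs⟩, ⟨t, ht⟩, e.cable_of_mem hs, e.cable_of_mem ht, rfl⟩)
  · have h := abs_linear_sub_le_dist (G := G) (f := fun v => (G.dist e.fst v : ℝ)) zero_le_one
      (fun a => ?_) (e.cable s) (e.cable t)
    · rw [IsProfile.glue_cable _ e hs, IsProfile.glue_cable _ e ht] at h
      simpa [CableSpace.dist_fst_snd] using h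
    · have h1 := CableSpace.dist_tri (G := G) e.fst a.fst a.snd
      have h2 := CableSpace.dist_tri (G := G) e.fst a.snd a.fst
      rw [SimpleGraph.dist_comm (u := a.snd)] at h2
      rw [CableSpace.dist_fst_snd] at h1 h2
      rw [abs_le]
      push_cast at h1 h2
      constructor <;> linarith

lemma Dart.continuous_cable (e : G.Dart) : Continuous e.cable := by
  have h : Continuous e.point := by
    refine (Isometry.of_dist_eq fun a b => ?_).continuous
    rw [← e.cable_coe, ← e.cable_coe, e.dist_cable a.2 b.2]
    rfl
  exact h.comp continuous_projIcc

lemma Dart.dist_cable_le (e f : G.Dart) {s t : ℝ} (hs : s ∈ Icc (0 : ℝ) 1)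
    (ht : t ∈ Icc (0 : ℝ) 1) :
    Dist.dist (e.cable s) (f.cable t) ≤ G.dist e.fst f.fst + 2 := by
  have h0 : (0 : ℝ) ∈ Icc (0 : ℝ) 1 := by simp
  have h1 := dist_triangle4 (e.cable s) (e.cable 0) (f.cable 0) (f.cable t)
  rw [e.dist_cable hs h0, f.dist_cable h0 ht, sub_zero, abs_of_nonneg hs.1, zero_sub, abs_neg,
    abs_of_nonneg ht.1] at h1
  have := e.dist_cable_zero_le f
  linarith [hs.2, ht.2]

end Metric

/-! ### The measures -/

instance [Countable V] : Countable G.Dart :=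
  (Dart.toProd_injective (G := G)).countable

instance : MeasurableSingletonClass G.Dart := ⟨fun _ => trivial⟩

section Measure

lemma measurableEmbedding_dart (e : G.Dart) :
    MeasurableEmbedding (fun t : ℝ => (e, t)) :=
  measurableEmbedding_prodMk_left e

/-- On a single oriented edge, the measure is Lebesgue measure on `[0,1]`. -/
lemma dartMeasure_restrict_dart [Countable V] (e : G.Dart) :
    G.dartMeasure.restrict ({e} ×ˢ univ) =
      (volume.restrict (Icc (0 : ℝ) 1)).map (fun t => (e, t)) := by
  rw [dartMeasure, ← Measure.prod_restrict, Measure.restrict_univ, Measure.restrict_singleton,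
    Measure.count_singleton, one_smul, Measure.dirac_prod]

lemma map_dart_le [Countable V] (e : G.Dart) :
    (volume.restrict (Icc (0 : ℝ) 1)).map (fun t => (e, t)) ≤ G.dartMeasure := by
  rw [← dartMeasure_restrict_dart]
  exact Measure.restrict_le_self

lemma eLpNorm_dart_le [Countable V] (e : G.Dart) (g : G.Dart × ℝ → ℝ) (p : ℝ≥0∞) :
    eLpNorm (fun t => g (e, t)) p (volume.restrict (Icc (0 : ℝ) 1)) ≤
      eLpNorm g p G.dartMeasure := by
  have h := (measurableEmbedding_dart e).eLpNorm_map_measure (g := g) (p := p)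
    (μ := volume.restrict (Icc (0 : ℝ) 1))
  have h' := eLpNorm_mono_measure (p := p) g (map_dart_le e)
  rw [h] at h'
  exact h'

lemma memLp_dart [Countable V] (e : G.Dart) {g : G.Dart × ℝ → ℝ} {p : ℝ≥0∞}
    (hg : MemLp g p G.dartMeasure) :
    MemLp (fun t => g (e, t)) p (volume.restrict (Icc (0 : ℝ) 1)) := by
  have h := (measurableEmbedding_dart e).memLp_map_measure_iff (g := g) (p := p)
    (μ := volume.restrict (Icc (0 : ℝ) 1))
  exact h.1 (hg.mono_measure (map_dart_le e))

lemma ae_dartMeasure_iff [Countable V] {p : G.Dart × ℝ → Prop} :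
    (∀ᵐ z ∂G.dartMeasure, p z) ↔
      ∀ e : G.Dart, ∀ᵐ t ∂(volume.restrict (Icc (0 : ℝ) 1)), p (e, t) := by
  have hU : (univ : Set (G.Dart × ℝ)) = ⋃ e : G.Dart, {e} ×ˢ univ := by
    ext z
    simp
  rw [← Measure.restrict_univ (μ := G.dartMeasure), hU, ae_restrict_iUnion_iff]
  refine forall_congr' fun e => ?_
  rw [dartMeasure_restrict_dart, (measurableEmbedding_dart e).ae_map_iff]

lemma integral_dart [Countable V] (e : G.Dart) (g : G.Dart × ℝ → ℝ) :
    ∫ z in {e} ×ˢ univ, g z ∂G.dartMeasure = ∫ t in (0 : ℝ)..1, g (e, t) := by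
  rw [dartMeasure_restrict_dart, (measurableEmbedding_dart e).integral_map,
    intervalIntegral.integral_of_le zero_le_one, integral_Icc_eq_integral_Ioc]

variable [Fact G.Connected]

lemma measurable_cableMap [Countable V] : Measurable (cableMap : G.Dart × ℝ → G.CableSpace) :=
  measurable_from_prod_countable_right fun e => e.continuous_cable.measurable

/-- The factor `1 / 2` is due to every edge being represented by its two orientations. -/
lemma cableMeasure_apply [Countable V] {B : Set G.CableSpace} (hB : MeasurableSet B) :
    G.cableMeasure B = 2⁻¹ * G.dartMeasure (cableMap ⁻¹' B) := by
  rw [cableMeasure, Measure.smul_apply, Measure.map_apply measurable_cableMap hB, smul_eq_mul]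

lemma memLp_cableMeasure_iff [Countable V] {u : G.CableSpace → ℝ} {p : ℝ≥0∞}
    (hu : AEStronglyMeasurable u G.cableMeasure) :
    MemLp u p G.cableMeasure ↔ MemLp (fun z => u (cableMap z)) p G.dartMeasure := by
  have h2 : (2⁻¹ : ℝ≥0∞) ≠ 0 := by simp
  have hu' : AEStronglyMeasurable u (G.dartMeasure.map cableMap) :=
    hu.mono_ac (Measure.absolutelyContinuous_smul h2)
  have h3 : MemLp u p G.cableMeasure ↔ MemLp u p (G.dartMeasure.map cableMap) := by
    refine ⟨fun h => ?_, fun h => h.smul_measure (by simp)⟩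
    have := h.smul_measure (c := 2) (by simp)
    rwa [cableMeasure, smul_smul, ENNReal.mul_inv_cancel (by simp) (by simp), one_smul] at this
  rw [h3, memLp_map_measure_iff hu' measurable_cableMap.aemeasurable]
  rfl

lemma eLpNorm_cable_le [Countable V] (e : G.Dart) {u : G.CableSpace → ℝ}
    (hu : AEStronglyMeasurable u G.cableMeasure) :
    eLpNorm (fun t => u (e.cable t)) 2 (volume.restrict (Icc (0 : ℝ) 1)) ≤
      2 * eLpNorm u 2 G.cableMeasure := by
  have h2 : (2⁻¹ : ℝ≥0∞) ≠ 0 := by simp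
  have hu' : AEStronglyMeasurable u (G.dartMeasure.map cableMap) :=
    hu.mono_ac (Measure.absolutelyContinuous_smul h2)
  have h1 := eLpNorm_dart_le e (fun z => u (cableMap z)) 2
  have h3 : eLpNorm (fun z => u (cableMap z)) 2 G.dartMeasure =
      eLpNorm u 2 (G.dartMeasure.map cableMap) :=
    (eLpNorm_map_measure hu' measurable_cableMap.aemeasurable).symm
  rw [h3] at h1
  refine h1.trans ?_
  have h4 : G.dartMeasure.map cableMap = (2 : ℝ≥0∞) • G.cableMeasure := by
    rw [cableMeasure, smul_smul, ENNReal.mul_inv_cancel (by simp) (by simp), one_smul]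
  rw [h4, eLpNorm_smul_measure_of_ne_top (by simp), smul_eq_mul]
  gcongr
  refine (ENNReal.rpow_le_rpow_of_exponent_le (by simp) (?_ : _ ≤ (1 : ℝ))).trans (by simp)
  simp
  norm_num

end Measure

end SimpleGraph

/-! ### Limits of primitives on the unit interval -/

instance isProbabilityMeasure_restrict_unitInterval :
    IsProbabilityMeasure ((volume : Measure ℝ).restrict (Icc 0 1)) :=
  ⟨by simp⟩

lemma intervalIntegrable_of_integrable_unit {g : ℝ → ℝ}
    (hg : Integrable g (volume.restrict (Icc (0 : ℝ) 1))) {a b : ℝ} (ha : a ∈ Icc (0 : ℝ) 1)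
    (hb : b ∈ Icc (0 : ℝ) 1) : IntervalIntegrable g volume a b := by
  have h : IntegrableOn g (Icc 0 1) := hg
  exact (h.mono_set (ordConnected_Icc.uIcc_subset ha hb)).intervalIntegrable

lemma continuousOn_primitive_unit {g : ℝ → ℝ}
    (hg : Integrable g (volume.restrict (Icc (0 : ℝ) 1))) :
    ContinuousOn (fun s => ∫ t in (0 : ℝ)..s, g t) (Icc 0 1) := by
  have h := intervalIntegral.continuousOn_primitive_interval (μ := volume) (f := g) (a := 0)
    (b := 1) (by rw [uIcc_of_le zero_le_one]; exact hg)
  rwa [uIcc_of_le zero_le_one] at h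

lemma abs_primitive_le {g : ℝ → ℝ} (hg : MemLp g 2 (volume.restrict (Icc (0 : ℝ) 1))) {s : ℝ}
    (hs : s ∈ Icc (0 : ℝ) 1) :
    |∫ t in (0 : ℝ)..s, g t| ≤ (eLpNorm g 2 (volume.restrict (Icc (0 : ℝ) 1))).toReal := by
  have hg1 : Integrable g (volume.restrict (Icc (0 : ℝ) 1)) := hg.integrable (by norm_num)
  have h1 : |∫ t in (0 : ℝ)..s, g t| ≤ ∫ t in Icc (0 : ℝ) 1, |g t| := by
    rw [intervalIntegral.integral_of_le hs.1]
    refine abs_integral_le_integral_abs.trans ?_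
    refine setIntegral_mono_set hg1.abs (ae_of_all _ fun _ => abs_nonneg _) ?_
    exact (Ioc_subset_Icc_self.trans (Icc_subset_Icc_right hs.2)).eventuallyLE
  refine h1.trans ?_
  have h2 : ∫ t in Icc (0 : ℝ) 1, |g t| =
      (eLpNorm g 1 (volume.restrict (Icc (0 : ℝ) 1))).toReal := by
    rw [eLpNorm_one_eq_lintegral_enorm,
      ← integral_norm_eq_lintegral_enorm hg.aestronglyMeasurable]
    rfl
  rw [h2]
  refine ENNReal.toReal_mono hg.eLpNorm_ne_top ?_
  exact eLpNorm_le_eLpNorm_of_exponent_le (by norm_num) hg.aestronglyMeasurable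

/-- If functions and their derivatives converge in `L²(0,1)`, then the functions converge
everywhere, the limit being a primitive of the limit of the derivatives. -/
lemma exists_tendsto_primitive {p p' : ℕ → ℝ → ℝ} {u g : ℝ → ℝ}
    (hp : ∀ n, MemLp (p n) 2 (volume.restrict (Icc (0 : ℝ) 1)))
    (hp' : ∀ n, MemLp (p' n) 2 (volume.restrict (Icc (0 : ℝ) 1)))
    (hu : MemLp u 2 (volume.restrict (Icc (0 : ℝ) 1)))
    (hg : MemLp g 2 (volume.restrict (Icc (0 : ℝ) 1)))
    (hprim : ∀ n, ∀ s ∈ Icc (0 : ℝ) 1, p n s = p n 0 + ∫ t in (0 : ℝ)..s, p' n t)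
    (h0 : Tendsto (fun n => eLpNorm (p n - u) 2 (volume.restrict (Icc (0 : ℝ) 1))) atTop (𝓝 0))
    (h1 : Tendsto (fun n => eLpNorm (p' n - g) 2 (volume.restrict (Icc (0 : ℝ) 1))) atTop (𝓝 0)) :
    ∃ κ : ℝ, (∀ s ∈ Icc (0 : ℝ) 1,
        Tendsto (fun n => p n s) atTop (𝓝 (κ + ∫ t in (0 : ℝ)..s, g t))) ∧
      ∀ᵐ s ∂(volume.restrict (Icc (0 : ℝ) 1)), u s = κ + ∫ t in (0 : ℝ)..s, g t := by
  set μ := (volume : Measure ℝ).restrict (Icc 0 1) with hμ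
  set P : ℝ → ℝ := fun s => ∫ t in (0 : ℝ)..s, g t with hP
  have hgi : Integrable g μ := hg.integrable (by norm_num)
  have hpi : ∀ n, Integrable (p' n) μ := fun n => (hp' n).integrable (by norm_num)
  have hPm : MemLp P 2 μ := by
    have hc : ContinuousOn P (Icc 0 1) := continuousOn_primitive_unit hgi
    refine MemLp.of_bound (hc.aestronglyMeasurable measurableSet_Icc)
      ((eLpNorm g 2 μ).toReal) ?_
    refine (ae_restrict_iff' measurableSet_Icc).2 (ae_of_all _ fun s hs => ?_)
    exact abs_primitive_le hg hs
  have hdiff : ∀ n, ∀ s ∈ Icc (0 : ℝ) 1, |(p n s - p n 0) - P s| ≤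
      (eLpNorm (p' n - g) 2 μ).toReal := by
    intro n s hs
    have h0' : (0 : ℝ) ∈ Icc (0 : ℝ) 1 := by simp
    have : (p n s - p n 0) - P s = ∫ t in (0 : ℝ)..s, (p' n - g) t := by
      rw [hprim n s hs, add_sub_cancel_left]
      exact (intervalIntegral.integral_sub (intervalIntegrable_of_integrable_unit (hpi n) h0' hs)
        (intervalIntegrable_of_integrable_unit hgi h0' hs)).symm
    rw [this]
    exact abs_primitive_le ((hp' n).sub hg) hs
  have hε : Tendsto (fun n => (eLpNorm (p' n - g) 2 μ).toReal) atTop (𝓝 0) := by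
    have := (ENNReal.tendsto_toReal (by simp : (0 : ℝ≥0∞) ≠ ∞)).comp h1
    simpa [Function.comp_def] using this
  -- the initial values converge in `L²` to the function `u - P`, which is therefore constant
  have hconst : Tendsto (fun n => eLpNorm ((fun _ => p n 0) - (u - P)) 2 μ) atTop (𝓝 0) := by
    have hb : ∀ n, eLpNorm ((fun _ => p n 0) - (u - P)) 2 μ ≤
        eLpNorm (p n - u) 2 μ + eLpNorm (p' n - g) 2 μ := by
      intro n
      have h3 : (fun _ => p n 0) - (u - P) = (p n - u) - (p n - (fun _ => p n 0) - P) := by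
        ext s
        simp only [Pi.sub_apply]
        ring
      rw [h3]
      refine (eLpNorm_sub_le ((hp n).sub hu).aestronglyMeasurable
        (((hp n).sub (memLp_const _)).sub hPm).aestronglyMeasurable (by norm_num)).trans ?_
      gcongr
      refine (eLpNorm_le_of_ae_bound (C := (eLpNorm (p' n - g) 2 μ).toReal) ?_).trans ?_
      · exact (ae_restrict_iff' measurableSet_Icc).2 (ae_of_all _ fun s hs => hdiff n s hs)
      · rw [measure_univ, ENNReal.one_rpow, one_mul,
          ENNReal.ofReal_toReal ((hp' n).sub hg).eLpNorm_ne_top]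
    refine tendsto_of_tendsto_of_tendsto_of_le_of_le tendsto_const_nhds ?_ (fun _ => zero_le) hb
    simpa using h0.add h1
  have hup : MemLp (u - P) 2 μ := hu.sub hPm
  set κ : ℝ := ∫ s, (u - P) s ∂μ with hκ
  have hlim : Tendsto (fun n => p n 0) atTop (𝓝 κ) := by
    rw [tendsto_iff_norm_sub_tendsto_zero]
    have hb : ∀ n, ‖p n 0 - κ‖ ≤ (eLpNorm ((fun _ => p n 0) - (u - P)) 2 μ).toReal := by
      intro n
      have h3 : p n 0 - κ = ∫ t in (0 : ℝ)..1, ((fun _ => p n 0) - (u - P) : ℝ → ℝ) t := by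
        rw [intervalIntegral.integral_of_le zero_le_one, ← integral_Icc_eq_integral_Ioc]
        simp only [Pi.sub_apply]
        rw [integral_sub (integrable_const _)]
        · simp [hκ, hμ]
        · exact hup.integrable (by norm_num)
      rw [h3]
      exact abs_primitive_le ((memLp_const _).sub hup) (s := 1) (by simp)
    refine squeeze_zero (fun _ => norm_nonneg _) hb ?_
    have := (ENNReal.tendsto_toReal (by simp : (0 : ℝ≥0∞) ≠ ∞)).comp hconst
    simpa [Function.comp_def] using this
  refine ⟨κ, fun s hs => ?_, ?_⟩
  · have h3 : Tendsto (fun n => (p n s - p n 0) - P s) atTop (𝓝 0) :=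
      squeeze_zero_norm (fun n => hdiff n s hs) hε
    have h4 := (h3.add hlim).add_const (P s)
    rw [zero_add] at h4
    refine h4.congr fun n => ?_
    ring
  · have h3 : eLpNorm ((fun _ => κ) - (u - P)) 2 μ = 0 := by
      have hb : ∀ n, eLpNorm ((fun _ => κ) - (u - P)) 2 μ ≤
          ENNReal.ofReal |κ - p n 0| + eLpNorm ((fun _ => p n 0) - (u - P)) 2 μ := by
        intro n
        have h5 : (fun _ => κ) - (u - P) =
            (fun _ => κ - p n 0) + ((fun _ => p n 0) - (u - P)) := by
          ext s
          simp
        rw [h5]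
        refine (eLpNorm_add_le aestronglyMeasurable_const
          ((memLp_const _).sub hup).aestronglyMeasurable (by norm_num)).trans ?_
        gcongr
        rw [eLpNorm_const _ (by norm_num) (IsProbabilityMeasure.ne_zero μ), measure_univ,
          ENNReal.one_rpow, mul_one, Real.enorm_eq_ofReal_abs]
      refine le_antisymm (ge_of_tendsto' (x := atTop) ?_ hb) zero_le
      have h6 : Tendsto (fun n => |κ - p n 0|) atTop (𝓝 0) := by
        have := (hlim.const_sub κ).abs
        simpa using this
      simpa using (ENNReal.tendsto_ofReal h6).add hconst
    rw [eLpNorm_eq_zero_iff ((memLp_const _).sub hup).aestronglyMeasurable (by norm_num)] at h3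
    filter_upwards [h3] with s hs
    simp only [Pi.sub_apply, Pi.zero_apply] at hs
    simp only [hP] at hs
    linarith

namespace SimpleGraph

variable {V : Type*} [Countable V] {G : SimpleGraph V} [Fact G.Connected]

/-! ### Continuous representatives of functions of finite energy -/

omit [Countable V] [Fact G.Connected] in
lemma IsCore.edgeDeriv_ae {φ : G.CableSpace → ℝ} (e : G.Dart) :
    (fun t => edgeDeriv φ (e, t)) =ᵐ[volume.restrict (Icc (0 : ℝ) 1)]
      deriv (fun s => φ (e.cable s)) := by
  rw [← restrict_Ioo_eq_restrict_Icc]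
  refine (ae_restrict_iff' measurableSet_Ioo).2 (ae_of_all _ fun t ht => ?_)
  exact derivWithin_of_mem_nhds (Icc_mem_nhds ht.1 ht.2)

lemma IsCore.memLp_edgeDeriv {φ : G.CableSpace → ℝ} (hφ : IsCore φ) (e : G.Dart) :
    MemLp (fun t => edgeDeriv φ (e, t)) 2 (volume.restrict (Icc (0 : ℝ) 1)) := by
  have h : MemLp (fun t => edgeDeriv φ (e, t)) ∞ (volume.restrict (Icc (0 : ℝ) 1)) := by
    refine ⟨?_, (eLpNorm_dart_le e _ _).trans_lt hφ.2.2.2⟩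
    exact (aestronglyMeasurable_deriv _ _).congr (IsCore.edgeDeriv_ae e).symm
  exact h.mono_exponent le_top

lemma IsCore.eq_add_integral {φ : G.CableSpace → ℝ} (hφ : IsCore φ) (e : G.Dart) {s : ℝ}
    (hs : s ∈ Icc (0 : ℝ) 1) :
    φ (e.cable s) = φ (e.cable 0) + ∫ t in (0 : ℝ)..s, edgeDeriv φ (e, t) := by
  have hi : Integrable (fun t => edgeDeriv φ (e, t)) (volume.restrict (Icc (0 : ℝ) 1)) :=
    (hφ.memLp_edgeDeriv e).integrable (by norm_num)
  rw [intervalIntegral.integral_eq_sub_of_hasDerivAt_of_le (f := fun s => φ (e.cable s)) hs.1]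
  · ring
  · exact (hφ.1.comp e.continuous_cable).continuousOn
  · intro t ht
    have ht' : Icc (0 : ℝ) 1 ∈ 𝓝 t := Icc_mem_nhds ht.1 (ht.2.trans_le hs.2)
    exact ((hφ.2.2.1 e t ⟨ht.1.le, ht.2.le.trans hs.2⟩).hasDerivWithinAt).hasDerivAt ht'
  · exact intervalIntegrable_of_integrable_unit hi (by simp) hs

/-- A function in the domain of the form has a representative that is, along every cable, a
primitive of the gradient: the pointwise limit of the approximating functions of `𝒦`. -/
theorem IsGradient.exists_representative {u : G.CableSpace → ℝ} {g : G.Dart × ℝ → ℝ}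
    (h : IsGradient u g) :
    ∃ F : G.CableSpace → ℝ,
      (∀ e : G.Dart, ∀ᵐ t ∂(volume.restrict (Icc (0 : ℝ) 1)), u (e.cable t) = F (e.cable t)) ∧
      ∀ e : G.Dart, ∀ s ∈ Icc (0 : ℝ) 1,
        F (e.cable s) = F (e.cable 0) + ∫ t in (0 : ℝ)..s, g (e, t) := by
  obtain ⟨hu, hg, φ, hφ, h0, h1⟩ := h
  have hφm : ∀ n, AEStronglyMeasurable (φ n) G.cableMeasure := fun n =>
    (hφ n).1.measurable.aestronglyMeasurable
  have key : ∀ e : G.Dart, ∃ κ : ℝ, (∀ s ∈ Icc (0 : ℝ) 1,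
        Tendsto (fun n => φ n (e.cable s)) atTop (𝓝 (κ + ∫ t in (0 : ℝ)..s, g (e, t)))) ∧
      ∀ᵐ s ∂(volume.restrict (Icc (0 : ℝ) 1)),
        u (e.cable s) = κ + ∫ t in (0 : ℝ)..s, g (e, t) := by
    intro e
    have hm : ∀ n, MemLp (fun s => φ n (e.cable s)) 2 (volume.restrict (Icc (0 : ℝ) 1)) := by
      intro n
      have hc : Continuous fun s => φ n (e.cable s) := (hφ n).1.comp e.continuous_cable
      obtain ⟨C, hC⟩ := isCompact_Icc.exists_bound_of_continuousOn (hc.continuousOn (s := Icc 0 1))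
      refine MemLp.of_bound hc.aestronglyMeasurable C ?_
      exact (ae_restrict_iff' measurableSet_Icc).2 (ae_of_all _ hC)
    have hue : MemLp (fun s => u (e.cable s)) 2 (volume.restrict (Icc (0 : ℝ) 1)) :=
      memLp_dart e ((memLp_cableMeasure_iff hu.1).1 hu)
    have hue0 : Tendsto (fun n => eLpNorm ((fun s => φ n (e.cable s)) - fun s => u (e.cable s)) 2
        (volume.restrict (Icc (0 : ℝ) 1))) atTop (𝓝 0) := by
      have h2 : Tendsto (fun n => 2 * eLpNorm (φ n - u) 2 G.cableMeasure) atTop (𝓝 0) := by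
        simpa using ENNReal.Tendsto.const_mul h0 (Or.inr (by simp : (2 : ℝ≥0∞) ≠ ∞))
      refine tendsto_of_tendsto_of_tendsto_of_le_of_le tendsto_const_nhds h2 (fun _ => zero_le)
        fun n => ?_
      exact eLpNorm_cable_le e (u := φ n - u) ((hφm n).sub hu.1)
    have hge : Tendsto (fun n => eLpNorm ((fun s => edgeDeriv (φ n) (e, s)) - fun s => g (e, s)) 2
        (volume.restrict (Icc (0 : ℝ) 1))) atTop (𝓝 0) := by
      refine tendsto_of_tendsto_of_tendsto_of_le_of_le tendsto_const_nhds h1 (fun _ => zero_le)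
        fun n => ?_
      exact eLpNorm_dart_le e (edgeDeriv (φ n) - g) 2
    exact exists_tendsto_primitive hm (fun n => (hφ n).memLp_edgeDeriv e) hue (memLp_dart e hg)
      (fun n s hs => (hφ n).eq_add_integral e hs) hue0 hge
  have hlim : ∀ x : G.CableSpace, ∃ l, Tendsto (fun n => φ n x) atTop (𝓝 l) := by
    intro x
    obtain ⟨e, t, ht, rfl⟩ := CableSpace.exists_cable x
    obtain ⟨κ, h2, -⟩ := key e
    exact ⟨_, h2 t ht⟩
  choose F hF using hlim
  refine ⟨F, fun e => ?_, fun e s hs => ?_⟩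
  · obtain ⟨κ, h2, h3⟩ := key e
    filter_upwards [h3, ae_restrict_mem measurableSet_Icc] with t ht ht'
    rw [ht]
    exact tendsto_nhds_unique (h2 t ht') (hF _)
  · obtain ⟨κ, h2, -⟩ := key e
    rw [tendsto_nhds_unique (hF _) (h2 s hs), tendsto_nhds_unique (hF _) (h2 0 (by simp))]
    simp

end SimpleGraph

/-! ### Functions determined by their integrals -/

lemma ae_eq_of_primitive_eq {g ψ : ℝ → ℝ} (hg : Integrable g (volume.restrict (Icc (0 : ℝ) 1)))
    (hψ : Integrable ψ (volume.restrict (Icc (0 : ℝ) 1)))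
    (h : ∀ s ∈ Icc (0 : ℝ) 1, ∫ t in (0 : ℝ)..s, g t = ∫ t in (0 : ℝ)..s, ψ t) :
    g =ᵐ[volume.restrict (Icc (0 : ℝ) 1)] ψ := by
  have h0 : (0 : ℝ) ∈ Icc (0 : ℝ) 1 := by simp
  have h1 : (1 : ℝ) ∈ Icc (0 : ℝ) 1 := by simp
  rw [← restrict_Ioo_eq_restrict_Icc]
  refine (ae_restrict_iff' measurableSet_Ioo).2 ?_
  filter_upwards [(intervalIntegrable_of_integrable_unit hg h0 h1).ae_hasDerivAt_integral,
    (intervalIntegrable_of_integrable_unit hψ h0 h1).ae_hasDerivAt_integral] with x hx hx' hx1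
  have hxm : x ∈ uIcc (0 : ℝ) 1 := by
    rw [uIcc_of_le zero_le_one]
    exact Ioo_subset_Icc_self hx1
  have h2 := hx hxm 0 (by simp)
  have h3 := hx' hxm 0 (by simp)
  refine h2.unique (h3.congr_of_eventuallyEq ?_)
  filter_upwards [Icc_mem_nhds hx1.1 hx1.2] with s hs using h s hs

/-- The du Bois-Reymond lemma: a function orthogonal to all mean-zero test functions on an
interval is constant there. -/
lemma exists_ae_eq_const {g : ℝ → ℝ} (hg : Integrable g (volume.restrict (Icc (0 : ℝ) 1)))
    {a b : ℝ} (ha : 0 ≤ a) (hb : b ≤ 1) (hab : a < b)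
    (h : ∀ η : ℝ → ℝ, Continuous η → (∃ a' b', a < a' ∧ b' < b ∧ ∀ t, t ∉ Icc a' b' → η t = 0) →
      ∫ t in (0 : ℝ)..1, η t = 0 → ∫ t in (0 : ℝ)..1, g t * η t = 0) :
    ∃ κ : ℝ, ∀ᵐ t, t ∈ Ioo a b → g t = κ := by
  have h0 : (0 : ℝ) ∈ Icc (0 : ℝ) 1 := by simp
  have h1 : (1 : ℝ) ∈ Icc (0 : ℝ) 1 := by simp
  have hgi := intervalIntegrable_of_integrable_unit hg h0 h1
  -- a bump function of integral one
  let f : ContDiffBump ((a + b) / 2) := ⟨(b - a) / 8, (b - a) / 4, by linarith, by linarith⟩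
  set ω : ℝ → ℝ := f.normed volume with hω
  have hωc : Continuous ω := f.continuous_normed
  have hω0 : ∀ t, t ∉ Icc (a + (b - a) / 4) (b - (b - a) / 4) → ω t = 0 := by
    intro t ht
    by_contra hne
    have hm : t ∈ Function.support (f.normed volume) := hne
    rw [f.support_normed_eq, Metric.mem_ball, Real.dist_eq] at hm
    have hm' : |t - (a + b) / 2| < (b - a) / 4 := hm
    rw [abs_lt] at hm'
    exact ht ⟨by linarith [hm'.1], by linarith [hm'.2]⟩
  have htest : ∀ η : ℝ → ℝ, (∃ a' b', a < a' ∧ b' < b ∧ ∀ t, t ∉ Icc a' b' → η t = 0) →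
      ∫ t, η t = ∫ t in (0 : ℝ)..1, η t := by
    rintro η ⟨a', b', ha', hb', hη⟩
    rw [intervalIntegral.integral_of_le zero_le_one, ← integral_Icc_eq_integral_Ioc]
    refine (setIntegral_eq_integral_of_forall_compl_eq_zero fun t ht => hη t fun ht' => ht ?_).symm
    exact ⟨by linarith [ht'.1], by linarith [ht'.2]⟩
  have hωs : ∃ a' b', a < a' ∧ b' < b ∧ ∀ t, t ∉ Icc a' b' → ω t = 0 :=
    ⟨_, _, by linarith, by linarith, hω0⟩
  have hω1 : ∫ t in (0 : ℝ)..1, ω t = 1 := by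
    rw [← htest ω hωs]
    exact f.integral_normed
  set κ := ∫ t in (0 : ℝ)..1, g t * ω t with hκ
  refine ⟨κ, ?_⟩
  have hloc : LocallyIntegrableOn (fun t => g t - κ) (Ioo a b) volume := by
    refine (IntegrableOn.mono_set (t := Icc 0 1) ?_ ?_).locallyIntegrableOn
    · exact Integrable.sub hg (integrable_const _)
    · exact fun t ht => ⟨by linarith [ht.1], by linarith [ht.2]⟩
  have key := isOpen_Ioo.ae_eq_zero_of_integral_contDiff_smul_eq_zero (μ := volume) hloc ?_
  · filter_upwards [key] with t ht htm
    linarith [ht htm]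
  intro η hη hηc hηs
  have hηs' : ∃ a' b', a < a' ∧ b' < b ∧ ∀ t, t ∉ Icc a' b' → η t = 0 := by
    rcases (tsupport η).eq_empty_or_nonempty with he | hne
    · refine ⟨a + 1, b - 1, by linarith, by linarith, fun t _ => ?_⟩
      exact image_eq_zero_of_notMem_tsupport (by simp [he])
    · obtain ⟨a', ha', ha''⟩ := hηc.isCompact.exists_isLeast hne
      obtain ⟨b', hb', hb''⟩ := hηc.isCompact.exists_isGreatest hne
      refine ⟨a', b', (hηs ha').1, (hηs hb').2, fun t ht => ?_⟩
      exact image_eq_zero_of_notMem_tsupport fun ht' => ht ⟨ha'' ht', hb'' ht'⟩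
  have hi1 : IntervalIntegrable (fun t => g t * η t) volume 0 1 :=
    hgi.mul_continuousOn hη.continuous.continuousOn
  have hi2 : IntervalIntegrable (fun t => g t * ω t) volume 0 1 :=
    hgi.mul_continuousOn hωc.continuousOn
  set m := ∫ t in (0 : ℝ)..1, η t with hm
  have h2 := h (fun t => η t - m * ω t) (hη.continuous.sub (continuous_const.mul hωc)) ?_ ?_
  · rw [htest]
    · have h3 : ∀ t, η t • (g t - κ) = g t * η t - κ * η t := by
        intro t
        rw [smul_eq_mul]
        ring
      simp_rw [h3]
      rw [intervalIntegral.integral_sub hi1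
        ((hη.continuous.const_mul κ).intervalIntegrable _ _),
        intervalIntegral.integral_const_mul, ← hm]
      have h4 : ∀ t, g t * (η t - m * ω t) = g t * η t - m * (g t * ω t) := fun t => by ring
      simp_rw [h4] at h2
      rw [intervalIntegral.integral_sub hi1 (hi2.const_mul m),
        intervalIntegral.integral_const_mul, ← hκ] at h2
      linarith
    · obtain ⟨a', b', h5, h6, h7⟩ := hηs'
      exact ⟨a', b', h5, h6, fun t ht => by rw [h7 t ht, zero_smul]⟩
  · obtain ⟨a', b', h5, h6, h7⟩ := hηs'
    refine ⟨min a' (a + (b - a) / 4), max b' (b - (b - a) / 4), lt_min h5 (by linarith),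
      max_lt h6 (by linarith), fun t ht => ?_⟩
    rw [h7 t fun ht' => ht ⟨(min_le_left _ _).trans ht'.1, ht'.2.trans (le_max_left _ _)⟩,
      hω0 t fun ht' => ht ⟨(min_le_right _ _).trans ht'.1, ht'.2.trans (le_max_right _ _)⟩]
    ring
  · rw [intervalIntegral.integral_sub (hη.continuous.intervalIntegrable _ _)
      ((hωc.const_mul m).intervalIntegrable _ _), intervalIntegral.integral_const_mul, hω1, hm]
    ring

lemma measurable_indicator_of_continuousOn {ψ : ℝ → ℝ} (h : ContinuousOn ψ (Icc (0 : ℝ) 1)) :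
    Measurable ((Icc (0 : ℝ) 1).indicator ψ) := by
  rw [← piecewise_eq_indicator]
  exact h.measurable_piecewise continuousOn_const measurableSet_Icc

namespace SimpleGraph

variable {V : Type*} [Countable V] {G : SimpleGraph V} [Fact G.Connected]

/-! ### The gradient of a harmonic function -/

omit [Countable V] in
lemma IsGradient.gradient_spec {u : G.CableSpace → ℝ} (hu : MemForm u) :
    IsGradient u (gradient u) := by
  rw [gradient, dif_pos hu]
  exact hu.choose_spec

lemma IsGradient.integrable_dart {u : G.CableSpace → ℝ} {g : G.Dart × ℝ → ℝ}
    (h : IsGradient u g) (e : G.Dart) :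
    Integrable (fun t => g (e, t)) (volume.restrict (Icc (0 : ℝ) 1)) :=
  (memLp_dart e h.2.1).integrable (by norm_num)

/-- A continuously differentiable test function on finitely many cables, given by its profiles
`q` with derivatives `ψ`. -/
structure IsTest (q ψ : G.Dart → ℝ → ℝ) (f : V → ℝ) (S : Finset G.Dart) (L : ℝ) : Prop
    extends IsProfile q f where
  deriv : ∀ e, ∀ t ∈ Icc (0 : ℝ) 1, HasDerivWithinAt (q e) (ψ e t) (Icc 0 1) t
  cont : ∀ e, ContinuousOn (ψ e) (Icc 0 1)
  bound : ∀ e, ∀ t ∈ Icc (0 : ℝ) 1, |ψ e t| ≤ L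
  zero_off : ∀ e ∉ S, ∀ t ∈ Icc (0 : ℝ) 1, q e t = 0 ∧ ψ e t = 0

namespace IsTest

variable {q ψ : G.Dart → ℝ → ℝ} {f : V → ℝ} {S : Finset G.Dart} {L : ℝ}

omit [Countable V] [Fact G.Connected] in
lemma nonneg [Nonempty G.Dart] (h : IsTest q ψ f S L) : 0 ≤ L :=
  (abs_nonneg _).trans (h.bound (Classical.arbitrary _) 0 (by simp))

omit [Countable V] in
lemma continuous (h : IsTest q ψ f S L) : Continuous h.toIsProfile.glue := by
  rcases isEmpty_or_nonempty G.Dart with he | he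
  · refine continuous_iff_continuousAt.2 fun x => ?_
    obtain ⟨e, -⟩ := CableSpace.exists_point x
    exact he.elim e
  refine h.toIsProfile.continuous_glue h.nonneg fun e s hs t ht => ?_
  exact (convex_Icc (0 : ℝ) 1).norm_image_sub_le_of_norm_hasDerivWithin_le (h.deriv e)
    (h.bound e) ht hs

omit [Countable V] in
lemma tsupport_subset (h : IsTest q ψ f S L) {K : Set G.CableSpace} (hK : IsClosed K)
    (hq : ∀ e ∈ S, ∀ t ∈ Icc (0 : ℝ) 1, q e t ≠ 0 → e.cable t ∈ K) :
    tsupport h.toIsProfile.glue ⊆ K := by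
  refine closure_minimal (fun x hx => ?_) hK
  obtain ⟨e, t, ht, rfl⟩ := CableSpace.exists_cable x
  rw [Function.mem_support, IsProfile.glue_cable _ e ht] at hx
  by_cases he : e ∈ S
  · exact hq e he t ht hx
  · exact absurd (h.zero_off e he t ht).1 hx

omit [Countable V] in
lemma hasCompactSupport (h : IsTest q ψ f S L) : HasCompactSupport h.toIsProfile.glue := by
  have hK : IsCompact (⋃ e ∈ S, e.cable '' Icc (0 : ℝ) 1) :=
    S.isCompact_biUnion fun e _ => isCompact_Icc.image e.continuous_cable
  refine hK.of_isClosed_subset (isClosed_tsupport _) (h.tsupport_subset hK.isClosed ?_)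
  exact fun e he t ht _ => mem_biUnion he (mem_image_of_mem _ ht)

omit [Countable V] [Fact G.Connected] in
lemma edgeDeriv_eq (h : IsTest q ψ f S L) (e : G.Dart) {t : ℝ} (ht : t ∈ Icc (0 : ℝ) 1) :
    edgeDeriv h.toIsProfile.glue (e, t) = ψ e t := by
  have h1 : HasDerivWithinAt (fun s => h.toIsProfile.glue (e.cable s)) (ψ e t) (Icc 0 1) t :=
    (h.deriv e t ht).congr (fun s hs => h.toIsProfile.glue_cable e hs)
      (h.toIsProfile.glue_cable e ht)
  exact h1.derivWithin (uniqueDiffOn_Icc zero_lt_one t ht)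

omit [Fact G.Connected] in
lemma edgeDeriv_ae (h : IsTest q ψ f S L) :
    ∀ᵐ z ∂G.dartMeasure, edgeDeriv h.toIsProfile.glue z = ψ z.1 z.2 :=
  ae_dartMeasure_iff.2 fun e =>
    (ae_restrict_iff' measurableSet_Icc).2 (ae_of_all _ fun _ ht => h.edgeDeriv_eq e ht)

omit [Fact G.Connected] in
lemma memLp_of_bound (S : Finset G.Dart) {v : G.Dart × ℝ → ℝ}
    (hv : AEStronglyMeasurable v G.dartMeasure) {C : ℝ}
    (hC : ∀ e ∈ S, ∀ t ∈ Icc (0 : ℝ) 1, |v (e, t)| ≤ C)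
    (h0 : ∀ e ∉ S, ∀ t ∈ Icc (0 : ℝ) 1, v (e, t) = 0) : MemLp v 2 G.dartMeasure := by
  set A : Set (G.Dart × ℝ) := (S : Set G.Dart) ×ˢ univ with hA
  have hAm : MeasurableSet A := S.measurableSet.prod MeasurableSet.univ
  have hAfin : G.dartMeasure A < ∞ := by
    rw [hA, dartMeasure, Measure.prod_prod]
    refine ENNReal.mul_lt_top ?_ (by simp)
    rw [Measure.count_apply_finset]
    simp
  have h1 : MemLp (A.indicator fun _ => C) 2 G.dartMeasure :=
    memLp_indicator_const 2 hAm C (Or.inr hAfin.ne)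
  refine h1.of_le hv (ae_dartMeasure_iff.2 fun e =>
    (ae_restrict_iff' measurableSet_Icc).2 (ae_of_all _ fun t ht => ?_))
  by_cases he : e ∈ S
  · rw [indicator_of_mem (by simp [hA, he])]
    exact (hC e he t ht).trans (le_abs_self _)
  · rw [h0 e he t ht]
    simp

lemma isCore (h : IsTest q ψ f S L) : IsCore h.toIsProfile.glue := by
  refine ⟨h.continuous, h.hasCompactSupport, fun e t ht => ?_, ?_⟩
  · exact ((h.deriv e t ht).congr (fun s hs => h.toIsProfile.glue_cable e hs)
      (h.toIsProfile.glue_cable e ht)).differentiableWithinAt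
  · refine (eLpNormEssSup_lt_top_of_ae_bound (C := L) ?_)
    exact ae_dartMeasure_iff.2 fun e => (ae_restrict_iff' measurableSet_Icc).2
      (ae_of_all _ fun t ht => (h.edgeDeriv_eq e ht).symm ▸ h.bound e t ht)

lemma isGradient (h : IsTest q ψ f S L) :
    IsGradient h.toIsProfile.glue (fun z => ψ z.1 z.2) := by
  have hc := h.continuous
  have hψm : AEStronglyMeasurable (fun z : G.Dart × ℝ => ψ z.1 z.2) G.dartMeasure := by
    have h1 : Measurable fun z : G.Dart × ℝ => (Icc (0 : ℝ) 1).indicator (ψ z.1) z.2 :=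
      measurable_from_prod_countable_right fun e =>
        (measurable_indicator_of_continuousOn (h.cont e))
    refine h1.aestronglyMeasurable.congr (ae_dartMeasure_iff.2 fun e =>
      (ae_restrict_iff' measurableSet_Icc).2 (ae_of_all _ fun t ht => ?_))
    exact indicator_of_mem ht _
  refine ⟨?_, ?_, fun _ => h.toIsProfile.glue, fun _ => h.isCore, ?_, ?_⟩
  · rw [memLp_cableMeasure_iff hc.measurable.aestronglyMeasurable]
    obtain ⟨C, hC⟩ := h.hasCompactSupport.exists_bound_of_continuous hc
    refine memLp_of_bound S (hc.measurable.comp measurable_cableMap).aestronglyMeasurable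
      (C := C) (fun e _ t _ => hC _) fun e he t ht => ?_
    exact (h.toIsProfile.glue_cable e ht).trans (h.zero_off e he t ht).1
  · exact memLp_of_bound S hψm (fun e _ t ht => h.bound e t ht) fun e he t ht =>
      (h.zero_off e he t ht).2
  · simp
  · have h2 : ∀ n : ℕ, eLpNorm (edgeDeriv h.toIsProfile.glue - fun z => ψ z.1 z.2) 2
        G.dartMeasure = 0 := by
      intro n
      rw [eLpNorm_congr_ae (g := 0)]
      · simp
      · filter_upwards [h.edgeDeriv_ae] with z hz
        simp [hz]
    simp only [h2 0, tendsto_const_nhds]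

/-- The gradient, defined through a choice of approximating functions, is the derivative of the
test function: both have the same primitives. -/
lemma gradient_ae (h : IsTest q ψ f S L) :
    ∀ᵐ z ∂G.dartMeasure, gradient h.toIsProfile.glue z = ψ z.1 z.2 := by
  have hg := IsGradient.gradient_spec ⟨_, h.isGradient⟩
  obtain ⟨F, hF, hF'⟩ := hg.exists_representative
  refine ae_dartMeasure_iff.2 fun e => ?_
  have hi := hg.integrable_dart e
  have hψ : Integrable (ψ e) (volume.restrict (Icc (0 : ℝ) 1)) :=
    (h.cont e).integrableOn_compact isCompact_Icc
  have hFc : ContinuousOn (fun t => F (e.cable t)) (Icc 0 1) := by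
    refine ContinuousOn.congr (f := fun s => F (e.cable 0) + ∫ t in (0 : ℝ)..s,
      gradient h.toIsProfile.glue (e, t)) ?_ (hF' e)
    exact continuousOn_const.add (continuousOn_primitive_unit hi)
  have heq := Measure.eqOn_Icc_of_ae_eq volume (zero_ne_one' ℝ) (hF e)
    (h.continuous.comp e.continuous_cable).continuousOn hFc
  refine ae_eq_of_primitive_eq hi hψ fun s hs => ?_
  have h1 := hF' e s hs
  have h2 := heq hs
  have h3 := heq (left_mem_Icc.2 (zero_le_one' ℝ))
  simp only at h2 h3
  have h5 : ∫ t in (0 : ℝ)..s, ψ e t = q e s - q e 0 := by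
    refine intervalIntegral.integral_eq_sub_of_hasDerivAt_of_le hs.1 ?_ ?_ ?_
    · exact fun t ht => ((h.deriv e t ⟨ht.1, ht.2.trans hs.2⟩).continuousWithinAt).mono
        (Icc_subset_Icc_right hs.2)
    · intro t ht
      have ht' : Icc (0 : ℝ) 1 ∈ 𝓝 t := Icc_mem_nhds ht.1 (ht.2.trans_le hs.2)
      exact (h.deriv e t ⟨ht.1.le, ht.2.le.trans hs.2⟩).hasDerivAt ht'
    · exact intervalIntegrable_of_integrable_unit hψ (by simp) hs
  rw [h5, ← h.toIsProfile.glue_cable e hs, ← h.toIsProfile.glue_cable e (by simp : (0:ℝ) ∈ _), h2,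
    h3, h1]
  ring

/-- A harmonic function is tested with a test function supported in the domain. The sum runs over
oriented edges, so that every edge in the support contributes twice. -/
lemma sum_eq_zero (h : IsTest q ψ f S L) {u : G.CableSpace → ℝ} {D : Set G.CableSpace}
    (hu : IsHarmonicIn u D) {K : Set G.CableSpace} (hK : IsClosed K) (hKD : K ⊆ D)
    (hq : ∀ e ∈ S, ∀ t ∈ Icc (0 : ℝ) 1, q e t ≠ 0 → e.cable t ∈ K) :
    ∑ e ∈ S, ∫ t in (0 : ℝ)..1, gradient u (e, t) * ψ e t = 0 := by
  have hφ : MemForm h.toIsProfile.glue := ⟨_, h.isGradient⟩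
  have h1 := hu.2 _ hφ h.continuous h.hasCompactSupport ((h.tsupport_subset hK hq).trans hKD)
  rw [energy, mul_eq_zero, or_iff_right (by norm_num)] at h1
  have hint : Integrable (fun z => gradient u z * gradient h.toIsProfile.glue z) G.dartMeasure :=
    (IsGradient.gradient_spec hu.1).2.1.integrable_mul (IsGradient.gradient_spec hφ).2.1
  have hae : (fun z => gradient u z * gradient h.toIsProfile.glue z) =ᵐ[G.dartMeasure]
      fun z => gradient u z * ψ z.1 z.2 := by
    filter_upwards [h.gradient_ae] with z hz
    rw [hz]
  rw [integral_congr_ae hae] at h1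
  replace hint := hint.congr hae
  have hS : ∫ z in ⋃ e ∈ S, ({e} ×ˢ univ : Set (G.Dart × ℝ)), gradient u z * ψ z.1 z.2
      ∂G.dartMeasure = 0 := by
    rw [← h1]
    refine setIntegral_eq_integral_of_ae_compl_eq_zero (ae_dartMeasure_iff.2 fun e => ?_)
    refine (ae_restrict_iff' measurableSet_Icc).2 (ae_of_all _ fun t ht he => ?_)
    have he' : e ∉ S := by simpa using he
    simp only [(h.zero_off e he' t ht).2, mul_zero]
  rw [integral_biUnion_finset] at hS
  · refine Eq.trans (Finset.sum_congr rfl fun e _ => ?_) hS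
    exact (integral_dart e fun z => gradient u z * ψ z.1 z.2).symm
  · exact fun e _ => (measurableSet_singleton e).prod MeasurableSet.univ
  · intro e _ e' _ hne
    rw [Function.onFun, Set.disjoint_prod]
    exact Or.inl (by simpa using hne)
  · exact fun e _ => hint.integrableOn

end IsTest

end SimpleGraph

namespace SimpleGraph

variable {V : Type*} [Countable V] {G : SimpleGraph V} [Fact G.Connected]

/-- `F` is a representative of `u` that is, along every cable, a primitive of the gradient. -/
structure IsRep (u F : G.CableSpace → ℝ) : Prop where
  ae_eq : ∀ e : G.Dart, ∀ᵐ t ∂(volume.restrict (Icc (0 : ℝ) 1)), u (e.cable t) = F (e.cable t)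
  integrable : ∀ e : G.Dart,
    Integrable (fun t => gradient u (e, t)) (volume.restrict (Icc (0 : ℝ) 1))
  eq_add : ∀ e : G.Dart, ∀ s ∈ Icc (0 : ℝ) 1,
    F (e.cable s) = F (e.cable 0) + ∫ t in (0 : ℝ)..s, gradient u (e, t)

lemma MemForm.exists_isRep {u : G.CableSpace → ℝ} (hu : MemForm u) : ∃ F, IsRep u F := by
  have h := IsGradient.gradient_spec hu
  obtain ⟨F, h1, h2⟩ := h.exists_representative
  exact ⟨F, h1, h.integrable_dart, h2⟩

namespace IsRep

variable {u F : G.CableSpace → ℝ}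

omit [Countable V] in
lemma sub_eq (hF : IsRep u F) (e : G.Dart) {s t : ℝ} (hs : s ∈ Icc (0 : ℝ) 1)
    (ht : t ∈ Icc (0 : ℝ) 1) :
    F (e.cable t) - F (e.cable s) = ∫ x in s..t, gradient u (e, x) := by
  have h0 : (0 : ℝ) ∈ Icc (0 : ℝ) 1 := by simp
  rw [hF.eq_add e s hs, hF.eq_add e t ht, ← intervalIntegral.integral_interval_sub_left
    (intervalIntegrable_of_integrable_unit (hF.integrable e) h0 ht)
    (intervalIntegrable_of_integrable_unit (hF.integrable e) h0 hs)]
  ring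

omit [Countable V] in
lemma gradient_symm (hF : IsRep u F) (e : G.Dart) :
    (fun t => gradient u (e.symm, t)) =ᵐ[volume.restrict (Icc (0 : ℝ) 1)]
      fun t => -gradient u (e, 1 - t) := by
  have hflip : Integrable (fun t => gradient u (e, 1 - t))
      (volume.restrict (Icc (0 : ℝ) 1)) := by
    have h := (intervalIntegrable_of_integrable_unit (hF.integrable e) (a := 0) (b := 1)
      (by simp) (by simp)).comp_sub_left 1
    rw [sub_zero, sub_self, intervalIntegrable_iff, uIoc_comm, uIoc_of_le zero_le_one] at h
    rwa [← restrict_Ioc_eq_restrict_Icc]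
  refine ae_eq_of_primitive_eq (hF.integrable _) hflip.neg fun s hs => ?_
  have h0 : (0 : ℝ) ∈ Icc (0 : ℝ) 1 := by simp
  have hs' : 1 - s ∈ Icc (0 : ℝ) 1 := ⟨by linarith [hs.2], by linarith [hs.1]⟩
  have h1 := hF.sub_eq e.symm h0 hs
  have h2 := hF.sub_eq e hs' (by simp : (1 : ℝ) ∈ Icc (0 : ℝ) 1)
  rw [← e.symm_cable hs', ← e.symm_cable (by simp : (1 : ℝ) ∈ Icc (0 : ℝ) 1), sub_self,
    sub_sub_cancel] at h2
  rw [← h1, intervalIntegral.integral_neg,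
    intervalIntegral.integral_comp_sub_left (fun t => gradient u (e, t)) 1, sub_zero, ← h2]
  ring

/-- Harmonic functions are affine along the parts of the cables that lie in the domain. -/
lemma exists_slope (hF : IsRep u F) {D : Set G.CableSpace} (hu : IsHarmonicIn u D) (e : G.Dart)
    {a b : ℝ} (ha : 0 ≤ a) (hb : b ≤ 1) (hab : a < b) (hD : e.cable '' Ioo a b ⊆ D) :
    ∃ κ : ℝ, (∀ᵐ t, t ∈ Ioo a b → gradient u (e, t) = κ) ∧
      ∀ s ∈ Icc a b, ∀ t ∈ Icc a b, F (e.cable t) - F (e.cable s) = κ * (t - s) := by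
  classical
  have key : ∃ κ : ℝ, ∀ᵐ t, t ∈ Ioo a b → gradient u (e, t) = κ := by
    refine exists_ae_eq_const (hF.integrable e) ha hb hab ?_
    rintro η hη ⟨a', b', ha', hb', hη0⟩ hη1
    set Q : ℝ → ℝ := fun t => ∫ x in (0 : ℝ)..t, η x with hQ
    have hQd : ∀ t, HasDerivAt Q (η t) t := fun t =>
      intervalIntegral.integral_hasDerivAt_right (hη.intervalIntegrable _ _)
        (hη.stronglyMeasurableAtFilter _ _) hη.continuousAt
    have hQ0 : ∀ t ∈ Icc (0 : ℝ) 1, t ∉ Icc a' b' → Q t = 0 := by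
      intro t ht ht'
      rcases lt_or_ge t a' with h | h
      · refine intervalIntegral.integral_zero_ae (ae_of_all _ fun x hx => hη0 x fun hx' => ?_)
        rw [uIoc_of_le ht.1] at hx
        linarith [hx.2, hx'.1]
      · have h2 : b' < t := by
          by_contra h3
          exact ht' ⟨h, not_lt.1 h3⟩
        have h3 : ∫ x in t..1, η x = 0 := by
          refine intervalIntegral.integral_zero_ae (ae_of_all _ fun x hx => hη0 x fun hx' => ?_)
          rw [uIoc_of_le ht.2] at hx
          linarith [hx.1, hx'.2]
        have h4 := intervalIntegral.integral_add_adjacent_intervals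
          (hη.intervalIntegrable (μ := volume) 0 t) (hη.intervalIntegrable (μ := volume) t 1)
        rw [h3, hη1, add_zero] at h4
        exact h4
    have hne : e.symm ≠ e := Dart.symm_ne e
    have hQ00 : Q 0 = 0 := by simp [hQ]
    obtain ⟨L, hL⟩ := (isCompact_Icc (a := (0 : ℝ)) (b := 1)).exists_bound_of_continuousOn
      hη.continuousOn
    have hL0 : 0 ≤ L := (norm_nonneg _).trans (hL 0 (by simp))
    have hflip : ∀ t ∈ Icc (0 : ℝ) 1, 1 - t ∈ Icc (0 : ℝ) 1 := fun t ht =>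
      ⟨by linarith [ht.2], by linarith [ht.1]⟩
    have htest : IsTest (G := G)
        (fun e' t => if e' = e then Q t else if e' = e.symm then Q (1 - t) else 0)
        (fun e' t => if e' = e then η t else if e' = e.symm then -η (1 - t) else 0)
        (fun _ => 0) {e, e.symm} L := by
      constructor
      · constructor
        · intro e'
          split_ifs
          · exact hQ00
          · rw [sub_zero]
            exact hη1
          · rfl
        · intro e' t _
          rcases eq_or_ne e' e with rfl | h1
          · simp [hne]
          · rcases eq_or_ne e' e.symm with rfl | h2
            · simp [hne]
            · have h3 : e'.symm ≠ e := fun h => h2 (by rw [← h, Dart.symm_symm])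
              have h4 : e'.symm ≠ e.symm := fun h => h1 (Dart.symm_involutive.injective h)
              simp [h1, h2, h3, h4]
      · intro e' t _
        by_cases h1 : e' = e
        · simp only [h1, if_true]
          exact (hQd t).hasDerivWithinAt
        · by_cases h2 : e' = e.symm
          · simp only [h2, hne, if_true, if_false]
            have h3 := (hQd (1 - t)).comp_const_sub 1 t
            exact h3.hasDerivWithinAt
          · simp only [h1, h2, if_false]
            exact hasDerivWithinAt_const _ _ _
      · intro e'
        by_cases h1 : e' = e
        · simp only [h1, if_true]
          exact hη.continuousOn
        · by_cases h2 : e' = e.symm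
          · simp only [h2, hne, if_true, if_false]
            fun_prop
          · simp only [h1, h2, if_false]
            exact continuousOn_const
      · intro e' t ht
        split_ifs
        · exact hL t ht
        · rw [abs_neg]
          exact hL _ (hflip t ht)
        · simpa using hL0
      · intro e' he' t _
        have h1 : e' ≠ e := fun h => he' (by simp [h])
        have h2 : e' ≠ e.symm := fun h => he' (by simp [h])
        simp [h1, h2]
    have h1 := htest.sum_eq_zero hu (K := e.cable '' (Icc a' b' ∩ Icc 0 1))
      ((isCompact_Icc.inter isCompact_Icc).image e.continuous_cable).isClosed ?_ ?_
    · rw [Finset.sum_pair hne.symm] at h1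
      simp only [if_true, hne, if_false] at h1
      have h2 : ∫ t in (0 : ℝ)..1, gradient u (e.symm, t) * -η (1 - t) =
          ∫ t in (0 : ℝ)..1, gradient u (e, t) * η t := by
        have h3 : ∫ t in (0 : ℝ)..1, gradient u (e.symm, t) * -η (1 - t) =
            ∫ t in (0 : ℝ)..1, gradient u (e, 1 - t) * η (1 - t) := by
          rw [intervalIntegral.integral_of_le zero_le_one,
            intervalIntegral.integral_of_le zero_le_one, restrict_Ioc_eq_restrict_Icc]
          refine integral_congr_ae ?_
          filter_upwards [hF.gradient_symm e] with t ht
          rw [ht]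
          ring
        rw [h3, intervalIntegral.integral_comp_sub_left (fun t => gradient u (e, t) * η t) 1]
        simp
      rw [h2] at h1
      linarith
    · rintro _ ⟨t, ht, rfl⟩
      exact hD ⟨t, ⟨by linarith [ht.1.1], by linarith [ht.1.2]⟩, rfl⟩
    · intro e' he' t ht hq
      rcases Finset.mem_insert.1 he' with rfl | h2
      · simp only [if_true] at hq
        refine ⟨t, ⟨?_, ht⟩, rfl⟩
        by_contra h
        exact hq (hQ0 t ht h)
      · obtain rfl := Finset.mem_singleton.1 h2
        simp only [if_true, hne, if_false] at hq
        refine ⟨1 - t, ⟨?_, hflip t ht⟩, ?_⟩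
        · by_contra h
          exact hq (hQ0 _ (hflip t ht) h)
        · rw [← e.symm_cable (hflip t ht), sub_sub_cancel]
  obtain ⟨κ, hκ⟩ := key
  refine ⟨κ, hκ, ?_⟩
  have hle : ∀ s ∈ Icc a b, ∀ t ∈ Icc a b, s ≤ t →
      F (e.cable t) - F (e.cable s) = κ * (t - s) := by
    intro s hs t ht hst
    rw [hF.sub_eq e ⟨ha.trans hs.1, hs.2.trans hb⟩ ⟨ha.trans ht.1, ht.2.trans hb⟩,
      intervalIntegral.integral_of_le hst, ← restrict_Ioo_eq_restrict_Ioc]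
    have h1 : ∫ x in Ioo s t, gradient u (e, x) = ∫ x in Ioo s t, κ := by
      refine setIntegral_congr_ae measurableSet_Ioo ?_
      filter_upwards [hκ] with x hx hx'
      exact hx ⟨hs.1.trans_lt hx'.1, hx'.2.trans_le ht.2⟩
    rw [h1]
    simp [hst]
    ring
  intro s hs t ht
  rcases le_total s t with h | h
  · exact hle s hs t ht h
  · linarith [hle t ht s hs h]

/-- Kirchhoff's law: at a vertex whose cables lie in the domain, the increments of a harmonic
function sum up to zero. -/
lemma sum_increments_eq_zero (hF : IsRep u F) {D : Set G.CableSpace} (hu : IsHarmonicIn u D)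
    {v : V} {A : Finset G.Dart} (hA : ∀ e, e ∈ A ↔ e.fst = v)
    (hD : ∀ e ∈ A, e.cable '' Icc 0 1 ⊆ D) :
    ∑ e ∈ A, (F (e.cable 1) - F (e.cable 0)) = 0 := by
  classical
  have h0 : (0 : ℝ) ∈ Icc (0 : ℝ) 1 := by simp
  have h1 : (1 : ℝ) ∈ Icc (0 : ℝ) 1 := by simp
  set f : V → ℝ := fun w => if w = v then 1 else 0 with hf
  have hsymm : ∀ e ∈ A.image Dart.symm, e.snd = v := by
    intro e he
    obtain ⟨e', he', rfl⟩ := Finset.mem_image.1 he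
    exact (hA e').1 he'
  have hsymm' : ∀ e : G.Dart, e.snd = v → e ∈ A.image Dart.symm := fun e he =>
    Finset.mem_image.2 ⟨e.symm, (hA _).2 he, Dart.symm_symm e⟩
  have htest : IsTest (G := G) (fun e t => f e.fst + t * (f e.snd - f e.fst))
      (fun e _ => f e.snd - f e.fst) f (A ∪ A.image Dart.symm) 1 := by
    refine ⟨isProfile_linear f, fun e t _ => ?_, fun e => continuousOn_const, fun e t _ => ?_,
      fun e he t _ => ?_⟩
    · have := ((hasDerivAt_id t).mul_const (f e.snd - f e.fst)).const_add (f e.fst)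
      rw [one_mul] at this
      exact this.hasDerivWithinAt
    · simp only [hf]
      split_ifs <;> norm_num
    · rw [Finset.mem_union, not_or] at he
      have h2 : e.fst ≠ v := fun h => he.1 ((hA e).2 h)
      have h3 : e.snd ≠ v := fun h => he.2 (hsymm' e h)
      simp [hf, h2, h3]
  have hK : IsClosed (⋃ e ∈ A, e.cable '' Icc (0 : ℝ) 1) :=
    (A.isCompact_biUnion fun e _ => isCompact_Icc.image e.continuous_cable).isClosed
  have h2 := htest.sum_eq_zero hu hK (iUnion₂_subset hD) ?_
  · rw [Finset.sum_union, Finset.sum_image (Dart.symm_involutive.injective.injOn)] at h2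
    · have h3 : ∀ e ∈ A, ∫ t in (0 : ℝ)..1, gradient u (e, t) * (f e.snd - f e.fst) =
          -(F (e.cable 1) - F (e.cable 0)) := by
        intro e he
        have h4 : e.fst = v := (hA e).1 he
        have h5 : e.snd ≠ v := fun h => e.adj.ne (h4.trans h.symm)
        rw [intervalIntegral.integral_mul_const, ← hF.sub_eq e h0 h1]
        simp [hf, h4, h5]
      have h3' : ∀ e ∈ A, ∫ t in (0 : ℝ)..1, gradient u (e.symm, t) *
          (f e.symm.snd - f e.symm.fst) = -(F (e.cable 1) - F (e.cable 0)) := by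
        intro e he
        have h4 : e.symm.snd = v := (hA e).1 he
        have h5 : e.symm.fst ≠ v := fun h => e.symm.adj.ne (h.trans h4.symm)
        rw [intervalIntegral.integral_mul_const, ← hF.sub_eq e.symm h0 h1, ← e.symm_cable h0,
          ← e.symm_cable h1, sub_self, sub_zero]
        simp only [hf]
        rw [if_pos h4, if_neg h5]
        ring
      rw [Finset.sum_congr rfl h3, Finset.sum_congr rfl h3', Finset.sum_neg_distrib] at h2
      linarith
    · rw [Finset.disjoint_left]
      intro e he he'
      exact e.adj.ne (((hA e).1 he).trans (hsymm e he').symm)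
  · intro e he t ht _
    rcases Finset.mem_union.1 he with h | h
    · exact mem_biUnion h (mem_image_of_mem _ ht)
    · obtain ⟨e', he', rfl⟩ := Finset.mem_image.1 h
      have ht' : 1 - t ∈ Icc (0 : ℝ) 1 := ⟨by linarith [ht.2], by linarith [ht.1]⟩
      refine mem_biUnion he' ⟨1 - t, ht', ?_⟩
      rw [← e'.symm_cable ht', sub_sub_cancel]

end IsRep

end SimpleGraph

/-! ### Combinatorics of self-similar cells -/

/-- The data of a self-similar lattice graph: the scaling factor `c`, the points `P i` of the
basic cell in integer coordinates, and the graph `H` on the basic cell. -/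
structure CellData (d : ℕ) (ι : Type*) where
  /-- The scaling factor. -/
  c : ℕ
  /-- The points of the basic cell, which are also the fixed points of the contractions. -/
  P : ι → Fin d → ℤ
  /-- The graph on the basic cell. -/
  H : SimpleGraph ι

namespace CellData

variable {d : ℕ} {ι : Type*} (S : CellData d ι)

/-- An `n`-cell is given by its position `a`, and its corners are `cⁿ (a + P i)`; its `i`-th child
is the `(n - 1)`-cell sharing the corner with index `i`. -/
def child (a : Fin d → ℤ) (i : ι) : Fin d → ℤ := (S.c : ℤ) • a + ((S.c : ℤ) - 1) • S.P i

/-- The corner with index `i` of the `n`-cell at position `a`. -/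
def corner (n : ℕ) (a : Fin d → ℤ) (i : ι) : Fin d → ℤ := (S.c : ℤ) ^ n • (a + S.P i)

/-- The positions of the cells of the blown-up graph. They are the same for all levels, because the
expansion by `c` maps the `n`-cells to the `(n + 1)`-cells. -/
inductive IsPosition : (Fin d → ℤ) → Prop
  | zero : IsPosition 0
  | child (a : Fin d → ℤ) (i : ι) : IsPosition a → IsPosition (S.child a i)

lemma corner_succ (n : ℕ) (a : Fin d → ℤ) (i : ι) :
    S.corner (n + 1) a i = S.corner n (S.child a i) i := by
  ext x
  simp only [corner, child, Pi.smul_apply, Pi.add_apply, smul_eq_mul]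
  ring

lemma corner_child (n : ℕ) (a : Fin d → ℤ) (k i : ι) :
    S.corner n (S.child a k) i = (S.c : ℤ) ^ n • ((S.c : ℤ) • a + (S.child 0 k + S.P i)) := by
  ext x
  simp only [corner, child, Pi.smul_apply, Pi.add_apply, Pi.zero_apply, smul_eq_mul]
  ring

lemma corner_succ' (n : ℕ) (a : Fin d → ℤ) (i : ι) :
    S.corner (n + 1) a i = (S.c : ℤ) ^ n • ((S.c : ℤ) • a + (S.c : ℤ) • S.P i) := by
  ext x
  simp only [corner, Pi.smul_apply, Pi.add_apply, smul_eq_mul]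
  ring

@[simp]
lemma corner_zero (a : Fin d → ℤ) (i : ι) : S.corner 0 a i = a + S.P i := by
  simp [corner]

variable [Fintype ι]

open Classical in
/-- The positions of the `0`-cells contained in the `n`-cell at position `a`. -/
def descendants : ℕ → (Fin d → ℤ) → Finset (Fin d → ℤ)
  | 0, a => {a}
  | n + 1, a => Finset.univ.biUnion fun i => descendants n (S.child a i)

lemma mem_descendants_succ {n : ℕ} {a b : Fin d → ℤ} :
    b ∈ S.descendants (n + 1) a ↔ ∃ i, b ∈ S.descendants n (S.child a i) := by
  simp [descendants]

open Classical in
/-- The Laplacian of the basic cell. -/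
def cellLap (f : ι → ℝ) (i : ι) : ℝ := ∑ j, if S.H.Adj i j then f j - f i else 0

open Classical in
/-- The Laplacian at `v` of the graph formed by the edges of the `n`-cell at position `a`. -/
def lap (h : (Fin d → ℤ) → ℝ) (n : ℕ) (a v : Fin d → ℤ) : ℝ :=
  ∑ b ∈ S.descendants n a, ∑ i, if b + S.P i = v then S.cellLap (fun j => h (b + S.P j)) i else 0

open Classical in
/-- The Laplacian of the graph of the basic cell subdivided once. -/
def subdividedLap (f : (Fin d → ℤ) → ℝ) (z : Fin d → ℤ) : ℝ :=
  ∑ k, ∑ i, if S.child 0 k + S.P i = z then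
    S.cellLap (fun j => f (S.child 0 k + S.P j)) i else 0

/-- `h` is harmonic on the `n`-cell at position `a` off its corners. -/
def IsHarmonicCell (h : (Fin d → ℤ) → ℝ) (n : ℕ) (a : Fin d → ℤ) : Prop :=
  ∀ v, (∀ k, v ≠ S.corner n a k) → S.lap h n a v = 0

/-- The properties of the cells that the argument uses. The essential ones are `sep` (the cells of
the same level meet at corners only) and `lap_eq`, `contract`: for a function that is harmonic on
the once subdivided basic cell off its corners, the flux out of the corners is `ρ` times the flux
of the basic cell, and the increments on the smaller cells are at most `ρ` times those on the
basic cell. -/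
structure IsHarmonicStructure (ρ : ℝ) : Prop where
  two_le : 2 ≤ S.c
  rho_pos : 0 < ρ
  rho_lt : ρ < 1
  /-- The points of the basic cell are pairwise incongruent modulo `c`; hence different cells have
  different children. -/
  eq_of_dvd : ∀ i j, (∀ x, (S.c : ℤ) ∣ S.P i x - S.P j x) → i = j
  /-- The basic cell has a corner at the centre of the expansion, so that the
  `n`-cell at position `0` is contained in the `(n + 1)`-cell at position `0`. -/
  exists_zero : ∃ z, S.P z = 0
  exists_adj : ∃ i j, S.H.Adj i j
  /-- The basic cell has diameter at most two. -/
  diam : ∀ i j, i = j ∨ S.H.Adj i j ∨ ∃ k, S.H.Adj i k ∧ S.H.Adj k j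
  /-- Neighbouring corners of the subdivided basic cell are joined by a path of `c` edges. -/
  chain : ∀ (f : (Fin d → ℤ) → ℝ) (M : ℝ), (∀ k i j, S.H.Adj i j →
    |f (S.child 0 k + S.P i) - f (S.child 0 k + S.P j)| ≤ M) → ∀ i j, S.H.Adj i j →
      |f ((S.c : ℤ) • S.P i) - f ((S.c : ℤ) • S.P j)| ≤ S.c * M
  sep : ∀ n a a', S.IsPosition a → S.IsPosition a' → a ≠ a' → ∀ b ∈ S.descendants n a,
    ∀ b' ∈ S.descendants n a', ∀ i j, b + S.P i = b' + S.P j → ∃ k, b + S.P i = S.corner n a k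
  /-- Every oriented edge of the graph belongs to a single `0`-cell. -/
  edge_unique : ∀ b b', S.IsPosition b → S.IsPosition b' → ∀ i j k l, S.H.Adj i j → S.H.Adj k l →
    b + S.P i = b' + S.P k → b + S.P j = b' + S.P l → b = b'
  lap_eq : ∀ f : (Fin d → ℤ) → ℝ,
    (∀ z, (∀ i, z ≠ (S.c : ℤ) • S.P i) → S.subdividedLap f z = 0) →
      ∀ i, S.subdividedLap f ((S.c : ℤ) • S.P i) =
        ρ * S.cellLap (fun j => f ((S.c : ℤ) • S.P j)) i
  contract : ∀ f : (Fin d → ℤ) → ℝ,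
    (∀ z, (∀ i, z ≠ (S.c : ℤ) • S.P i) → S.subdividedLap f z = 0) → ∀ M : ℝ,
      (∀ i j, S.H.Adj i j → |f ((S.c : ℤ) • S.P i) - f ((S.c : ℤ) • S.P j)| ≤ M) →
        ∀ k i j, S.H.Adj i j →
          |f (S.child 0 k + S.P i) - f (S.child 0 k + S.P j)| ≤ ρ * M

namespace IsHarmonicStructure

variable {S} {ρ : ℝ} (hS : S.IsHarmonicStructure ρ)

include hS

lemma c_pos : (0 : ℤ) < S.c := by
  have := hS.two_le
  omega

lemma P_injective : Function.Injective S.P := fun i j h =>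
  hS.eq_of_dvd i j fun x => by simp [h]

lemma corner_injective (n : ℕ) (a : Fin d → ℤ) : Function.Injective (S.corner n a) := by
  intro i j h
  have hc : ((S.c : ℤ) ^ n) ≠ 0 := pow_ne_zero _ hS.c_pos.ne'
  exact hS.P_injective (add_left_cancel (smul_right_injective _ hc h))

lemma child_inj {a a' : Fin d → ℤ} {i j : ι} (h : S.child a i = S.child a' j) :
    a = a' ∧ i = j := by
  have hij : i = j := by
    refine hS.eq_of_dvd i j fun x => ?_
    have hx := congrFun h x
    simp only [child, Pi.add_apply, Pi.smul_apply, smul_eq_mul] at hx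
    refine ⟨(a x - a' x) + (S.P i x - S.P j x), ?_⟩
    linarith
  subst hij
  exact ⟨smul_right_injective _ hS.c_pos.ne' (add_right_cancel h), rfl⟩

lemma disjoint_descendants {n : ℕ} {a a' : Fin d → ℤ} (h : a ≠ a') :
    Disjoint (S.descendants n a) (S.descendants n a') := by
  induction n generalizing a a' with
  | zero => simpa [descendants] using h
  | succ n ih =>
    rw [Finset.disjoint_left]
    intro b hb hb'
    obtain ⟨i, hi⟩ := S.mem_descendants_succ.1 hb
    obtain ⟨j, hj⟩ := S.mem_descendants_succ.1 hb'
    exact Finset.disjoint_left.1 (ih fun h' => h (hS.child_inj h').1) hi hj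

lemma disjoint_children (n : ℕ) (a : Fin d → ℤ) :
    (↑(Finset.univ : Finset ι) : Set ι).PairwiseDisjoint
      fun i => S.descendants n (S.child a i) :=
  fun _ _ _ _ hij => hS.disjoint_descendants fun h => hij (hS.child_inj h).2

lemma card_descendants (n : ℕ) (a : Fin d → ℤ) :
    (S.descendants n a).card = Fintype.card ι ^ n := by
  induction n generalizing a with
  | zero => simp [descendants]
  | succ n ih =>
    rw [descendants, Finset.card_biUnion (hS.disjoint_children n a)]
    simp [ih, pow_succ, mul_comm]

omit hS in
lemma isPosition_of_mem {n : ℕ} {a b : Fin d → ℤ} (ha : S.IsPosition a)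
    (hb : b ∈ S.descendants n a) : S.IsPosition b := by
  induction n generalizing a with
  | zero => rwa [Finset.mem_singleton.1 hb]
  | succ n ih =>
    obtain ⟨i, hi⟩ := S.mem_descendants_succ.1 hb
    exact ih (.child a i ha) hi

lemma exists_ancestor (n : ℕ) {b : Fin d → ℤ} (hb : S.IsPosition b) :
    ∃ a, S.IsPosition a ∧ b ∈ S.descendants n a := by
  induction n with
  | zero => exact ⟨b, hb, Finset.mem_singleton_self b⟩
  | succ n ih =>
    obtain ⟨a, ha, hba⟩ := ih
    rcases ha with _ | ⟨a', i, ha'⟩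
    · obtain ⟨z, hz⟩ := hS.exists_zero
      refine ⟨0, .zero, S.mem_descendants_succ.2 ⟨z, ?_⟩⟩
      simpa [child, hz] using hba
    · exact ⟨a', ha', S.mem_descendants_succ.2 ⟨i, hba⟩⟩

omit hS in
lemma exists_corner_eq (n : ℕ) (a : Fin d → ℤ) (i : ι) :
    ∃ b ∈ S.descendants n a, b + S.P i = S.corner n a i := by
  induction n generalizing a with
  | zero => exact ⟨a, Finset.mem_singleton_self a, by simp⟩
  | succ n ih =>
    obtain ⟨b, hb, h⟩ := ih (S.child a i)
    exact ⟨b, S.mem_descendants_succ.2 ⟨i, hb⟩, by rw [h, corner_succ]⟩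

omit hS in
lemma exists_bound (S : CellData d ι) : ∃ p : ℤ, 0 ≤ p ∧ ∀ i x, |S.P i x| ≤ p := by
  refine ⟨∑ i, ∑ x, |S.P i x|, Finset.sum_nonneg fun _ _ => Finset.sum_nonneg fun _ _ =>
    abs_nonneg _, fun i x => ?_⟩
  refine (Finset.single_le_sum (f := fun x => |S.P i x|) (fun _ _ => abs_nonneg _)
    (Finset.mem_univ x)).trans ?_
  exact Finset.single_le_sum (f := fun i => ∑ x, |S.P i x|)
    (fun _ _ => Finset.sum_nonneg fun _ _ => abs_nonneg _) (Finset.mem_univ i)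

lemma abs_sub_le_of_mem {p : ℤ} (hp : ∀ i x, |S.P i x| ≤ p) {n : ℕ} {a b : Fin d → ℤ}
    (hb : b ∈ S.descendants n a) (x : Fin d) :
    |b x - (S.c : ℤ) ^ n * a x| ≤ ((S.c : ℤ) ^ n - 1) * p := by
  induction n generalizing a with
  | zero => simp [Finset.mem_singleton.1 hb]
  | succ n ih =>
    obtain ⟨i, hi⟩ := S.mem_descendants_succ.1 hb
    have h1 := ih hi
    have hc : (0 : ℤ) < (S.c : ℤ) ^ n := pow_pos hS.c_pos _
    have hc1 : (0 : ℤ) ≤ (S.c : ℤ) - 1 := by linarith [hS.c_pos]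
    have h2 : (S.c : ℤ) ^ n * S.child a i x - (S.c : ℤ) ^ (n + 1) * a x =
        ((S.c : ℤ) ^ n * ((S.c : ℤ) - 1)) * S.P i x := by
      simp only [child, Pi.add_apply, Pi.smul_apply, smul_eq_mul]
      ring
    have h3 : |(S.c : ℤ) ^ n * S.child a i x - (S.c : ℤ) ^ (n + 1) * a x| ≤
        ((S.c : ℤ) ^ n * ((S.c : ℤ) - 1)) * p := by
      rw [h2, abs_mul, abs_of_nonneg (mul_nonneg hc.le hc1)]
      exact mul_le_mul_of_nonneg_left (hp i x) (mul_nonneg hc.le hc1)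
    refine (abs_sub_le _ _ _).trans ((add_le_add h1 h3).trans (le_of_eq ?_))
    ring

/-! ### Renormalization of the Laplacian -/

lemma lap_succ (h : (Fin d → ℤ) → ℝ) (n : ℕ) (a v : Fin d → ℤ) :
    S.lap h (n + 1) a v = ∑ k, S.lap h n (S.child a k) v := by
  rw [lap, descendants, Finset.sum_biUnion (hS.disjoint_children n a)]
  rfl

omit hS in
lemma exists_of_lap_ne_zero {h : (Fin d → ℤ) → ℝ} {n : ℕ} {a v : Fin d → ℤ}
    (hv : S.lap h n a v ≠ 0) : ∃ b ∈ S.descendants n a, ∃ i, b + S.P i = v := by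
  obtain ⟨b, hb, hb'⟩ := Finset.exists_ne_zero_of_sum_ne_zero hv
  obtain ⟨i, -, hi⟩ := Finset.exists_ne_zero_of_sum_ne_zero hb'
  refine ⟨b, hb, i, ?_⟩
  by_contra hne
  exact hi (if_neg hne)

/-- Harmonicity passes to the smaller cells, since these meet each other at corners only. -/
lemma isHarmonicCell_child {h : (Fin d → ℤ) → ℝ} {n : ℕ} {a : Fin d → ℤ} (ha : S.IsPosition a)
    (hh : S.IsHarmonicCell h (n + 1) a) (i : ι) : S.IsHarmonicCell h n (S.child a i) := by
  intro v hv
  by_contra hne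
  obtain ⟨b, hb, j, rfl⟩ := exists_of_lap_ne_zero hne
  have hother : ∀ k, k ≠ i → ∀ b' ∈ S.descendants n (S.child a k), ∀ l,
      b + S.P j ≠ b' + S.P l := by
    intro k hk b' hb' l hbb
    obtain ⟨m, hm⟩ := hS.sep n _ _ (.child a i ha) (.child a k ha)
      (fun h' => hk (hS.child_inj h').2.symm) b hb b' hb' j l hbb
    exact hv m hm
  have h1 := hh (b + S.P j) ?_
  · rw [hS.lap_succ, Finset.sum_eq_single i] at h1
    · exact hne h1
    · intro k _ hk
      by_contra hne'
      obtain ⟨b', hb', l, hl⟩ := exists_of_lap_ne_zero hne'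
      exact hother k hk b' hb' l hl.symm
    · simp
  · intro k hk
    rw [corner_succ] at hk
    obtain ⟨b', hb', hbk⟩ := exists_corner_eq (S := S) n (S.child a k) k
    rcases eq_or_ne k i with rfl | hki
    · exact hv k hk
    · exact hother k hki b' hb' k (hk.trans hbk.symm)

/-- The Laplacian of a cell, applied to a function harmonic off the corners, is a multiple of the
Laplacian of the graph of its corners. Consequently the restriction to the corners of the cells one
level below is harmonic on the once subdivided basic cell off its corners; this is the second
part, which the induction provides along with the first. -/
lemma lap_eq_pow {h : (Fin d → ℤ) → ℝ} {n : ℕ} {a : Fin d → ℤ} (ha : S.IsPosition a)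
    (hh : S.IsHarmonicCell h n a) (i : ι) :
    S.lap h n a (S.corner n a i) = ρ ^ n * S.cellLap (fun j => h (S.corner n a j)) i ∧
    (∀ m, n = m + 1 → ∀ z, (∀ k, z ≠ (S.c : ℤ) • S.P k) →
      S.subdividedLap (fun z => h ((S.c : ℤ) ^ m • ((S.c : ℤ) • a + z))) z = 0) := by
  induction n generalizing a i with
  | zero =>
    refine ⟨?_, fun m hm => by omega⟩
    simp only [lap, descendants, Finset.sum_singleton, corner_zero, pow_zero, one_mul]
    rw [Finset.sum_eq_single i]
    · simp
    · intro j _ hj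
      exact if_neg fun h' => hj (hS.P_injective (add_left_cancel h'))
    · simp
  | succ n ih =>
    set f : (Fin d → ℤ) → ℝ := fun z => h ((S.c : ℤ) ^ n • ((S.c : ℤ) • a + z)) with hf
    have hinj : ∀ z z' : Fin d → ℤ, (S.c : ℤ) ^ n • ((S.c : ℤ) • a + z) =
        (S.c : ℤ) ^ n • ((S.c : ℤ) • a + z') → z = z' := fun z z' hz =>
      add_left_cancel (smul_right_injective _ (pow_ne_zero n hS.c_pos.ne') hz)
    have hchild : ∀ k v, S.lap h n (S.child a k) v = ρ ^ n * ∑ j, open Classical in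
        if S.corner n (S.child a k) j = v then
          S.cellLap (fun l => h (S.corner n (S.child a k) l)) j else 0 := by
      intro k v
      have hk := hS.isHarmonicCell_child ha hh k
      by_cases hv : ∃ j, v = S.corner n (S.child a k) j
      · obtain ⟨j, rfl⟩ := hv
        rw [(ih (.child a k ha) hk j).1, Finset.sum_eq_single j]
        · simp
        · intro l _ hl
          exact if_neg fun h' => hl (hS.corner_injective n _ h')
        · simp
      · push Not at hv
        rw [hk v hv, Finset.sum_eq_zero, mul_zero]
        intro j _
        exact if_neg fun h' => hv j h'.symm
    have hlap : ∀ z, S.lap h (n + 1) a ((S.c : ℤ) ^ n • ((S.c : ℤ) • a + z)) =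
        ρ ^ n * S.subdividedLap f z := by
      intro z
      rw [hS.lap_succ, subdividedLap, Finset.mul_sum]
      refine Finset.sum_congr rfl fun k _ => ?_
      rw [hchild]
      congr 1
      refine Finset.sum_congr rfl fun j _ => ?_
      simp only [corner_child]
      exact if_congr ⟨fun h' => hinj _ _ h', fun h' => by rw [h']⟩ rfl rfl
    have hsub : ∀ z, (∀ k, z ≠ (S.c : ℤ) • S.P k) → S.subdividedLap f z = 0 := by
      intro z hz
      have h1 := hh ((S.c : ℤ) ^ n • ((S.c : ℤ) • a + z)) fun k hk => hz k ?_
      · rw [hlap] at h1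
        exact (mul_eq_zero.1 h1).resolve_left (pow_ne_zero n hS.rho_pos.ne')
      · rw [corner_succ'] at hk
        exact hinj _ _ hk
    refine ⟨?_, fun m hm => ?_⟩
    · simp only [corner_succ']
      rw [hlap, hS.lap_eq f hsub i, pow_succ]
      ring
    · obtain rfl : n = m := by omega
      exact hsub

/-- `M` bounds the increments of `h` between neighbouring corners of the `n`-cell at `a`. -/
def _root_.CellData.IncrementsLE (S : CellData d ι) (h : (Fin d → ℤ) → ℝ) (n : ℕ)
    (a : Fin d → ℤ) (M : ℝ) : Prop :=
  ∀ i j, S.H.Adj i j → |h (S.corner n a i) - h (S.corner n a j)| ≤ M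

lemma incrementsLE_child {h : (Fin d → ℤ) → ℝ} {n : ℕ} {a : Fin d → ℤ} {M : ℝ}
    (ha : S.IsPosition a) (hh : S.IsHarmonicCell h (n + 1) a)
    (hM : S.IncrementsLE h (n + 1) a M) (k : ι) :
    S.IncrementsLE h n (S.child a k) (ρ * M) := by
  intro i j hij
  have h1 := hS.contract _ ((hS.lap_eq_pow ha hh i).2 n rfl) M
    (fun i j hij => by simpa only [corner_succ'] using hM i j hij) k i j hij
  simpa only [corner_child] using h1

lemma abs_sub_le_of_diam {f : ι → ℝ} {M : ℝ} (hM : ∀ i j, S.H.Adj i j → |f i - f j| ≤ M)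
    (i j : ι) : |f i - f j| ≤ 2 * M := by
  obtain ⟨i', j', h'⟩ := hS.exists_adj
  have hM0 : 0 ≤ M := (abs_nonneg _).trans (hM i' j' h')
  rcases hS.diam i j with rfl | h | ⟨k, h1, h2⟩
  · simpa using hM0
  · linarith [hM i j h]
  · have := abs_sub_le (f i) (f k) (f j)
    linarith [hM i k h1, hM k j h2]

/-- The increments contract by the factor `ρ` from level to level. -/
lemma abs_edge_le {h : (Fin d → ℤ) → ℝ} {n : ℕ} {a b : Fin d → ℤ} {M : ℝ}
    (ha : S.IsPosition a) (hh : S.IsHarmonicCell h n a) (hM : S.IncrementsLE h n a M)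
    (hb : b ∈ S.descendants n a) {i j : ι} (hij : S.H.Adj i j) :
    |h (b + S.P i) - h (b + S.P j)| ≤ ρ ^ n * M := by
  induction n generalizing a M with
  | zero =>
    rw [Finset.mem_singleton.1 hb]
    simpa using hM i j hij
  | succ n ih =>
    obtain ⟨k, hk⟩ := S.mem_descendants_succ.1 hb
    have := ih (.child a k ha) (hS.isHarmonicCell_child ha hh k)
      (hS.incrementsLE_child ha hh hM k) hk
    rwa [pow_succ, mul_assoc]

/-- The oscillation on a cell, summed up along the chain of the cells that contain a vertex. -/
lemma abs_sub_corner_le {h : (Fin d → ℤ) → ℝ} {n : ℕ} {a b : Fin d → ℤ} {M : ℝ}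
    (ha : S.IsPosition a) (hh : S.IsHarmonicCell h n a) (hM : S.IncrementsLE h n a M)
    (hb : b ∈ S.descendants n a) (i j : ι) :
    |h (b + S.P i) - h (S.corner n a j)| ≤ 2 * M / (1 - ρ) := by
  have hρ : 0 < 1 - ρ := by linarith [hS.rho_lt]
  have hρ' := hS.rho_pos
  induction n generalizing a M j with
  | zero =>
    rw [Finset.mem_singleton.1 hb]
    have h1 := hS.abs_sub_le_of_diam (f := fun i => h (a + S.P i)) (M := M)
      (fun i j hij => by simpa using hM i j hij) i j
    rw [corner_zero]
    refine h1.trans ?_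
    have hM0 : 0 ≤ 2 * M := (abs_nonneg _).trans h1
    rw [le_div_iff₀ hρ]
    nlinarith
  | succ n ih =>
    obtain ⟨k, hk⟩ := S.mem_descendants_succ.1 hb
    have h1 := ih (.child a k ha) (hS.isHarmonicCell_child ha hh k)
      (hS.incrementsLE_child ha hh hM k) hk k
    rw [← corner_succ] at h1
    have h2 := hS.abs_sub_le_of_diam (f := fun i => h (S.corner (n + 1) a i)) hM k j
    have h3 := abs_sub_le (h (b + S.P i)) (h (S.corner (n + 1) a k)) (h (S.corner (n + 1) a j))
    have h4 : 2 * M / (1 - ρ) = 2 * (ρ * M) / (1 - ρ) + 2 * M := by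
      field_simp
      ring
    linarith

/-- The cell `m` levels below that shares a given corner. -/
lemma exists_small_cell (m n : ℕ) {h : (Fin d → ℤ) → ℝ} {a : Fin d → ℤ} {M : ℝ}
    (ha : S.IsPosition a) (hh : S.IsHarmonicCell h (n + m) a)
    (hM : S.IncrementsLE h (n + m) a M) (i : ι) :
    ∃ a', S.IsPosition a' ∧ S.descendants n a' ⊆ S.descendants (n + m) a ∧
      S.IsHarmonicCell h n a' ∧ S.IncrementsLE h n a' (ρ ^ m * M) ∧
      S.corner n a' i = S.corner (n + m) a i := by
  induction m generalizing a M with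
  | zero => exact ⟨a, ha, subset_rfl, hh, by simpa using hM, rfl⟩
  | succ m ih =>
    obtain ⟨a', h1, h2, h3, h4, h5⟩ := ih (.child a i ha) (hS.isHarmonicCell_child ha hh i)
      (hS.incrementsLE_child ha hh hM i)
    refine ⟨a', h1, h2.trans fun b hb => ?_, h3, ?_, ?_⟩
    · exact S.mem_descendants_succ.2 ⟨i, hb⟩
    · rwa [pow_succ, mul_assoc]
    · rw [h5]
      exact (S.corner_succ (n + m) a i).symm

/-- A function harmonic on a cell off its corners is comparable to its maximal increment `M`
between corners on a cell that is smaller by a fixed number of levels: the one at a corner where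
the absolute value is at least `M / 2`. -/
lemma exists_large_cell {m : ℕ} (hm : 8 * ρ ^ m ≤ 1 - ρ) (n : ℕ) {h : (Fin d → ℤ) → ℝ}
    {a : Fin d → ℤ} (ha : S.IsPosition a) (hh : S.IsHarmonicCell h (n + m) a) :
    ∃ M y : ℝ, M / 2 ≤ |y| ∧ S.IncrementsLE h (n + m) a M ∧
      ∃ a', S.descendants n a' ⊆ S.descendants (n + m) a ∧
        ∀ b ∈ S.descendants n a', ∀ i, |h (b + S.P i) - y| ≤ M / 4 := by
  obtain ⟨i₀, j₀, hij₀⟩ := hS.exists_adj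
  have hρ : 0 < 1 - ρ := by linarith [hS.rho_lt]
  classical
  obtain ⟨p, hp, hmax⟩ := ((Finset.univ : Finset (ι × ι)).filter fun p : ι × ι =>
    S.H.Adj p.1 p.2).exists_max_image
    (fun p : ι × ι => |h (S.corner (n + m) a p.1) - h (S.corner (n + m) a p.2)|)
    ⟨(i₀, j₀), by simpa using hij₀⟩
  set M := |h (S.corner (n + m) a p.1) - h (S.corner (n + m) a p.2)| with hMdef
  have hM : S.IncrementsLE h (n + m) a M := fun i j hij => hmax (i, j) (by simpa using hij)
  have hM0 : 0 ≤ M := abs_nonneg _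
  have hy : ∃ i, M / 2 ≤ |h (S.corner (n + m) a i)| := by
    by_contra hcon
    push Not at hcon
    have := abs_sub (h (S.corner (n + m) a p.1)) (h (S.corner (n + m) a p.2))
    linarith [hcon p.1, hcon p.2]
  obtain ⟨i, hi⟩ := hy
  obtain ⟨a', h1, h2, h3, h4, h5⟩ := hS.exists_small_cell m n ha hh hM i
  refine ⟨M, _, hi, hM, a', h2, fun b hb j => ?_⟩
  rw [← h5]
  refine (hS.abs_sub_corner_le h1 h3 h4 hb j i).trans ?_
  -- the oscillation is at most `2 ρᵐ M / (1 - ρ) ≤ M / 4`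
  rw [div_le_iff₀ hρ]
  nlinarith

/-- Applied to the distance function of the graph, this says that neighbouring corners of an
`n`-cell are at distance at most `cⁿ`. -/
lemma abs_sub_corner_le_pow {f : (Fin d → ℤ) → ℝ}
    (hf : ∀ b, S.IsPosition b → ∀ i j, S.H.Adj i j → |f (b + S.P i) - f (b + S.P j)| ≤ 1)
    (n : ℕ) {a : Fin d → ℤ} (ha : S.IsPosition a) :
    S.IncrementsLE f n a ((S.c : ℝ) ^ n) := by
  induction n generalizing a with
  | zero =>
    intro i j hij
    simpa using hf a ha i j hij
  | succ n ih =>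
    intro i j hij
    have h1 := hS.chain (fun z => f ((S.c : ℤ) ^ n • ((S.c : ℤ) • a + z))) ((S.c : ℝ) ^ n)
      (fun k i j hij => by simpa only [corner_child] using ih (.child a k ha) i j hij) i j hij
    rw [pow_succ, mul_comm]
    simpa only [corner_succ'] using h1

/-- Applied to the distance function of the graph, this bounds the diameter of an `n`-cell. -/
lemma abs_sub_corner_le_four {f : (Fin d → ℤ) → ℝ}
    (hf : ∀ b, S.IsPosition b → ∀ i j, S.H.Adj i j → |f (b + S.P i) - f (b + S.P j)| ≤ 1)
    (n : ℕ) {a b : Fin d → ℤ} (ha : S.IsPosition a) (hb : b ∈ S.descendants n a) (i j : ι) :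
    |f (b + S.P i) - f (S.corner n a j)| ≤ 4 * (S.c : ℝ) ^ n := by
  induction n generalizing a j with
  | zero =>
    rw [Finset.mem_singleton.1 hb]
    have h1 := hS.abs_sub_le_of_diam (f := fun i => f (a + S.P i)) (M := 1)
      (fun i j hij => hf a ha i j hij) i j
    rw [corner_zero]
    refine h1.trans ?_
    norm_num
  | succ n ih =>
    obtain ⟨k, hk⟩ := S.mem_descendants_succ.1 hb
    have h1 := ih (.child a k ha) hk k
    rw [← corner_succ] at h1
    have h2 := hS.abs_sub_le_of_diam (f := fun i => f (S.corner (n + 1) a i))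
      (hS.abs_sub_corner_le_pow hf (n + 1) ha) k j
    have h3 := abs_sub_le (f (b + S.P i)) (f (S.corner (n + 1) a k)) (f (S.corner (n + 1) a j))
    have h4 : (2 : ℝ) ≤ S.c := by exact_mod_cast hS.two_le
    have h5 : (0 : ℝ) < (S.c : ℝ) ^ n := by positivity
    rw [pow_succ] at h2 ⊢
    nlinarith

end IsHarmonicStructure

end CellData

namespace SimpleGraph

variable {V : Type*} [Countable V] {G : SimpleGraph V} [Fact G.Connected]

/-! ### Balls and integrals over balls -/

omit [Countable V] [Fact G.Connected] in
lemma dartMeasure_apply {A : Set (G.Dart × ℝ)} (hA : MeasurableSet A) :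
    G.dartMeasure A = ∑' e : G.Dart, volume.restrict (Icc (0 : ℝ) 1) (Prod.mk e ⁻¹' A) := by
  rw [dartMeasure, Measure.prod_apply hA, lintegral_count]

/-- A ball meets a cable in a set of diameter at most twice the radius. -/
lemma cableMeasure_ball_le {x : G.CableSpace} {s : ℝ} {T : Finset G.Dart}
    (hT : ∀ e : G.Dart, ∀ t ∈ Icc (0 : ℝ) 1, e.cable t ∈ Metric.ball x s → e ∈ T) :
    G.cableMeasure (Metric.ball x s) ≤ ENNReal.ofReal (T.card * min 1 (2 * s)) := by
  have hpre : MeasurableSet (cableMap ⁻¹' Metric.ball x s : Set (G.Dart × ℝ)) :=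
    measurable_cableMap Metric.isOpen_ball.measurableSet
  have hslice : ∀ e : G.Dart, volume.restrict (Icc (0 : ℝ) 1)
      (Prod.mk e ⁻¹' (cableMap ⁻¹' Metric.ball x s)) ≤
      ENNReal.ofReal (min 1 (2 * s)) := by
    intro e
    rw [Measure.restrict_apply (hpre.preimage measurable_prodMk_left), ENNReal.ofReal_min]
    refine le_min ?_ ?_
    · refine (measure_mono inter_subset_right).trans ?_
      simp
    · refine (Real.volume_le_diam _).trans (Metric.ediam_le fun t ht t' ht' => ?_)
      rw [edist_dist, Real.dist_eq, ← e.dist_cable ht.2 ht'.2]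
      refine ENNReal.ofReal_le_ofReal ?_
      have h1 : Dist.dist (e.cable t) x < s := ht.1
      have h2 : Dist.dist (e.cable t') x < s := ht'.1
      have := dist_triangle_right (e.cable t) (e.cable t') x
      linarith
  rw [cableMeasure_apply Metric.isOpen_ball.measurableSet, dartMeasure_apply hpre,
    tsum_eq_sum (s := T)]
  · refine (mul_le_of_le_one_left zero_le (by simp)).trans ?_
    refine (Finset.sum_le_card_nsmul T _ _ fun e _ => hslice e).trans ?_
    rw [nsmul_eq_mul, ENNReal.ofReal_mul (by positivity), ENNReal.ofReal_natCast]
  · intro e he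
    rw [Measure.restrict_apply (hpre.preimage measurable_prodMk_left)]
    convert measure_empty (μ := volume)
    refine eq_empty_of_forall_notMem fun t ht => he (hT e t ht.2 ht.1)

omit [Fact G.Connected] in
lemma dartMeasure_restrict_prod (e : G.Dart) {A : Set ℝ} (hA : MeasurableSet A)
    (hA1 : A ⊆ Icc 0 1) :
    G.dartMeasure.restrict ({e} ×ˢ A) = (volume.restrict A).map (fun t => (e, t)) := by
  rw [dartMeasure, ← Measure.prod_restrict, Measure.restrict_singleton,
    Measure.count_singleton, one_smul, Measure.dirac_prod, Measure.restrict_restrict hA,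
    inter_eq_left.2 hA1]

/-- The integral over a ball is bounded below by the integrals over parts of cables. -/
lemma IsRep.le_setIntegral {u F : G.CableSpace → ℝ} (hF : IsRep u F) {B : Set G.CableSpace}
    (hB : MeasurableSet B) (hu : IntegrableOn u B G.cableMeasure) {A : Set ℝ}
    (hA : MeasurableSet A) (hA1 : A ⊆ Icc 0 1) {T : Finset G.Dart}
    (hT : ∀ e ∈ T, e.cable '' A ⊆ B) {J : ℝ}
    (hJ : ∀ e ∈ T, J ≤ ∫ t in A, |F (e.cable t)|) :
    T.card * J ≤ 2 * ∫ y in B, |u y| ∂G.cableMeasure := by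
  have h2 : (2⁻¹ : ℝ≥0∞) ≠ 0 := by simp
  have hpre : MeasurableSet (cableMap ⁻¹' B : Set (G.Dart × ℝ)) := measurable_cableMap hB
  have hum : IntegrableOn u B (G.dartMeasure.map cableMap) := by
    have h3 : G.dartMeasure.map cableMap = (2 : ℝ≥0∞) • G.cableMeasure := by
      rw [cableMeasure, smul_smul, ENNReal.mul_inv_cancel (by simp) (by simp), one_smul]
    rw [h3, IntegrableOn, Measure.restrict_smul]
    exact hu.smul_measure (by simp)
  have hum' : AEStronglyMeasurable u ((G.dartMeasure.map cableMap).restrict B) :=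
    hum.aestronglyMeasurable
  rw [Measure.restrict_map measurable_cableMap hB] at hum'
  have habs : AEStronglyMeasurable (fun y => |u y|)
      ((G.dartMeasure.restrict (cableMap ⁻¹' B)).map cableMap) := hum'.norm
  have heq : 2 * ∫ y in B, |u y| ∂G.cableMeasure =
      ∫ z in cableMap ⁻¹' B, |u (cableMap z)| ∂G.dartMeasure := by
    rw [cableMeasure, Measure.restrict_smul, integral_smul_measure,
      Measure.restrict_map measurable_cableMap hB,
      integral_map measurable_cableMap.aemeasurable habs]
    simp
  have hint : IntegrableOn (fun z => |u (cableMap z)|) (cableMap ⁻¹' B) G.dartMeasure := by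
    have h3 : IntegrableOn u B (G.dartMeasure.map cableMap) := hum
    rw [IntegrableOn, Measure.restrict_map measurable_cableMap hB,
      integrable_map_measure hum' measurable_cableMap.aemeasurable] at h3
    exact h3.abs
  have hsub : (⋃ e ∈ T, ({e} ×ˢ A : Set (G.Dart × ℝ))) ⊆ cableMap ⁻¹' B := by
    refine iUnion₂_subset fun e he => ?_
    rintro ⟨e', t⟩ ⟨h3, h4⟩
    obtain rfl : e' = e := h3
    exact hT e' he ⟨t, h4, rfl⟩
  rw [heq]
  refine le_trans ?_ (setIntegral_mono_set hint (ae_of_all _ fun _ => abs_nonneg _)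
    hsub.eventuallyLE)
  rw [integral_biUnion_finset]
  · rw [← nsmul_eq_mul]
    refine Finset.card_nsmul_le_sum _ _ _ fun e he => (hJ e he).trans (le_of_eq ?_)
    rw [dartMeasure_restrict_prod e hA hA1, (measurableEmbedding_dart e).integral_map]
    refine integral_congr_ae ?_
    have h3 := ae_mono (Measure.restrict_mono_set volume hA1) (hF.ae_eq e)
    filter_upwards [h3] with t ht
    rw [← ht]
    rfl
  · exact fun e _ => (measurableSet_singleton e).prod hA
  · intro e _ e' _ hne
    rw [Function.onFun, Set.disjoint_prod]
    exact Or.inl (by simpa using hne)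
  · exact fun e he => hint.mono_set ((subset_biUnion_of_mem (u := fun e =>
      ({e} ×ˢ A : Set (G.Dart × ℝ))) he).trans hsub)

omit [Countable V] in
lemma MemForm.integrableOn {u : G.CableSpace → ℝ} (hu : MemForm u) {B : Set G.CableSpace}
    (hB : G.cableMeasure B ≠ ∞) : IntegrableOn u B G.cableMeasure := by
  have : IsFiniteMeasure (G.cableMeasure.restrict B) := ⟨by
    rw [Measure.restrict_apply_univ]
    exact hB.lt_top⟩
  obtain ⟨g, hg⟩ := hu
  exact (hg.1.mono_measure Measure.restrict_le_self).integrable (by norm_num)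

/-! ### Small balls -/

/-- An affine function of slope `κ` has an integral of at least `|κ| ℓ² / 4` over an interval of
length `ℓ`: compare the values at points at distance `ℓ / 2`. -/
lemma le_integral_abs_of_affine {f : ℝ → ℝ} {κ a b : ℝ} (hab : a < b)
    (hf : ∀ s ∈ Icc a b, ∀ t ∈ Icc a b, f t - f s = κ * (t - s)) :
    |κ| * (b - a) ^ 2 / 4 ≤ ∫ t in Icc a b, |f t| := by
  have hcont : ContinuousOn f (Icc a b) := by
    refine ContinuousOn.congr (f := fun t => f a + κ * (t - a)) (by fun_prop) fun t ht => ?_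
    linarith [hf a (left_mem_Icc.2 hab.le) t ht]
  set l := (b - a) / 2 with hl
  have hl0 : 0 < l := by
    rw [hl]
    linarith
  have hi : IntervalIntegrable (fun t => |f t|) volume a b := by
    refine ContinuousOn.intervalIntegrable ?_
    rw [uIcc_of_le hab.le]
    exact hcont.abs
  have hi1 : IntervalIntegrable (fun t => |f t|) volume a (a + l) :=
    hi.mono_set (by
      rw [uIcc_of_le hab.le, uIcc_of_le (by linarith)]
      exact Icc_subset_Icc_right (by linarith))
  have hi2 : IntervalIntegrable (fun t => |f t|) volume (a + l) b :=
    hi.mono_set (by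
      rw [uIcc_of_le hab.le, uIcc_of_le (by linarith)]
      exact Icc_subset_Icc_left (by linarith))
  rw [integral_Icc_eq_integral_Ioc, ← intervalIntegral.integral_of_le hab.le,
    ← intervalIntegral.integral_add_adjacent_intervals hi1 hi2]
  have hb : b = a + l + l := by
    rw [hl]
    ring
  have hshift : ∫ t in (a + l)..b, |f t| = ∫ t in a..(a + l), |f (t + l)| := by
    rw [intervalIntegral.integral_comp_add_right (fun t => |f t|), ← hb]
  have hi3 : IntervalIntegrable (fun t => |f (t + l)|) volume a (a + l) := by
    have := hi2.comp_add_right l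
    rwa [add_sub_cancel_right, hb, add_sub_cancel_right] at this
  rw [hshift, ← intervalIntegral.integral_add hi1 hi3]
  have hconst : ∫ _ in a..(a + l), |κ| * l = |κ| * (b - a) ^ 2 / 4 := by
    rw [intervalIntegral.integral_const, smul_eq_mul, hl]
    ring
  rw [← hconst]
  refine intervalIntegral.integral_mono_on (by linarith) (by simp) (hi1.add hi3) fun t ht => ?_
  have h1 := hf t ⟨ht.1, by linarith [ht.2]⟩ (t + l) ⟨by linarith [ht.1], by linarith [ht.2]⟩
  rw [add_sub_cancel_left] at h1
  have h2 := abs_sub (f (t + l)) (f t)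
  rw [h1, abs_mul, abs_of_pos hl0] at h2
  linarith

/-- In balls of bounded radius the gradient of a harmonic function is controlled by the values of
the function on the cable at hand: the part of the cable within distance `r` of a point of the ball
has length at least `r / R₀`, and there the function is affine. -/
lemma abs_gradient_le_of_le {R₀ : ℝ} (hR : 1 ≤ R₀) {K : ℕ} {x : G.CableSpace} {r : ℝ} (hr : 0 < r)
    (hr' : r ≤ R₀) {T : Finset G.Dart} (hTK : T.card ≤ K)
    (hT : ∀ e : G.Dart, ∀ t ∈ Icc (0 : ℝ) 1, e.cable t ∈ Metric.ball x (2 * r) → e ∈ T)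
    {u : G.CableSpace → ℝ} (hu : IsHarmonicIn u (Metric.ball x (2 * r))) (e : G.Dart) :
    ∀ᵐ t ∂(volume.restrict (Icc (0 : ℝ) 1)), e.cable t ∈ Metric.ball x r →
      |gradient u (e, t)| ≤
        32 * R₀ ^ 2 * K * (1 / r) * ⨍ y in Metric.ball x (2 * r), |u y| ∂G.cableMeasure := by
  obtain ⟨F, hF⟩ := hu.1.exists_isRep
  set B := Metric.ball x (2 * r) with hB
  have hBm : G.cableMeasure B ≤ ENNReal.ofReal (T.card * min 1 (2 * (2 * r))) :=
    cableMeasure_ball_le hT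
  have hBfin : G.cableMeasure B ≠ ∞ := (hBm.trans_lt ENNReal.ofReal_lt_top).ne
  have hBr : G.cableMeasure.real B ≤ K * (4 * r) := by
    refine (ENNReal.toReal_le_of_le_ofReal (by positivity) hBm).trans ?_
    have h1 : (T.card : ℝ) ≤ K := by exact_mod_cast hTK
    have h2 : min 1 (2 * (2 * r)) ≤ 4 * r := (min_le_right _ _).trans (by linarith)
    have h3 : 0 ≤ min 1 (2 * (2 * r)) := by positivity
    exact mul_le_mul h1 h2 h3 (by positivity)
  set A := ⨍ y in B, |u y| ∂G.cableMeasure with hA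
  have hAint : ∫ y in B, |u y| ∂G.cableMeasure = G.cableMeasure.real B * A := by
    rw [hA, ← smul_eq_mul, measure_smul_setAverage _ hBfin]
  have hA0 : 0 ≤ A := by
    rw [hA, setAverage_eq]
    exact smul_nonneg (by positivity) (integral_nonneg fun _ => abs_nonneg _)
  have huB := hu.1.integrableOn hBfin
  -- near every parameter in the ball the gradient is a constant that satisfies the bound
  have hloc : ∀ t₀ ∈ Icc (0 : ℝ) 1, e.cable t₀ ∈ Metric.ball x r →
      ∀ᵐ t, t ∈ Ioo (t₀ - r) (t₀ + r) → t ∈ Ioo (0 : ℝ) 1 →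
        |gradient u (e, t)| ≤ 32 * R₀ ^ 2 * K * (1 / r) * A := by
    intro t₀ ht₀ hx
    set a := max 0 (t₀ - r) with ha
    set b := min 1 (t₀ + r) with hb
    have hlen : r / R₀ ≤ b - a := by
      have h1 : r / R₀ ≤ r := div_le_self hr.le hR
      have h2 : r / R₀ ≤ 1 := (div_le_one (by linarith)).2 hr'
      rcases max_cases 0 (t₀ - r) with h3 | h3 <;> rcases min_cases 1 (t₀ + r) with h4 | h4 <;>
        rw [ha, hb, h3.1, h4.1] <;> linarith [ht₀.1, ht₀.2]
    have hab : a < b := by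
      have : 0 < r / R₀ := by positivity
      linarith
    have ha0 : 0 ≤ a := le_max_left _ _
    have hb1 : b ≤ 1 := min_le_left _ _
    have hsub : e.cable '' Icc a b ⊆ B := by
      rintro _ ⟨t, ht, rfl⟩
      have h1 : Dist.dist (e.cable t) (e.cable t₀) ≤ r := by
        rw [e.dist_cable ⟨ha0.trans ht.1, ht.2.trans hb1⟩ ht₀, abs_le]
        constructor
        · linarith [ht.1, le_max_right 0 (t₀ - r)]
        · linarith [ht.2, min_le_right 1 (t₀ + r)]
      have h2 : Dist.dist (e.cable t₀) x < r := hx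
      have h3 := dist_triangle (e.cable t) (e.cable t₀) x
      rw [hB, Metric.mem_ball]
      linarith
    obtain ⟨κ, hκ, hFκ⟩ := hF.exists_slope hu e ha0 hb1 hab
      ((image_mono Ioo_subset_Icc_self).trans hsub)
    have h1 := hF.le_setIntegral Metric.isOpen_ball.measurableSet huB measurableSet_Icc
      (Icc_subset_Icc ha0 hb1) (T := {e}) (by simpa using hsub)
      (J := |κ| * (b - a) ^ 2 / 4)
      (by simpa using le_integral_abs_of_affine hab hFκ)
    rw [hAint, Finset.card_singleton, Nat.cast_one, one_mul] at h1
    have h2 : (r / R₀) ^ 2 ≤ (b - a) ^ 2 := by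
      have : 0 ≤ r / R₀ := by positivity
      gcongr
    have h3 : |κ| ≤ 32 * R₀ ^ 2 * K * (1 / r) * A := by
      have h4 : |κ| * (r / R₀) ^ 2 ≤ 8 * (K * (4 * r) * A) := by
        have h5 := mul_le_mul_of_nonneg_left h2 (abs_nonneg κ)
        have h6 := mul_le_mul_of_nonneg_right hBr hA0
        linarith
      have hR0 : 0 < R₀ := by linarith
      rw [div_pow, mul_div_assoc', div_le_iff₀ (by positivity)] at h4
      have h7 : |κ| * r ^ 2 ≤ 32 * R₀ ^ 2 * K * (1 / r) * A * r ^ 2 := by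
        refine h4.trans (le_of_eq ?_)
        field_simp
        ring
      exact le_of_mul_le_mul_right h7 (by positivity)
    filter_upwards [hκ] with t ht ht1 ht2
    rw [ht ⟨max_lt ht2.1 ht1.1, lt_min ht2.2 ht1.2⟩]
    exact h3
  rw [← restrict_Ioo_eq_restrict_Icc, ae_restrict_iff' measurableSet_Ioo]
  set bad : Set ℝ := {t | ¬ (t ∈ Ioo (0 : ℝ) 1 → e.cable t ∈ Metric.ball x r →
      |gradient u (e, t)| ≤ 32 * R₀ ^ 2 * K * (1 / r) * A)} with hbad
  change volume bad = 0
  refine measure_null_of_locally_null bad fun t₀ ht₀ => ?_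
  have ht₀' : t₀ ∈ Ioo (0 : ℝ) 1 ∧ e.cable t₀ ∈ Metric.ball x r := by
    simp only [hbad, mem_ofPred_eq] at ht₀
    push Not at ht₀
    exact ⟨ht₀.1, ht₀.2.1⟩
  refine ⟨bad ∩ Ioo (t₀ - r) (t₀ + r), inter_mem_nhdsWithin _
    (Ioo_mem_nhds (by linarith) (by linarith)), ?_⟩
  refine measure_mono_null ?_ (hloc t₀ (Ioo_subset_Icc_self ht₀'.1) ht₀'.2)
  rintro t ⟨ht1, ht2⟩ ht3
  exact ht1 fun ht4 _ => ht3 ht2 ht4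

/-- The gradient bound may be checked on every cable. -/
lemma gradientSupNorm_le {u : G.CableSpace → ℝ} {x : G.CableSpace} {r C : ℝ}
    (h : ∀ e : G.Dart, ∀ᵐ t ∂(volume.restrict (Icc (0 : ℝ) 1)), e.cable t ∈ Metric.ball x r →
      |gradient u (e, t)| ≤ C) :
    gradientSupNorm u (Metric.ball x r) ≤ ENNReal.ofReal C := by
  rw [gradientSupNorm, eLpNorm_exponent_top]
  refine eLpNormEssSup_le_of_ae_bound ?_
  rw [ae_restrict_iff' (measurable_cableMap Metric.isOpen_ball.measurableSet)]
  exact ae_dartMeasure_iff.2 h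

end SimpleGraph

/-- `G` is the graph formed by the `0`-cells of `S`, the vertices having integer coordinates `X`. -/
structure CellData.IsCellGraph {d : ℕ} {ι V : Type*} (S : CellData d ι) (G : SimpleGraph V)
    (X : V → Fin d → ℤ) : Prop where
  injective : Function.Injective X
  exists_vertex : ∀ b, S.IsPosition b → ∀ i, ∃ v, X v = b + S.P i
  adj_iff : ∀ v w, G.Adj v w ↔ ∃ b, S.IsPosition b ∧ ∃ i j, S.H.Adj i j ∧
    X v = b + S.P i ∧ X w = b + S.P j

namespace CellData.IsCellGraph

open SimpleGraph

variable {d : ℕ} {ι V : Type*} [Fintype ι] {S : CellData d ι} {G : SimpleGraph V}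
  {X : V → Fin d → ℤ} {ρ : ℝ}

omit [Fintype ι] in
lemma exists_dart (hX : S.IsCellGraph G X) {b : Fin d → ℤ} (hb : S.IsPosition b) {i j : ι}
    (hij : S.H.Adj i j) : ∃ e : G.Dart, X e.fst = b + S.P i ∧ X e.snd = b + S.P j := by
  obtain ⟨v, hv⟩ := hX.exists_vertex b hb i
  obtain ⟨w, hw⟩ := hX.exists_vertex b hb j
  exact ⟨⟨(v, w), (hX.adj_iff v w).2 ⟨b, hb, i, j, hij, hv, hw⟩⟩, hv, hw⟩

omit [Fintype ι] in
lemma dart_ext (hX : S.IsCellGraph G X) {e f : G.Dart} (h1 : X e.fst = X f.fst)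
    (h2 : X e.snd = X f.snd) : e = f :=
  Dart.ext _ _ (Prod.ext (hX.injective h1) (hX.injective h2))

/-! ### Volume growth -/

/-- A ball of radius comparable to `cⁿ` meets a bounded number of `n`-cells: the integer
coordinates, interpolated to the cables, are Lipschitz functions, so that the positions of these
cells lie in a box of bounded size. -/
lemma exists_card_le [Fact G.Connected] (hS : S.IsHarmonicStructure ρ) (hX : S.IsCellGraph G X)
    (R : ℝ) :
    ∃ K : ℕ, ∀ (n : ℕ) (x : G.CableSpace) (s : ℝ), s ≤ R * (S.c : ℝ) ^ n →
      ∃ T : Finset G.Dart, T.card ≤ K * Fintype.card ι ^ n ∧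
        ∀ e : G.Dart, ∀ t ∈ Icc (0 : ℝ) 1, e.cable t ∈ Metric.ball x s → e ∈ T := by
  classical
  obtain ⟨p, hp0, hp⟩ := IsHarmonicStructure.exists_bound S
  set C : ℝ := p * (2 * R + 4) with hC
  have hp0' : (0 : ℝ) ≤ p := by exact_mod_cast hp0
  refine ⟨⌈2 * C + 1⌉₊ ^ d * (Fintype.card ι * Fintype.card ι), fun n x s hs => ?_⟩
  have hc2 : (2 : ℝ) ≤ S.c := by exact_mod_cast hS.two_le
  have hcn : (1 : ℝ) ≤ (S.c : ℝ) ^ n := one_le_pow₀ (by linarith)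
  let y : Fin d → ℝ := fun k =>
    (isProfile_linear (G := G) fun v => (X v k : ℝ)).glue x / (S.c : ℝ) ^ n
  let box : Finset (Fin d → ℤ) := Fintype.piFinset fun k => Finset.Icc ⌈y k - C⌉ ⌊y k + C⌋
  let Q : Finset ((Fin d → ℤ) × (Fin d → ℤ)) :=
    (box.biUnion (S.descendants n) ×ˢ (Finset.univ : Finset (ι × ι))).image
      fun q => (q.1 + S.P q.2.1, q.1 + S.P q.2.2)
  let ψ : G.Dart → (Fin d → ℤ) × (Fin d → ℤ) := fun e => (X e.fst, X e.snd)
  have hψ : Function.Injective ψ := fun e f h =>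
    hX.dart_ext (congrArg Prod.fst h) (congrArg Prod.snd h)
  refine ⟨Q.preimage ψ hψ.injOn, ?_, fun e t ht hx => ?_⟩
  · have hbox : box.card ≤ ⌈2 * C + 1⌉₊ ^ d := by
      rw [Fintype.card_piFinset]
      refine (Finset.prod_le_pow_card _ _ ⌈2 * C + 1⌉₊ fun k _ => ?_).trans (by simp)
      rw [Int.card_Icc, Int.toNat_le]
      have h1 := Int.floor_le (y k + C)
      have h2 := Int.le_ceil (y k - C)
      have h3 := Nat.le_ceil (2 * C + 1)
      have h4 : ((⌊y k + C⌋ + 1 - ⌈y k - C⌉ : ℤ) : ℝ) ≤ ((⌈2 * C + 1⌉₊ : ℤ) : ℝ) := by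
        push_cast
        linarith
      exact_mod_cast h4
    calc (Q.preimage ψ hψ.injOn).card ≤ Q.card := by
          rw [Finset.card_preimage]
          exact Finset.card_filter_le _ _
      _ ≤ (box.biUnion (S.descendants n)).card * (Fintype.card ι * Fintype.card ι) := by
          refine Finset.card_image_le.trans (le_of_eq ?_)
          rw [Finset.card_product, Finset.card_univ, Fintype.card_prod]
      _ ≤ (⌈2 * C + 1⌉₊ ^ d * Fintype.card ι ^ n) * (Fintype.card ι * Fintype.card ι) := by
          refine Nat.mul_le_mul_right _ ?_
          refine (Finset.card_biUnion_le_card_mul _ _ _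
            fun a _ => (hS.card_descendants n a).le).trans ?_
          exact Nat.mul_le_mul_right _ hbox
      _ = _ := by ring
  · rw [Finset.mem_preimage]
    obtain ⟨b, hb, i, j, hij, h1, h2⟩ := (hX.adj_iff _ _).1 e.adj
    obtain ⟨a, ha, hba⟩ := hS.exists_ancestor n hb
    refine Finset.mem_image.2 ⟨(b, i, j), Finset.mem_product.2
      ⟨Finset.mem_biUnion.2 ⟨a, ?_, hba⟩, Finset.mem_univ _⟩, Prod.ext h1.symm h2.symm⟩
    refine Fintype.mem_piFinset.2 fun k => ?_
    have hlip : ∀ f : G.Dart, |(X f.snd k : ℝ) - X f.fst k| ≤ 2 * p := by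
      intro f
      obtain ⟨b', -, i', j', -, h3, h4⟩ := (hX.adj_iff _ _).1 f.adj
      have h5 : X f.snd k - X f.fst k = S.P j' k - S.P i' k := by
        rw [h3, h4]
        simp
      have h6 : |X f.snd k - X f.fst k| ≤ 2 * p := by
        rw [h5]
        refine (abs_sub _ _).trans ?_
        linarith [hp j' k, hp i' k]
      exact_mod_cast h6
    have h3 := abs_linear_sub_le_dist (G := G) (f := fun v => (X v k : ℝ)) (L := 2 * p)
      (by linarith) hlip (e.cable t) x
    have h4 : (isProfile_linear (G := G) fun v => (X v k : ℝ)).glue x = y k * (S.c : ℝ) ^ n := by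
      rw [div_mul_cancel₀]
      positivity
    rw [IsProfile.glue_cable _ e ht, h4] at h3
    have h5 : Dist.dist (e.cable t) x < s := hx
    have h6 : |t * ((X e.snd k : ℝ) - X e.fst k)| ≤ 2 * p := by
      rw [abs_mul, abs_of_nonneg ht.1]
      exact (mul_le_of_le_one_left (abs_nonneg _) ht.2).trans (hlip e)
    have h7 : |(b k : ℝ) - (S.c : ℝ) ^ n * a k| ≤ ((S.c : ℝ) ^ n - 1) * p := by
      exact_mod_cast hS.abs_sub_le_of_mem hp hba k
    have h8 : |(S.P i k : ℝ)| ≤ p := by exact_mod_cast hp i k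
    have h9 : (X e.fst k : ℝ) = b k + S.P i k := by
      rw [h1]
      simp
    have h10 : 2 * p * Dist.dist (e.cable t) x ≤ 2 * p * (R * (S.c : ℝ) ^ n) :=
      mul_le_mul_of_nonneg_left (h5.le.trans hs) (by linarith)
    have h11 : (p : ℝ) ≤ p * (S.c : ℝ) ^ n := le_mul_of_one_le_right hp0' hcn
    rw [abs_le] at h3 h6 h7 h8
    have hcn0 : (0 : ℝ) < (S.c : ℝ) ^ n := by linarith
    have hup : (a k : ℝ) * (S.c : ℝ) ^ n ≤ (y k + C) * (S.c : ℝ) ^ n := by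
      rw [hC]
      linarith [h3.1, h3.2, h6.1, h6.2, h7.1, h7.2, h8.1, h8.2]
    have hlo : (y k - C) * (S.c : ℝ) ^ n ≤ (a k : ℝ) * (S.c : ℝ) ^ n := by
      rw [hC]
      linarith [h3.1, h3.2, h6.1, h6.2, h7.1, h7.2, h8.1, h8.2]
    rw [Finset.mem_Icc, Int.ceil_le, Int.le_floor]
    exact ⟨le_of_mul_le_mul_right hlo hcn0, le_of_mul_le_mul_right hup hcn0⟩

/-! ### Harmonic functions on cells -/

/-- The cables of an `n`-cell are within distance `10 cⁿ` of each other. -/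
lemma dist_cable_le [Fact G.Connected] (hS : S.IsHarmonicStructure ρ) (hX : S.IsCellGraph G X)
    {n : ℕ} {a b b' : Fin d → ℤ} (ha : S.IsPosition a) (hb : b ∈ S.descendants n a)
    (hb' : b' ∈ S.descendants n a) {e f : G.Dart} {i j : ι} (he : X e.fst = b + S.P i)
    (hf : X f.fst = b' + S.P j) {s t : ℝ} (hs : s ∈ Icc (0 : ℝ) 1) (ht : t ∈ Icc (0 : ℝ) 1) :
    Dist.dist (e.cable s) (f.cable t) ≤ 10 * (S.c : ℝ) ^ n := by
  have hc2 : (2 : ℝ) ≤ S.c := by exact_mod_cast hS.two_le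
  have hcn : (1 : ℝ) ≤ (S.c : ℝ) ^ n := one_le_pow₀ (by linarith)
  set δ : (Fin d → ℤ) → ℝ := Function.extend X (fun v => (G.dist e.fst v : ℝ)) 0 with hδ
  have hδX : ∀ v, δ (X v) = G.dist e.fst v := fun v => hX.injective.extend_apply _ _ v
  have hlip : ∀ b, S.IsPosition b → ∀ i j, S.H.Adj i j →
      |δ (b + S.P i) - δ (b + S.P j)| ≤ 1 := by
    intro b hb i j hij
    obtain ⟨g, h1, h2⟩ := hX.exists_dart hb hij
    rw [← h1, ← h2, hδX, hδX]
    have h3 := CableSpace.dist_tri (G := G) e.fst g.fst g.snd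
    have h4 := CableSpace.dist_tri (G := G) e.fst g.snd g.fst
    rw [SimpleGraph.dist_comm (u := g.snd)] at h4
    rw [CableSpace.dist_fst_snd] at h3 h4
    push_cast at h3 h4
    rw [abs_le]
    constructor <;> linarith
  have h1 := hS.abs_sub_corner_le_four hlip n ha hb i i
  have h2 := hS.abs_sub_corner_le_four hlip n ha hb' j i
  rw [← he, hδX, SimpleGraph.dist_self] at h1
  rw [← hf, hδX] at h2
  rw [abs_le] at h1 h2
  push_cast at h1
  have h3 := e.dist_cable_le f hs ht
  linarith [h1.1, h2.2]

/-- The values at the vertices of a harmonic function form a harmonic function on every cell that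
is contained in the domain. -/
lemma isHarmonicCell [Countable V] [Fact G.Connected] (hS : S.IsHarmonicStructure ρ)
    (hX : S.IsCellGraph G X) {u F : G.CableSpace → ℝ} (hF : IsRep u F) {D : Set G.CableSpace}
    (hu : IsHarmonicIn u D) {h : (Fin d → ℤ) → ℝ}
    (hh : ∀ e : G.Dart, h (X e.fst) = F (e.cable 0) ∧ h (X e.snd) = F (e.cable 1))
    {n : ℕ} {a : Fin d → ℤ} (ha : S.IsPosition a)
    (hD : ∀ b ∈ S.descendants n a, ∀ i, ∀ e : G.Dart, X e.fst = b + S.P i →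
      e.cable '' Icc 0 1 ⊆ D) : S.IsHarmonicCell h n a := by
  classical
  intro v hv
  by_contra hne
  obtain ⟨b₀, hb₀, i₀, rfl⟩ := IsHarmonicStructure.exists_of_lap_ne_zero hne
  refine hne ?_
  have hpos : ∀ b ∈ S.descendants n a, S.IsPosition b := fun b hb =>
    IsHarmonicStructure.isPosition_of_mem ha hb
  obtain ⟨w, hw⟩ := hX.exists_vertex b₀ (hpos b₀ hb₀) i₀
  -- the pairs of a `0`-cell and an oriented edge of it that starts at the given vertex
  let Ω : Finset ((Fin d → ℤ) × ι × ι) :=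
    (S.descendants n a ×ˢ (Finset.univ : Finset (ι × ι))).filter
      fun q => q.1 + S.P q.2.1 = b₀ + S.P i₀ ∧ S.H.Adj q.2.1 q.2.2
  have hΩ : ∀ q : (Fin d → ℤ) × ι × ι, q ∈ Ω ↔ q.1 ∈ S.descendants n a ∧
      q.1 + S.P q.2.1 = b₀ + S.P i₀ ∧ S.H.Adj q.2.1 q.2.2 := by
    intro q
    simp [Ω]
  have hdart : ∀ q : Ω, ∃ e : G.Dart, X e.fst = q.1.1 + S.P q.1.2.1 ∧
      X e.snd = q.1.1 + S.P q.1.2.2 := fun q =>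
    hX.exists_dart (hpos _ ((hΩ q).1 q.2).1) ((hΩ q).1 q.2).2.2
  choose g hg1 hg2 using hdart
  have hinj : Function.Injective g := by
    intro q q' hqq
    have hq := (hΩ q).1 q.2
    have hq' := (hΩ q').1 q'.2
    have h1 : q.1.1 + S.P q.1.2.1 = q'.1.1 + S.P q'.1.2.1 := by rw [← hg1, ← hg1, hqq]
    have h2 : q.1.1 + S.P q.1.2.2 = q'.1.1 + S.P q'.1.2.2 := by rw [← hg2, ← hg2, hqq]
    have h3 := hS.edge_unique _ _ (hpos _ hq.1) (hpos _ hq'.1) _ _ _ _ hq.2.2 hq'.2.2 h1 h2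
    rw [h3] at h1 h2
    exact Subtype.ext (Prod.ext h3 (Prod.ext (hS.P_injective (add_left_cancel h1))
      (hS.P_injective (add_left_cancel h2))))
  have hA : ∀ e, e ∈ Ω.attach.image g ↔ e.fst = w := by
    intro e
    constructor
    · intro he
      obtain ⟨q, -, rfl⟩ := Finset.mem_image.1 he
      exact hX.injective ((hg1 q).trans ((((hΩ q).1 q.2).2.1).trans hw.symm))
    · intro he
      obtain ⟨b, hb, i, j, hij, h1, h2⟩ := (hX.adj_iff _ _).1 e.adj
      obtain ⟨a', ha', hba'⟩ := hS.exists_ancestor n hb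
      have h3 : b₀ + S.P i₀ = b + S.P i := by rw [← hw, ← h1, he]
      have haa : a = a' := by
        by_contra hne'
        obtain ⟨k, hk⟩ := hS.sep n a a' ha ha' hne' b₀ hb₀ b hba' i₀ i h3
        exact hv k hk
      subst haa
      have hq : (b, i, j) ∈ Ω := (hΩ _).2 ⟨hba', h3.symm, hij⟩
      refine Finset.mem_image.2 ⟨⟨_, hq⟩, Finset.mem_attach _ _, ?_⟩
      exact hX.dart_ext ((hg1 ⟨_, hq⟩).trans h1.symm) ((hg2 ⟨_, hq⟩).trans h2.symm)
  have hsum := hF.sum_increments_eq_zero hu hA fun e he => ?_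
  · rw [Finset.sum_image hinj.injOn] at hsum
    have h1 : ∀ q ∈ Ω.attach, F ((g q).cable 1) - F ((g q).cable 0) =
        h (q.1.1 + S.P q.1.2.2) - h (q.1.1 + S.P q.1.2.1) := by
      intro q _
      rw [← (hh (g q)).1, ← (hh (g q)).2, hg1, hg2]
    rw [Finset.sum_congr rfl h1,
      Finset.sum_attach Ω fun q => h (q.1 + S.P q.2.2) - h (q.1 + S.P q.2.1),
      Finset.sum_filter, Finset.sum_product] at hsum
    rw [← hsum, lap]
    refine Finset.sum_congr rfl fun b _ => ?_
    rw [← Finset.univ_product_univ, Finset.sum_product]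
    refine Finset.sum_congr rfl fun i _ => ?_
    by_cases hbi : b + S.P i = b₀ + S.P i₀
    · rw [if_pos hbi, cellLap]
      refine Finset.sum_congr rfl fun j _ => ?_
      simp only [hbi, true_and]
    · simp [hbi]
  · refine hD b₀ hb₀ i₀ e ?_
    rw [← hw, (hA e).1 he]

/-- In balls of radius comparable to `cᴺ` the gradient of a harmonic function is at most a multiple
of `ρᴺ` times the mean of its absolute value, where `N = n + m` and the values are large on a cell
of level `n`. -/
lemma abs_gradient_le_of_ge [Countable V] [Fact G.Connected] (hS : S.IsHarmonicStructure ρ)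
    (hX : S.IsCellGraph G X) {m : ℕ} (hm : 8 * ρ ^ m ≤ 1 - ρ) {K n : ℕ} {x : G.CableSpace} {r : ℝ}
    (hr : 16 * (S.c : ℝ) ^ (n + m) ≤ r) {T : Finset G.Dart}
    (hTK : T.card ≤ K * Fintype.card ι ^ (n + m))
    (hT : ∀ e : G.Dart, ∀ t ∈ Icc (0 : ℝ) 1, e.cable t ∈ Metric.ball x (2 * r) → e ∈ T)
    {u : G.CableSpace → ℝ} (hu : IsHarmonicIn u (Metric.ball x (2 * r))) (e : G.Dart) :
    ∀ᵐ t ∂(volume.restrict (Icc (0 : ℝ) 1)), e.cable t ∈ Metric.ball x r →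
      |gradient u (e, t)| ≤ ρ ^ (n + m) * (8 * Fintype.card ι ^ m * K) *
        ⨍ y in Metric.ball x (2 * r), |u y| ∂G.cableMeasure := by
  classical
  by_cases hne : ∃ t ∈ Icc (0 : ℝ) 1, e.cable t ∈ Metric.ball x r
  swap
  · refine (ae_restrict_iff' measurableSet_Icc).2 (ae_of_all _ fun t ht htx => ?_)
    exact absurd ⟨t, ht, htx⟩ hne
  obtain ⟨t₀, ht₀, htx⟩ := hne
  have hc2 : (2 : ℝ) ≤ S.c := by exact_mod_cast hS.two_le
  have hcn : (1 : ℝ) ≤ (S.c : ℝ) ^ (n + m) := one_le_pow₀ (by linarith)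
  obtain ⟨F, hF⟩ := hu.1.exists_isRep
  set D := Metric.ball x (2 * r) with hDdef
  have hDm : G.cableMeasure D ≤ ENNReal.ofReal (T.card * min 1 (2 * (2 * r))) :=
    cableMeasure_ball_le hT
  have hDfin : G.cableMeasure D ≠ ∞ := (hDm.trans_lt ENNReal.ofReal_lt_top).ne
  have hDr : G.cableMeasure.real D ≤ K * Fintype.card ι ^ (n + m) := by
    have h0 : 0 ≤ min 1 (2 * (2 * r)) := le_min zero_le_one (by linarith)
    refine (ENNReal.toReal_le_of_le_ofReal (by positivity) hDm).trans ?_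
    have h1 : (T.card : ℝ) ≤ K * Fintype.card ι ^ (n + m) := by exact_mod_cast hTK
    exact (mul_le_of_le_one_right (by positivity) (min_le_left _ _)).trans h1
  set A := ⨍ y in D, |u y| ∂G.cableMeasure with hA
  have hAint : ∫ y in D, |u y| ∂G.cableMeasure = G.cableMeasure.real D * A := by
    rw [hA, ← smul_eq_mul, measure_smul_setAverage _ hDfin]
  have hA0 : 0 ≤ A := by
    rw [hA, setAverage_eq]
    exact smul_nonneg (by positivity) (integral_nonneg fun _ => abs_nonneg _)
  -- the values at the vertices
  obtain ⟨h, hh⟩ : ∃ h : (Fin d → ℤ) → ℝ, ∀ e : G.Dart, h (X e.fst) = F (e.cable 0) ∧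
      h (X e.snd) = F (e.cable 1) := by
    have hval : ∀ v : V, ∃ y, ∀ e : G.Dart, e.fst = v → F (e.cable 0) = y := by
      intro v
      by_cases hv : ∃ e : G.Dart, e.fst = v
      · obtain ⟨e, rfl⟩ := hv
        exact ⟨F (e.cable 0), fun e' he' => by rw [Dart.cable_zero_eq he']⟩
      · exact ⟨0, fun e he => absurd ⟨e, he⟩ hv⟩
    choose k hk using hval
    refine ⟨Function.extend X k 0, fun e => ⟨?_, ?_⟩⟩
    · rw [hX.injective.extend_apply, hk _ e rfl]
    · rw [hX.injective.extend_apply, ← hk e.snd e.symm rfl,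
        ← e.symm_cable (by simp : (1 : ℝ) ∈ Icc (0 : ℝ) 1), sub_self]
  -- the cell that contains the cable `e`
  obtain ⟨b₁, hb₁, i, j, hij, h1, h2⟩ := (hX.adj_iff _ _).1 e.adj
  obtain ⟨a, ha, hba⟩ := hS.exists_ancestor (n + m) hb₁
  have hD : ∀ b ∈ S.descendants (n + m) a, ∀ i, ∀ e' : G.Dart, X e'.fst = b + S.P i →
      e'.cable '' Icc 0 1 ⊆ D := by
    rintro b hb i' e' he' _ ⟨t, ht, rfl⟩
    have h3 := hX.dist_cable_le hS ha hb hba he' h1 ht ht₀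
    have h4 : Dist.dist (e.cable t₀) x < r := htx
    have h5 := dist_triangle (e'.cable t) (e.cable t₀) x
    rw [hDdef, Metric.mem_ball]
    linarith
  have hcell := hX.isHarmonicCell hS hF hu hh ha hD
  have haffine : ∀ b ∈ S.descendants (n + m) a, ∀ i, ∀ e' : G.Dart, X e'.fst = b + S.P i →
      (∀ᵐ t, t ∈ Ioo (0 : ℝ) 1 → gradient u (e', t) = h (X e'.snd) - h (X e'.fst)) ∧
      ∀ t ∈ Icc (0 : ℝ) 1, F (e'.cable t) = h (X e'.fst) + t * (h (X e'.snd) - h (X e'.fst)) := by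
    intro b hb i' e' he'
    obtain ⟨κ, hκ, hFκ⟩ := hF.exists_slope hu e' le_rfl le_rfl zero_lt_one
      ((image_mono Ioo_subset_Icc_self).trans (hD b hb i' e' he'))
    have h3 := hFκ 0 (by simp) 1 (by simp)
    rw [← (hh e').1, ← (hh e').2, sub_zero, mul_one] at h3
    rw [h3]
    refine ⟨hκ, fun t ht => ?_⟩
    have h4 := hFκ 0 (by simp) t ht
    rw [← (hh e').1] at h4
    linarith
  obtain ⟨M, y, hy, hM, a', ha', hval⟩ := hS.exists_large_cell hm n ha hcell
  -- a lower bound for the integral from the cell where the values are large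
  obtain ⟨i₀, j₀, hij₀⟩ := hS.exists_adj
  have hpos : ∀ b ∈ S.descendants n a', S.IsPosition b := fun b hb =>
    IsHarmonicStructure.isPosition_of_mem ha (ha' hb)
  have hdart : ∀ b : S.descendants n a', ∃ e : G.Dart, X e.fst = b.1 + S.P i₀ ∧
      X e.snd = b.1 + S.P j₀ := fun b => hX.exists_dart (hpos b.1 b.2) hij₀
  choose g hg1 hg2 using hdart
  have hginj : Function.Injective g := fun b b' hbb =>
    Subtype.ext (add_right_cancel ((hg1 b).symm.trans ((congrArg (fun f => X f.fst) hbb).trans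
      (hg1 b'))))
  have hM0 : 0 ≤ M := (abs_nonneg _).trans (hM i₀ j₀ hij₀)
  have hlow := hF.le_setIntegral (B := D) Metric.isOpen_ball.measurableSet
    (hu.1.integrableOn hDfin) (A := Icc 0 1) measurableSet_Icc subset_rfl
    (T := (S.descendants n a').attach.image g) (J := M / 4) ?_ ?_
  · rw [Finset.card_image_of_injective _ hginj, Finset.card_attach, hS.card_descendants, hAint]
      at hlow
    have hι : (0 : ℝ) < Fintype.card ι := by
      have : 0 < Fintype.card ι := Fintype.card_pos_iff.2 ⟨i₀⟩
      exact_mod_cast this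
    have hMA : M ≤ 8 * Fintype.card ι ^ m * K * A := by
      have h3 := mul_le_mul_of_nonneg_right hDr hA0
      rw [pow_add] at h3
      have h4 : (0 : ℝ) < (Fintype.card ι : ℝ) ^ n := by positivity
      push_cast at hlow
      have h5 : (Fintype.card ι : ℝ) ^ n * M ≤
          (Fintype.card ι : ℝ) ^ n * (8 * Fintype.card ι ^ m * K * A) := by
        linarith
      exact le_of_mul_le_mul_left h5 h4
    have hedge := hS.abs_edge_le ha hcell hM hba hij
    rw [← h1, ← h2, abs_sub_comm] at hedge
    rw [← restrict_Ioo_eq_restrict_Icc]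
    refine (ae_restrict_iff' measurableSet_Ioo).2 ?_
    filter_upwards [(haffine b₁ hba i e h1).1] with t ht ht' _
    rw [ht ht', mul_assoc]
    exact hedge.trans (mul_le_mul_of_nonneg_left hMA (pow_pos hS.rho_pos _).le)
  · intro f hf
    obtain ⟨b, -, rfl⟩ := Finset.mem_image.1 hf
    exact hD b.1 (ha' b.2) i₀ _ (hg1 b)
  · intro f hf
    obtain ⟨b, -, rfl⟩ := Finset.mem_image.1 hf
    have haff := (haffine b.1 (ha' b.2) i₀ _ (hg1 b)).2
    have h3 : ∀ t ∈ Icc (0 : ℝ) 1, M / 4 ≤ |F ((g b).cable t)| := by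
      intro t ht
      rw [haff t ht, hg1, hg2]
      have h4 := hval b.1 b.2 i₀
      have h5 := hval b.1 b.2 j₀
      set α := h (b.1 + S.P i₀)
      set β := h (b.1 + S.P j₀)
      have h6 : |α + t * (β - α) - y| ≤ M / 4 := by
        rw [show α + t * (β - α) - y = (1 - t) * (α - y) + t * (β - y) by ring]
        refine (abs_add_le _ _).trans ?_
        rw [abs_mul, abs_mul, abs_of_nonneg ht.1, abs_of_nonneg (by linarith [ht.2] : 0 ≤ 1 - t)]
        nlinarith [ht.1, ht.2]
      have h7 := abs_sub_abs_le_abs_sub y (α + t * (β - α))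
      rw [abs_sub_comm] at h7
      linarith
    have hcont : ContinuousOn (fun t => |F ((g b).cable t)|) (Icc 0 1) := by
      refine ContinuousOn.abs (ContinuousOn.congr (f := fun t => h (X (g b).fst) +
        t * (h (X (g b).snd) - h (X (g b).fst))) (by fun_prop) haff)
    have h8 : ∫ _ in Icc (0 : ℝ) 1, M / 4 = M / 4 := by simp
    rw [← h8]
    exact setIntegral_mono_on (by simp) (hcont.integrableOn_compact isCompact_Icc)
      measurableSet_Icc h3

/-- The generalized reverse Hölder inequality for the graphs of a harmonic structure, the exponents
being such that `c ^ (α - β) = ρ`. -/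
theorem generalizedReverseHolder [Fact G.Connected] (hS : S.IsHarmonicStructure ρ)
    (hX : S.IsCellGraph G X) {α β : ℝ} (hαβ : (S.c : ℝ) ^ (α - β) = ρ) :
    G.GeneralizedReverseHolder (scalePhi α) (scalePsi β) := by
  have : Countable V := hX.injective.countable
  have hc2 : (2 : ℝ) ≤ S.c := by exact_mod_cast hS.two_le
  have hc0 : (0 : ℝ) < S.c := by linarith
  obtain ⟨m, hm⟩ : ∃ m : ℕ, 8 * ρ ^ m ≤ 1 - ρ := by
    have h1 : 0 < (1 - ρ) / 8 := by linarith [hS.rho_lt]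
    obtain ⟨m, hm⟩ := exists_pow_lt_of_lt_one h1 hS.rho_lt
    exact ⟨m, by linarith⟩
  have hneg : α - β < 0 := by
    by_contra hcon
    have := Real.one_le_rpow (by linarith : (1 : ℝ) ≤ S.c) (not_lt.1 hcon)
    rw [hαβ] at this
    linarith [hS.rho_lt]
  set R₀ : ℝ := 16 * (S.c : ℝ) ^ m with hR₀
  have hR16 : 16 ≤ R₀ := by
    have : (1 : ℝ) ≤ (S.c : ℝ) ^ m := one_le_pow₀ (by linarith)
    linarith
  have hR1 : 1 ≤ R₀ := by linarith
  obtain ⟨K₁, hK₁⟩ := hX.exists_card_le hS (2 * R₀)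
  obtain ⟨K₂, hK₂⟩ := hX.exists_card_le hS (32 * S.c)
  have hlarge : ∀ r : ℝ, 1 ≤ r → scalePhi α r / scalePsi β r = r ^ (α - β) := by
    intro r hr
    rw [scalePhi, scalePsi, if_neg (not_lt.2 hr), if_neg (not_lt.2 hr),
      Real.rpow_sub (by linarith)]
  set C₁ : ℝ := 32 * R₀ ^ 2 * (K₁ : ℕ) * R₀ ^ (β - α) with hC₁
  set C₂ : ℝ := 8 * (Fintype.card ι : ℝ) ^ m * K₂ * (16 * S.c) ^ (β - α) with hC₂
  have hC₁0 : 0 ≤ C₁ := by positivity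
  have hC₂0 : 0 ≤ C₂ := by positivity
  refine ⟨C₁ + C₂ + 1, by linarith, fun x r hr u hu => gradientSupNorm_le fun e => ?_⟩
  have hA0 : 0 ≤ ⨍ y in Metric.ball x (2 * r), |u y| ∂G.cableMeasure := by
    rw [setAverage_eq]
    exact smul_nonneg (by positivity) (integral_nonneg fun _ => abs_nonneg _)
  set A := ⨍ y in Metric.ball x (2 * r), |u y| ∂G.cableMeasure with hA
  have hΦ0 : 0 ≤ scalePhi α r / scalePsi β r := by
    rw [scalePhi, scalePsi]
    split_ifs <;> positivity
  rcases le_or_gt r R₀ with hrR | hrR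
  · obtain ⟨T, hTK, hT⟩ := hK₁ 0 x (2 * r) (by simpa using hrR)
    rw [pow_zero, mul_one] at hTK
    filter_upwards [abs_gradient_le_of_le hR1 hr hrR hTK hT hu e] with t ht htx
    refine (ht htx).trans (mul_le_mul_of_nonneg_right ?_ hA0)
    have h1 : 1 / r ≤ R₀ ^ (β - α) * (scalePhi α r / scalePsi β r) := by
      rcases lt_or_ge r 1 with h | h
      · rw [scalePhi, scalePsi, if_pos h, if_pos h, pow_two, div_mul_cancel_left₀ hr.ne', ← one_div]
        exact le_mul_of_one_le_left (by positivity)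
          (Real.one_le_rpow hR1 (by linarith))
      · rw [hlarge r h]
        have h2 : R₀ ^ (α - β) ≤ r ^ (α - β) :=
          Real.rpow_le_rpow_of_nonpos hr hrR hneg.le
        have h3 : R₀ ^ (β - α) * R₀ ^ (α - β) = 1 := by
          rw [← Real.rpow_add (by linarith)]
          simp
        calc 1 / r ≤ 1 := (div_le_one hr).2 h
          _ = R₀ ^ (β - α) * R₀ ^ (α - β) := h3.symm
          _ ≤ _ := mul_le_mul_of_nonneg_left h2 (by positivity)
    calc 32 * R₀ ^ 2 * (K₁ : ℝ) * (1 / r) ≤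
        32 * R₀ ^ 2 * (K₁ : ℝ) * (R₀ ^ (β - α) * (scalePhi α r / scalePsi β r)) :=
          mul_le_mul_of_nonneg_left h1 (by positivity)
      _ = C₁ * (scalePhi α r / scalePsi β r) := by
          rw [hC₁]
          ring
      _ ≤ _ := mul_le_mul_of_nonneg_right (by linarith) hΦ0
  · -- the level of the cells is determined by `16 cᴺ ≤ r < 16 cᴺ⁺¹`
    obtain ⟨N, hN1, hN2⟩ := exists_nat_pow_near (x := r / 16) (y := (S.c : ℝ))
      (by linarith) (by linarith)
    have hmN : m ≤ N := by
      by_contra hcon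
      have h1 : (S.c : ℝ) ^ (N + 1) ≤ (S.c : ℝ) ^ m := pow_le_pow_right₀ (by linarith) (by omega)
      linarith
    obtain ⟨n, rfl⟩ := Nat.exists_eq_add_of_le' hmN
    obtain ⟨T, hTK, hT⟩ := hK₂ (n + m) x (2 * r) (by
      rw [pow_succ] at hN2
      linarith)
    filter_upwards [hX.abs_gradient_le_of_ge hS hm (by linarith) hTK hT hu e] with t ht htx
    refine (ht htx).trans (mul_le_mul_of_nonneg_right ?_ hA0)
    rw [hlarge r (by linarith)]
    have h1 : ρ ^ (n + m) ≤ (16 * S.c) ^ (β - α) * r ^ (α - β) := by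
      have h2 : r ≤ (16 * S.c) * (S.c : ℝ) ^ (n + m) := by
        rw [pow_succ] at hN2
        linarith
      have h3 := Real.rpow_le_rpow_of_nonpos hr h2 hneg.le
      rw [Real.mul_rpow (by positivity) (by positivity)] at h3
      have h4 : ((S.c : ℝ) ^ (n + m)) ^ (α - β) = ρ ^ (n + m) := by
        rw [← hαβ, ← Real.rpow_natCast, ← Real.rpow_natCast, ← Real.rpow_mul hc0.le,
          ← Real.rpow_mul hc0.le, mul_comm]
      rw [h4] at h3
      have h5 : (16 * (S.c : ℝ)) ^ (β - α) * (16 * (S.c : ℝ)) ^ (α - β) = 1 := by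
        rw [← Real.rpow_add (by positivity)]
        simp
      calc ρ ^ (n + m) = (16 * (S.c : ℝ)) ^ (β - α) *
            ((16 * (S.c : ℝ)) ^ (α - β) * ρ ^ (n + m)) := by rw [← mul_assoc, h5, one_mul]
        _ ≤ _ := mul_le_mul_of_nonneg_left h3 (by positivity)
    calc ρ ^ (n + m) * (8 * (Fintype.card ι : ℝ) ^ m * K₂) ≤
        (16 * S.c) ^ (β - α) * r ^ (α - β) * (8 * (Fintype.card ι : ℝ) ^ m * K₂) :=
          mul_le_mul_of_nonneg_right h1 (by positivity)
      _ = C₂ * r ^ (α - β) := by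
          rw [hC₂]
          ring
      _ ≤ _ := mul_le_mul_of_nonneg_right (by linarith) (by positivity)

end CellData.IsCellGraph

namespace CellData

variable {d : ℕ} {ι : Type*} [Fintype ι] {S : CellData d ι}

/-! ### Blow-up graphs as graphs of cells -/

lemma add_mem_descendants {n : ℕ} {a b : Fin d → ℤ} (v : Fin d → ℤ) (hb : b ∈ S.descendants n a) :
    b + (S.c : ℤ) ^ n • v ∈ S.descendants n (a + v) := by
  induction n generalizing a v with
  | zero => simpa [descendants] using hb
  | succ n ih =>
    obtain ⟨i, hi⟩ := S.mem_descendants_succ.1 hb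
    refine S.mem_descendants_succ.2 ⟨i, ?_⟩
    have h := ih ((S.c : ℤ) • v) hi
    rw [smul_smul, ← pow_succ] at h
    convert h using 2
    simp only [child, smul_add]
    abel

lemma child_mem_descendants {n : ℕ} {a b : Fin d → ℤ} (hb : b ∈ S.descendants n a) (i : ι) :
    S.child b i ∈ S.descendants (n + 1) a := by
  induction n generalizing a with
  | zero =>
    rw [Finset.mem_singleton.1 hb]
    exact S.mem_descendants_succ.2 ⟨i, Finset.mem_singleton_self _⟩
  | succ n ih =>
    obtain ⟨k, hk⟩ := S.mem_descendants_succ.1 hb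
    exact S.mem_descendants_succ.2 ⟨k, ih hk⟩

lemma IsPosition.exists_mem_descendants {b : Fin d → ℤ} (hb : S.IsPosition b) :
    ∃ n, b ∈ S.descendants n 0 := by
  induction hb with
  | zero => exact ⟨0, Finset.mem_singleton_self _⟩
  | child a i _ ih =>
    obtain ⟨n, hn⟩ := ih
    exact ⟨n + 1, child_mem_descendants hn i⟩

/-- The `n`-cell at a child of `0` is a translate of the `n`-cell at `0`. This matches the recursion
of the blow-up, in which the contractions act on the whole graph of the previous step. -/
lemma mem_descendants_zero_succ {n : ℕ} {b : Fin d → ℤ} :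
    b ∈ S.descendants (n + 1) 0 ↔
      ∃ i, ∃ b' ∈ S.descendants n 0, b = b' + (S.c : ℤ) ^ n • (((S.c : ℤ) - 1) • S.P i) := by
  have hchild : ∀ i, S.child 0 i = ((S.c : ℤ) - 1) • S.P i := fun i => by simp [child]
  rw [mem_descendants_succ]
  refine exists_congr fun i => ⟨fun h => ?_, ?_⟩
  · refine ⟨b + (S.c : ℤ) ^ n • (-S.child 0 i), ?_, ?_⟩
    · simpa using add_mem_descendants (-S.child 0 i) h
    · rw [hchild, smul_neg, neg_add_cancel_right]
  · rintro ⟨b', hb', rfl⟩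
    have := add_mem_descendants (S.child 0 i) hb'
    rw [zero_add] at this
    rwa [← hchild i]

section BlowUp

variable {c : ℝ} {f : ι → (Fin d → ℝ) → Fin d → ℝ} {p : ι → Fin d → ℝ}
  {E : Set ((Fin d → ℝ) × (Fin d → ℝ))} {J : (Fin d → ℤ) →+ (Fin d → ℝ)}

omit [Fintype ι] in
lemma blowUp_map_eq (hc : c = S.c) (hf : ∀ i x, c • f i x = x + (c - 1) • p i)
    (hJ : ∀ i, J (S.P i) = p i) {n : ℕ} {x : Fin d → ℝ} {z : Fin d → ℤ} (i : ι)
    (hx : c ^ n • x = J z) :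
    c ^ (n + 1) • f i x = J (z + (S.c : ℤ) ^ n • (((S.c : ℤ) - 1) • S.P i)) := by
  rw [pow_succ, mul_smul, hf, smul_add, hx, map_add, map_zsmul, map_zsmul, hJ]
  congr 1
  ext k
  simp [hc]

lemma mem_ifsIter_iff (hc : c = S.c) (hc0 : c ≠ 0)
    (hf : ∀ i x, c • f i x = x + (c - 1) • p i) (hJ : ∀ i, J (S.P i) = p i) (n : ℕ)
    (x : Fin d → ℝ) : x ∈ ifsIter f (range p) n ↔
      ∃ b ∈ S.descendants n 0, ∃ i, c ^ n • x = J (b + S.P i) := by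
  induction n generalizing x with
  | zero => simp [ifsIter, descendants, hJ, eq_comm]
  | succ n ih =>
    simp only [ifsIter, mem_iUnion, mem_image, ih]
    constructor
    · rintro ⟨i, x, ⟨b, hb, j, hx⟩, rfl⟩
      refine ⟨_, mem_descendants_zero_succ.2 ⟨i, b, hb, rfl⟩, j, ?_⟩
      rw [blowUp_map_eq hc hf hJ i hx]
      congr 1
      abel
    · rintro ⟨b, hb, j, hx⟩
      obtain ⟨i, b', hb', rfl⟩ := mem_descendants_zero_succ.1 hb
      have hy : c ^ n • ((c ^ n)⁻¹ • J (b' + S.P j)) = J (b' + S.P j) :=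
        smul_inv_smul₀ (pow_ne_zero n hc0) _
      refine ⟨i, _, ⟨b', hb', j, hy⟩, ?_⟩
      refine smul_right_injective _ (pow_ne_zero (n + 1) hc0) ?_
      dsimp only
      rw [blowUp_map_eq hc hf hJ i hy, hx]
      congr 1
      abel

lemma mem_ifsIter_prod_iff (hc : c = S.c) (hc0 : c ≠ 0)
    (hf : ∀ i x, c • f i x = x + (c - 1) • p i) (hJ : ∀ i, J (S.P i) = p i)
    (hE : ∀ e ∈ E, ∃ i j, e = (p i, p j)) (n : ℕ)
    (e : (Fin d → ℝ) × (Fin d → ℝ)) : e ∈ ifsIter (fun i => Prod.map (f i) (f i)) E n ↔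
      ∃ b ∈ S.descendants n 0, ∃ i j, (p i, p j) ∈ E ∧ c ^ n • e.1 = J (b + S.P i) ∧
        c ^ n • e.2 = J (b + S.P j) := by
  induction n generalizing e with
  | zero =>
    simp only [ifsIter, descendants, Finset.mem_singleton, pow_zero, one_smul, exists_eq_left,
      zero_add, hJ]
    constructor
    · intro he
      obtain ⟨i, j, rfl⟩ := hE e he
      exact ⟨i, j, he, rfl, rfl⟩
    · rintro ⟨i, j, he, h1, h2⟩
      rwa [show e = (p i, p j) from Prod.ext h1 h2]
  | succ n ih =>
    simp only [ifsIter, mem_iUnion, mem_image, ih]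
    constructor
    · rintro ⟨i, e, ⟨b, hb, j, k, hjk, h1, h2⟩, rfl⟩
      refine ⟨_, mem_descendants_zero_succ.2 ⟨i, b, hb, rfl⟩, j, k, hjk, ?_, ?_⟩
      · rw [Prod.map_fst, blowUp_map_eq hc hf hJ i h1]
        congr 1
        abel
      · rw [Prod.map_snd, blowUp_map_eq hc hf hJ i h2]
        congr 1
        abel
    · rintro ⟨b, hb, j, k, hjk, h1, h2⟩
      obtain ⟨i, b', hb', rfl⟩ := mem_descendants_zero_succ.1 hb
      have hy : ∀ j, c ^ n • ((c ^ n)⁻¹ • J (b' + S.P j)) = J (b' + S.P j) := fun j =>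
        smul_inv_smul₀ (pow_ne_zero n hc0) _
      refine ⟨i, (_, _), ⟨b', hb', j, k, hjk, hy j, hy k⟩, ?_⟩
      refine Prod.ext ?_ ?_ <;> refine smul_right_injective _ (pow_ne_zero (n + 1) hc0) ?_ <;>
        dsimp only [Prod.map]
      · rw [blowUp_map_eq hc hf hJ i (hy j), h1]
        congr 1
        abel
      · rw [blowUp_map_eq hc hf hJ i (hy k), h2]
        congr 1
        abel

/-- A blow-up graph is the graph formed by the `0`-cells, `J` being the passage from integer
coordinates to the coordinates in which the contractions are given. -/
theorem exists_isCellGraph (hc : c = S.c) (hc0 : c ≠ 0) (hJinj : Function.Injective J)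
    (hP : Function.Injective S.P)
    (hf : ∀ i x, c • f i x = x + (c - 1) • p i) (hJ : ∀ i, J (S.P i) = p i)
    (hE : ∀ e ∈ E, ∃ i j, e = (p i, p j))
    (hH : ∀ i j, S.H.Adj i j ↔ i ≠ j ∧ ((p i, p j) ∈ E ∨ (p j, p i) ∈ E)) :
    ∃ X, S.IsCellGraph (blowUpGraph c f (range p) E) X := by
  have hpos : ∀ n, ∀ b ∈ S.descendants n 0, S.IsPosition b := fun n b hb =>
    IsHarmonicStructure.isPosition_of_mem .zero hb
  have hX : ∀ v : blowUpVertices c f (range p), ∃ z, J z = v := by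
    rintro ⟨v, hv⟩
    obtain ⟨n, x, hx, rfl⟩ := mem_iUnion.1 hv
    obtain ⟨b, -, i, h⟩ := (mem_ifsIter_iff hc hc0 hf hJ n x).1 hx
    exact ⟨_, h.symm⟩
  choose X hX using hX
  have hrel : ∀ v w : blowUpVertices c f (range p),
      (∃ n, ∃ e ∈ ifsIter (fun i => Prod.map (f i) (f i)) E n,
        (v : Fin d → ℝ) = c ^ n • e.1 ∧ (w : Fin d → ℝ) = c ^ n • e.2) ↔
      ∃ b, S.IsPosition b ∧ ∃ i j, (p i, p j) ∈ E ∧ X v = b + S.P i ∧ X w = b + S.P j := by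
    intro v w
    constructor
    · rintro ⟨n, e, he, h1, h2⟩
      obtain ⟨b, hb, i, j, hij, h3, h4⟩ := (mem_ifsIter_prod_iff hc hc0 hf hJ hE n e).1 he
      exact ⟨b, hpos n b hb, i, j, hij, hJinj (by rw [hX, h1, h3]), hJinj (by rw [hX, h2, h4])⟩
    · rintro ⟨b, hb, i, j, hij, h1, h2⟩
      obtain ⟨n, hn⟩ := hb.exists_mem_descendants
      have hy : ∀ j, c ^ n • ((c ^ n)⁻¹ • J (b + S.P j)) = J (b + S.P j) := fun j =>
        smul_inv_smul₀ (pow_ne_zero n hc0) _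
      refine ⟨n, (_, _), (mem_ifsIter_prod_iff hc hc0 hf hJ hE n _).2
        ⟨b, hn, i, j, hij, hy i, hy j⟩, ?_, ?_⟩
      · rw [hy, ← h1, hX]
      · rw [hy, ← h2, hX]
  refine ⟨X, fun v w h => Subtype.ext (by rw [← hX, ← hX, h]), fun b hb i => ?_, fun v w => ?_⟩
  · obtain ⟨n, hn⟩ := hb.exists_mem_descendants
    have hy : c ^ n • ((c ^ n)⁻¹ • J (b + S.P i)) = J (b + S.P i) :=
      smul_inv_smul₀ (pow_ne_zero n hc0) _
    refine ⟨⟨J (b + S.P i), mem_iUnion.2 ⟨n, _, (mem_ifsIter_iff hc hc0 hf hJ n _).2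
      ⟨b, hn, i, hy⟩, hy⟩⟩, hJinj (hX _)⟩
  · rw [blowUpGraph, SimpleGraph.fromRel_adj, hrel, hrel]
    constructor
    · rintro ⟨hne, ⟨b, hb, i, j, hij, h1, h2⟩ | ⟨b, hb, i, j, hij, h1, h2⟩⟩
      · have hij' : i ≠ j := by
          rintro rfl
          exact hne (Subtype.ext (by rw [← hX, ← hX, h1, h2]))
        exact ⟨b, hb, i, j, (hH i j).2 ⟨hij', Or.inl hij⟩, h1, h2⟩
      · have hij' : j ≠ i := by
          rintro rfl
          exact hne (Subtype.ext (by rw [← hX, ← hX, h1, h2]))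
        exact ⟨b, hb, j, i, (hH j i).2 ⟨hij', Or.inr hij⟩, h2, h1⟩
    · rintro ⟨b, hb, i, j, hij, h1, h2⟩
      obtain ⟨hne, h⟩ := (hH i j).1 hij
      refine ⟨?_, ?_⟩
      · rintro rfl
        exact hne (hP (add_left_cancel (h1.symm.trans h2)))
      · rcases h with h | h
        · exact Or.inl ⟨b, hb, i, j, h, h1, h2⟩
        · exact Or.inr ⟨b, hb, j, i, h, h2, h1⟩

end BlowUp

open Classical in
/-- Evaluation of the Laplacian of the subdivided cell at a point with known representations. -/
lemma subdividedLap_eq_sum (f : (Fin d → ℤ) → ℝ) {z : Fin d → ℤ} (s : Finset (ι × ι))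
    (hs : ∀ k i, S.child 0 k + S.P i = z ↔ (k, i) ∈ s) :
    S.subdividedLap f z =
      ∑ q ∈ s, S.cellLap (fun j => f (S.child 0 q.1 + S.P j)) q.2 := by
  rw [subdividedLap, ← Fintype.sum_prod_type'
    (f := fun k i => if S.child 0 k + S.P i = z then
      S.cellLap (fun j => f (S.child 0 k + S.P j)) i else 0), ← Finset.sum_filter]
  refine Finset.sum_congr ?_ fun _ _ => rfl
  ext ⟨k, i⟩
  simp [hs]

end CellData

/-! ### The Sierpiński graph as a graph of cells -/

/-- The cells of the Sierpiński graph, in the coordinates of the lattice spanned by two sides of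
the triangle. -/
def sierpinskiCells : CellData 2 (Fin 3) where
  c := 2
  P := ![![0, 0], ![1, 0], ![0, 1]]
  H := ⊤

namespace sierpinskiCells

lemma P_zero (i : Fin 3) : sierpinskiCells.P i 0 = if i = 1 then 1 else 0 := by
  fin_cases i <;> rfl

lemma P_one (i : Fin 3) : sierpinskiCells.P i 1 = if i = 2 then 1 else 0 := by
  fin_cases i <;> rfl

lemma child_apply (a : Fin 2 → ℤ) (i : Fin 3) (x : Fin 2) :
    sierpinskiCells.child a i x = 2 * a x + sierpinskiCells.P i x := by
  simp [CellData.child, sierpinskiCells]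

lemma child_zero (i : Fin 3) : sierpinskiCells.child 0 i = sierpinskiCells.P i := by
  ext x
  simp [child_apply]

/-- The only identifications between points of the three subcells: the midpoints of the sides. -/
lemma P_add_P_eq_iff (k i k' i' : Fin 3) :
    sierpinskiCells.P k + sierpinskiCells.P i = sierpinskiCells.P k' + sierpinskiCells.P i' ↔
      (k = k' ∧ i = i') ∨ (k = i' ∧ i = k') := by
  rw [funext_iff, Fin.forall_fin_two]
  simp only [Pi.add_apply, P_zero, P_one]
  revert k i k' i'
  decide

/-- An `n`-cell lies in a triangle. -/
lemma bounds {n : ℕ} {a b : Fin 2 → ℤ} (hb : b ∈ sierpinskiCells.descendants n a) :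
    2 ^ n * a 0 ≤ b 0 ∧ 2 ^ n * a 1 ≤ b 1 ∧ b 0 + b 1 + 1 ≤ 2 ^ n * (a 0 + a 1 + 1) := by
  induction n generalizing a with
  | zero =>
    rw [Finset.mem_singleton.1 hb]
    simp
  | succ n ih =>
    obtain ⟨i, hi⟩ := sierpinskiCells.mem_descendants_succ.1 hb
    obtain ⟨h1, h2, h3⟩ := ih hi
    rw [child_apply, P_zero] at h1
    rw [child_apply, P_one] at h2
    rw [child_apply, child_apply, P_zero, P_one] at h3
    have hM : (0 : ℤ) < 2 ^ n := by positivity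
    rw [pow_succ]
    fin_cases i <;> simp at h1 h2 h3 <;> refine ⟨?_, ?_, ?_⟩ <;> linarith

/-- Two different cells of the same level lie in translated triangles, which meet at most at a
vertex. -/
lemma sep {n : ℕ} {a a' b b' : Fin 2 → ℤ} (hne : a ≠ a')
    (hb : b ∈ sierpinskiCells.descendants n a) (hb' : b' ∈ sierpinskiCells.descendants n a')
    {i j : Fin 3} (h : b + sierpinskiCells.P i = b' + sierpinskiCells.P j) :
    ∃ k, b + sierpinskiCells.P i = sierpinskiCells.corner n a k := by
  have hPb : ∀ i, 0 ≤ sierpinskiCells.P i 0 ∧ 0 ≤ sierpinskiCells.P i 1 ∧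
      sierpinskiCells.P i 0 + sierpinskiCells.P i 1 ≤ 1 := by
    intro i
    rw [P_zero, P_one]
    revert i
    decide
  obtain ⟨h1, h2, h3⟩ := bounds hb
  obtain ⟨h4, h5, h6⟩ := bounds hb'
  obtain ⟨h7, h8, h9⟩ := hPb i
  obtain ⟨h10, h11, h12⟩ := hPb j
  have h13 := congrFun h 0
  have h14 := congrFun h 1
  simp only [Pi.add_apply] at h13 h14
  have hM : (0 : ℤ) < 2 ^ n := by positivity
  have hc : ((sierpinskiCells.c : ℕ) : ℤ) = 2 := rfl
  have hcorner : ∀ k, (b 0 + sierpinskiCells.P i 0 = 2 ^ n * (a 0 + sierpinskiCells.P k 0)) →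
      (b 1 + sierpinskiCells.P i 1 = 2 ^ n * (a 1 + sierpinskiCells.P k 1)) →
      ∃ k, b + sierpinskiCells.P i = sierpinskiCells.corner n a k := by
    intro k hk1 hk2
    refine ⟨k, ?_⟩
    ext x
    simp only [CellData.corner, Pi.add_apply, Pi.smul_apply, smul_eq_mul, hc]
    fin_cases x
    · exact hk1
    · exact hk2
  rcases lt_or_ge (a 0) (a' 0) with h0 | h0
  · have := mul_le_mul_of_nonneg_left (Int.add_one_le_of_lt h0) hM.le
    refine hcorner 1 ?_ ?_
    · change _ = 2 ^ n * (a 0 + 1)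
      linarith
    · change _ = 2 ^ n * (a 1 + 0)
      linarith
  rcases lt_or_ge (a 1) (a' 1) with h0' | h0'
  · have := mul_le_mul_of_nonneg_left (Int.add_one_le_of_lt h0') hM.le
    refine hcorner 2 ?_ ?_
    · change _ = 2 ^ n * (a 0 + 0)
      linarith
    · change _ = 2 ^ n * (a 1 + 1)
      linarith
  · have h15 : a' 0 + a' 1 + 1 ≤ a 0 + a 1 := by
      by_contra hcon
      refine hne ?_
      ext x
      fin_cases x
      · change a 0 = a' 0
        omega
      · change a 1 = a' 1
        omega
    have := mul_le_mul_of_nonneg_left h15 hM.le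
    refine hcorner 0 ?_ ?_
    · change _ = 2 ^ n * (a 0 + 0)
      linarith
    · change _ = 2 ^ n * (a 1 + 0)
      linarith

lemma cellLap_eq (g : Fin 3 → ℝ) (i : Fin 3) :
    sierpinskiCells.cellLap g i = g 0 + g 1 + g 2 - 3 * g i := by
  have h : ∀ j, sierpinskiCells.H.Adj i j ↔ i ≠ j := fun j => Iff.rfl
  simp only [CellData.cellLap, h, Fin.sum_univ_three]
  fin_cases i <;> simp <;> ring

/-- The rule of harmonic extension. Here `g k i` is the value at the corner `i` of the subcell `k`;
the value at the midpoint of a side is a weighted mean, with weights `2 / 5`, `2 / 5`, `1 / 5`, of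
the values at the corners. -/
lemma midpoint_eq {f : (Fin 2 → ℤ) → ℝ}
    (hf : ∀ z, (∀ i, z ≠ (sierpinskiCells.c : ℤ) • sierpinskiCells.P i) →
      sierpinskiCells.subdividedLap f z = 0) :
    ∃ g : Fin 3 → Fin 3 → ℝ, (∀ k i, g k i = f (sierpinskiCells.child 0 k + sierpinskiCells.P i)) ∧
      (∀ k, g k k = f ((sierpinskiCells.c : ℤ) • sierpinskiCells.P k)) ∧
      (∀ k, sierpinskiCells.subdividedLap f ((sierpinskiCells.c : ℤ) • sierpinskiCells.P k) =
        g k 0 + g k 1 + g k 2 - 3 * g k k) ∧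
      g 1 0 = g 0 1 ∧ g 2 0 = g 0 2 ∧ g 2 1 = g 1 2 ∧
      5 * g 0 1 = 2 * g 0 0 + 2 * g 1 1 + g 2 2 ∧ 5 * g 0 2 = 2 * g 0 0 + 2 * g 2 2 + g 1 1 ∧
      5 * g 1 2 = 2 * g 1 1 + 2 * g 2 2 + g 0 0 := by
  have hc : ∀ k, (sierpinskiCells.c : ℤ) • sierpinskiCells.P k =
      sierpinskiCells.P k + sierpinskiCells.P k := fun k => by
    change (2 : ℤ) • sierpinskiCells.P k = _
    rw [two_smul]
  set g : Fin 3 → Fin 3 → ℝ := fun k i => f (sierpinskiCells.P k + sierpinskiCells.P i) with hg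
  have hsymm : ∀ k i, g k i = g i k := fun k i => by simp only [hg, add_comm]
  have hmid : ∀ k i, k ≠ i →
      (g k 0 + g k 1 + g k 2 - 3 * g k i) + (g i 0 + g i 1 + g i 2 - 3 * g i k) = 0 := by
    intro k i hki
    have h1 := hf (sierpinskiCells.P k + sierpinskiCells.P i) fun j hj => ?_
    · rw [CellData.subdividedLap_eq_sum f {(k, i), (i, k)}] at h1
      · rw [Finset.sum_pair (by simp [hki])] at h1
        simpa only [cellLap_eq, child_zero] using h1
      · intro k' i'
        rw [child_zero, P_add_P_eq_iff]
        simp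
    · rw [hc, P_add_P_eq_iff] at hj
      rcases hj with ⟨rfl, rfl⟩ | ⟨rfl, rfl⟩ <;> exact hki rfl
  have h01 := hmid 0 1 (by decide)
  have h02 := hmid 0 2 (by decide)
  have h12 := hmid 1 2 (by decide)
  have s1 := hsymm 1 0
  have s2 := hsymm 2 0
  have s3 := hsymm 2 1
  refine ⟨g, fun k i => by rw [child_zero], fun k => by rw [hc], fun k => ?_, s1, s2, s3,
    ?_, ?_, ?_⟩
  · rw [CellData.subdividedLap_eq_sum f {(k, k)}]
    · simp only [Finset.sum_singleton, cellLap_eq, child_zero, hg]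
    · intro k' i'
      rw [child_zero, hc, P_add_P_eq_iff]
      simp
  · linarith
  · linarith
  · linarith

theorem isHarmonicStructure : sierpinskiCells.IsHarmonicStructure (3 / 5) where
  two_le := le_rfl
  rho_pos := by norm_num
  rho_lt := by norm_num
  eq_of_dvd := by
    intro i j h
    have h0 := h 0
    have h1 := h 1
    change (2 : ℤ) ∣ _ at h0 h1
    rw [P_zero, P_zero] at h0
    rw [P_one, P_one] at h1
    revert i j
    decide
  exists_zero := ⟨0, by
    ext x
    fin_cases x <;> rfl⟩
  exists_adj := ⟨0, 1, by
    change (0 : Fin 3) ≠ 1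
    decide⟩
  diam i j := by
    rcases eq_or_ne i j with h | h
    · exact Or.inl h
    · exact Or.inr (Or.inl h)
  chain f M h i j hij := by
    have hc : ∀ k, (sierpinskiCells.c : ℤ) • sierpinskiCells.P k =
        sierpinskiCells.P k + sierpinskiCells.P k := fun k => by
      change (2 : ℤ) • sierpinskiCells.P k = _
      rw [two_smul]
    have h1 := h i i j hij
    have h2 := h j i j hij
    rw [child_zero] at h1 h2
    rw [hc, hc]
    rw [add_comm (sierpinskiCells.P j) (sierpinskiCells.P i)] at h2
    refine (abs_sub_le _ (f (sierpinskiCells.P i + sierpinskiCells.P j)) _).trans ?_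
    change _ ≤ ((2 : ℕ) : ℝ) * M
    push_cast
    linarith
  sep n a a' _ _ hne b hb b' hb' i j h := sep hne hb hb' h
  edge_unique b b' _ _ i j k l hij hkl h1 h2 := by
    have hij' : i ≠ j := hij
    have hkl' : k ≠ l := hkl
    have hfin : ∀ i j k l : Fin 3, i ≠ j → k ≠ l →
        sierpinskiCells.P i + sierpinskiCells.P l = sierpinskiCells.P k + sierpinskiCells.P j →
          i = k := by
      intro i j k l hij hkl h
      rcases (P_add_P_eq_iff _ _ _ _).1 h with h | h
      · exact h.1
      · exact absurd h.1 hij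
    have h3 : sierpinskiCells.P i + sierpinskiCells.P l =
        sierpinskiCells.P k + sierpinskiCells.P j := by
      ext x
      have h4 := congrFun h1 x
      have h5 := congrFun h2 x
      simp only [Pi.add_apply] at h4 h5 ⊢
      linarith
    rw [hfin i j k l hij' hkl' h3] at h1
    exact add_right_cancel h1
  lap_eq f hf i := by
    obtain ⟨g, -, h1, h2, h3, h4, h5, h6, h7, h8⟩ := midpoint_eq hf
    rw [h2, cellLap_eq, ← h1, ← h1, ← h1, ← h1]
    fin_cases i <;> simp <;> linarith
  contract f hf M hM k i j hij := by
    obtain ⟨g, h0, h1, h2, h3, h4, h5, h6, h7, h8⟩ := midpoint_eq hf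
    have hadj : ∀ i j : Fin 3, i ≠ j → |g i i - g j j| ≤ M := fun i j hij => by
      rw [h1, h1]
      exact hM i j hij
    have h01 := abs_le.1 (hadj 0 1 (by decide))
    have h02 := abs_le.1 (hadj 0 2 (by decide))
    have h12 := abs_le.1 (hadj 1 2 (by decide))
    rw [← h0, ← h0, abs_le]
    fin_cases k <;> fin_cases i <;> fin_cases j <;> simp <;>
      first | linarith | (constructor <;> linarith)

end sierpinskiCells

/-- The passage from lattice coordinates to Cartesian coordinates. -/
def sierpinskiEmbedding : (Fin 2 → ℤ) →+ (Fin 2 → ℝ) where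
  toFun z := ![z 0 + z 1 / 2, z 1 * (√3 / 2)]
  map_zero' := by
    ext x
    fin_cases x <;> simp
  map_add' z w := by
    ext x
    fin_cases x <;> simp <;> ring

lemma sierpinskiEmbedding_injective : Function.Injective sierpinskiEmbedding := by
  intro z w h
  have h0 : (z 0 : ℝ) + z 1 / 2 = w 0 + w 1 / 2 := congrFun h 0
  have h1 : (z 1 : ℝ) * (√3 / 2) = w 1 * (√3 / 2) := congrFun h 1
  have h2 : (z 1 : ℝ) = w 1 := mul_right_cancel₀ (by positivity) h1
  rw [h2] at h0
  have h3 : (z 0 : ℝ) = w 0 := by linarith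
  ext x
  fin_cases x
  · exact_mod_cast h3
  · exact_mod_cast h2

theorem sierpinskiGraph_generalizedReverseHolder :
    sierpinskiGraph.GeneralizedReverseHolder (scalePhi (Real.log 3 / Real.log 2))
      (scalePsi (Real.log 5 / Real.log 2)) := by
  have hS := sierpinskiCells.isHarmonicStructure
  have hinj : Function.Injective sierpinskiPoint := by
    intro i j h
    have h0 := congrFun h 0
    fin_cases i <;> fin_cases j <;> simp [sierpinskiPoint] at h0 ⊢
  obtain ⟨X, hX⟩ := CellData.exists_isCellGraph (S := sierpinskiCells) (c := 2)
    (f := sierpinskiMap) (p := sierpinskiPoint)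
    (E := {e | ∃ i j, i ≠ j ∧ e = (sierpinskiPoint i, sierpinskiPoint j)})
    (J := sierpinskiEmbedding) (by simp [sierpinskiCells]) (by norm_num)
    sierpinskiEmbedding_injective hS.P_injective
    (fun i x => by
      ext k
      simp only [sierpinskiMap, Pi.add_apply, Pi.smul_apply, smul_eq_mul]
      ring)
    (fun i => by
      ext k
      fin_cases i <;> fin_cases k <;>
        simp [sierpinskiEmbedding, sierpinskiCells, sierpinskiPoint])
    (fun e ⟨i, j, _, h⟩ => ⟨i, j, h⟩)
    (fun i j => by
      constructor
      · exact fun h => ⟨h, Or.inl ⟨i, j, h, rfl⟩⟩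
      · exact fun h => h.1)
  have hX' : sierpinskiCells.IsCellGraph sierpinskiGraph X := hX
  refine hX'.generalizedReverseHolder hS ?_
  have h2 : Real.log 2 ≠ 0 := (Real.log_pos (by norm_num)).ne'
  change ((2 : ℕ) : ℝ) ^ _ = _
  rw [← sub_div, ← Real.log_div (by norm_num) (by norm_num), Nat.cast_ofNat,
    Real.rpow_def_of_pos (by norm_num), mul_div_cancel₀ _ h2, Real.exp_log (by norm_num)]

/-! ### The Vicsek graphs as graphs of cells -/

/-- The cells of the `N`-dimensional Vicsek graph. In integer coordinates the corners of the basic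
cell are the points of `{0, 2}ᴺ` and the centre is `(1, …, 1)`. -/
def vicsekCells (N : ℕ) : CellData N (Option (Fin N → Bool)) where
  c := 3
  P i := match i with
    | some ε => fun x => if ε x then 2 else 0
    | none => fun _ => 1
  H := SimpleGraph.comap Option.isNone ⊤

namespace vicsekCells

variable {N : ℕ}

lemma P_none (x : Fin N) : (vicsekCells N).P none x = 1 := rfl

lemma P_some (ε : Fin N → Bool) (x : Fin N) :
    (vicsekCells N).P (some ε) x = if ε x then 2 else 0 := rfl

lemma P_nonneg (i : Option (Fin N → Bool)) (x : Fin N) : 0 ≤ (vicsekCells N).P i x := by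
  rcases i with _ | ε
  · rw [P_none]
    norm_num
  · rw [P_some]
    split_ifs <;> norm_num

lemma P_le_two (i : Option (Fin N → Bool)) (x : Fin N) : (vicsekCells N).P i x ≤ 2 := by
  rcases i with _ | ε
  · rw [P_none]
    norm_num
  · rw [P_some]
    split_ifs <;> norm_num

lemma adj_none_some (ε : Fin N → Bool) : (vicsekCells N).H.Adj none (some ε) := by
  simp [vicsekCells]

lemma adj_some_none (ε : Fin N → Bool) : (vicsekCells N).H.Adj (some ε) none :=
  (adj_none_some ε).symm

lemma not_adj_some_some (ε ε' : Fin N → Bool) : ¬(vicsekCells N).H.Adj (some ε) (some ε') := by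
  simp [vicsekCells]

lemma child_apply (a : Fin N → ℤ) (i : Option (Fin N → Bool)) (x : Fin N) :
    (vicsekCells N).child a i x = 3 * a x + 2 * (vicsekCells N).P i x := by
  simp [CellData.child, vicsekCells]

lemma bounds {n : ℕ} {a b : Fin N → ℤ} (hb : b ∈ (vicsekCells N).descendants n a) (x : Fin N) :
    3 ^ n * a x ≤ b x ∧ b x + 2 ≤ 3 ^ n * (a x + 2) := by
  induction n generalizing a with
  | zero =>
    rw [Finset.mem_singleton.1 hb]
    simp
  | succ n ih =>
    obtain ⟨i, hi⟩ := (vicsekCells N).mem_descendants_succ.1 hb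
    obtain ⟨h1, h2⟩ := ih hi
    rw [child_apply] at h1 h2
    have hM : (0 : ℤ) < 3 ^ n := by positivity
    have h3 := mul_le_mul_of_nonneg_left (P_nonneg i x) hM.le
    have h4 := mul_le_mul_of_nonneg_left (P_le_two i x) hM.le
    rw [pow_succ]
    constructor <;> linarith

/-- All coordinates of a position are even, and they agree modulo `4`. -/
lemma dvd_of_isPosition {a : Fin N → ℤ} (ha : (vicsekCells N).IsPosition a) :
    (∀ x, 2 ∣ a x) ∧ ∀ x y, 4 ∣ a x - a y := by
  induction ha with
  | zero => simp
  | child a i _ ih =>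
    refine ⟨fun x => ?_, fun x y => ?_⟩
    · have := ih.1 x
      rw [child_apply]
      omega
    · have := ih.2 x y
      rw [child_apply, child_apply]
      rcases i with _ | ε
      · rw [P_none, P_none]
        omega
      · rw [P_some, P_some]
        split_ifs <;> omega

/-- Two different cells of the same level can only meet at a corner, since by the congruences for
their positions they are diagonal neighbours. -/
lemma sep {n : ℕ} {a a' b b' : Fin N → ℤ} (ha : (vicsekCells N).IsPosition a)
    (ha' : (vicsekCells N).IsPosition a') (hne : a ≠ a')
    (hb : b ∈ (vicsekCells N).descendants n a) (hb' : b' ∈ (vicsekCells N).descendants n a')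
    {i j : Option (Fin N → Bool)} (h : b + (vicsekCells N).P i = b' + (vicsekCells N).P j) :
    ∃ k, b + (vicsekCells N).P i = (vicsekCells N).corner n a k := by
  have hM : (0 : ℤ) < 3 ^ n := by positivity
  have hv : ∀ x, b x + (vicsekCells N).P i x = b' x + (vicsekCells N).P j x := congrFun h
  have hle : ∀ x, a x ≤ a' x + 2 ∧ a' x ≤ a x + 2 := by
    intro x
    have h1 := hv x
    have h2 := bounds hb x
    have h3 := bounds hb' x
    have h4 := P_nonneg i x
    have h5 := P_le_two i x
    have h6 := P_nonneg j x
    have h7 := P_le_two j x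
    constructor <;> refine le_of_mul_le_mul_left ?_ hM <;> linarith
  obtain ⟨y, hy⟩ := Function.ne_iff.1 hne
  have hdiff : ∀ x, a' x = a x + 2 ∨ a x = a' x + 2 := by
    intro x
    have h1 := (dvd_of_isPosition ha).1 x
    have h2 := (dvd_of_isPosition ha').1 x
    have h3 := (dvd_of_isPosition ha).2 x y
    have h4 := (dvd_of_isPosition ha').2 x y
    have h5 := hle x
    have h6 := hle y
    have h7 := (dvd_of_isPosition ha).1 y
    have h8 := (dvd_of_isPosition ha').1 y
    omega
  refine ⟨some fun x => decide (a x < a' x), ?_⟩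
  ext x
  have h1 := hv x
  have h2 := bounds hb x
  have h3 := bounds hb' x
  have h4 := P_nonneg i x
  have h5 := P_le_two i x
  have h6 := P_nonneg j x
  have h7 := P_le_two j x
  change b x + (vicsekCells N).P i x = 3 ^ n * (a x + _)
  rw [P_some]
  rcases hdiff x with hx | hx
  · rw [if_pos (by simp [hx])]
    rw [hx] at h3
    linarith
  · rw [if_neg (by simp [hx])]
    rw [hx] at h2 ⊢
    linarith

lemma child_zero_add_apply (k i : Option (Fin N → Bool)) (x : Fin N) :
    ((vicsekCells N).child 0 k + (vicsekCells N).P i) x =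
      2 * (vicsekCells N).P k x + (vicsekCells N).P i x := by
  simp [child_apply]

/-- The central subcell meets the outer one at the corner `ε` in the point opposite to `ε`. -/
lemma child_add_eq (ε : Fin N → Bool) :
    (vicsekCells N).child 0 (some ε) + (vicsekCells N).P (some fun x => !ε x) =
      (vicsekCells N).child 0 none + (vicsekCells N).P (some ε) := by
  ext x
  simp only [child_zero_add_apply, P_none, P_some]
  cases ε x <;> simp

lemma smul_P (k : Option (Fin N → Bool)) :
    ((vicsekCells N).c : ℤ) • (vicsekCells N).P k =
      (vicsekCells N).child 0 k + (vicsekCells N).P k := by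
  ext x
  rw [child_zero_add_apply]
  change 3 * (vicsekCells N).P k x = _
  ring

/-- The only identifications between points of the subcells are those of `child_add_eq`. -/
lemma child_add_eq_iff (hN : N ≠ 0) {k i k' i' : Option (Fin N → Bool)} :
    (vicsekCells N).child 0 k + (vicsekCells N).P i =
        (vicsekCells N).child 0 k' + (vicsekCells N).P i' ↔
      (k = k' ∧ i = i') ∨
      (∃ ε, k = some ε ∧ i = some (fun x => !ε x) ∧ k' = none ∧ i' = some ε) ∨
      (∃ ε, k' = some ε ∧ i' = some (fun x => !ε x) ∧ k = none ∧ i = some ε) := by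
  constructor
  · intro h
    have hx : ∀ x, 2 * (vicsekCells N).P k x + (vicsekCells N).P i x =
        2 * (vicsekCells N).P k' x + (vicsekCells N).P i' x := fun x => by
      rw [← child_zero_add_apply, h, child_zero_add_apply]
    have x₀ : Fin N := ⟨0, Nat.pos_of_ne_zero hN⟩
    have h0 := hx x₀
    rcases k with _ | κ <;> rcases k' with _ | κ' <;> rcases i with _ | η <;>
      rcases i' with _ | η' <;> simp only [P_none, P_some] at hx h0
    all_goals first
      | (exfalso; split_ifs at h0 <;> omega)
      | skip
    · simp
    · left
      refine ⟨rfl, congrArg some (funext fun x => ?_)⟩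
      have := hx x
      cases h1 : η x <;> cases h2 : η' x <;> simp [h1, h2] at this ⊢
    · refine Or.inr (Or.inr ⟨κ', rfl, congrArg some (funext fun x => ?_), rfl,
        congrArg some (funext fun x => ?_)⟩) <;>
      · have := hx x
        cases h1 : η x <;> cases h2 : η' x <;> cases h3 : κ' x <;>
          simp [h1, h2, h3] at this ⊢
    · refine Or.inr (Or.inl ⟨κ, rfl, congrArg some (funext fun x => ?_), rfl,
        congrArg some (funext fun x => ?_)⟩) <;>
      · have := hx x
        cases h1 : η x <;> cases h2 : η' x <;> cases h3 : κ x <;>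
          simp [h1, h2, h3] at this ⊢
    · left
      refine ⟨congrArg some (funext fun x => ?_), rfl⟩
      have := hx x
      cases h1 : κ x <;> cases h2 : κ' x <;> simp [h1, h2] at this ⊢
    · left
      refine ⟨congrArg some (funext fun x => ?_), congrArg some (funext fun x => ?_)⟩ <;>
      · have := hx x
        cases h1 : η x <;> cases h2 : η' x <;> cases h3 : κ x <;> cases h4 : κ' x <;>
          simp [h1, h2, h3, h4] at this ⊢
  · rintro (⟨rfl, rfl⟩ | ⟨ε, rfl, rfl, rfl, rfl⟩ | ⟨ε, rfl, rfl, rfl, rfl⟩)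
    · rfl
    · exact child_add_eq ε
    · exact (child_add_eq ε).symm

lemma cellLap_some (g : Option (Fin N → Bool) → ℝ) (ε : Fin N → Bool) :
    (vicsekCells N).cellLap g (some ε) = g none - g (some ε) := by
  rw [CellData.cellLap, Fintype.sum_option, if_pos (adj_some_none ε)]
  simp only [if_neg (not_adj_some_some ε _), Finset.sum_const_zero, add_zero]

lemma cellLap_none (g : Option (Fin N → Bool) → ℝ) :
    (vicsekCells N).cellLap g none = ∑ ε, (g (some ε) - g none) := by
  rw [CellData.cellLap, Fintype.sum_option, if_neg (SimpleGraph.irrefl _), zero_add]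
  simp only [if_pos (adj_none_some _)]

/-- The rule of harmonic extension: on each arm the values are interpolated linearly, and off the
arms they are constant on the subcells. Here `q k i` is the value at the point `i` of the subcell
`k`, and an arm runs from a corner `3 P (some ε)` to the centre `3 P none`. -/
lemma extension (hN : N ≠ 0) {f : (Fin N → ℤ) → ℝ}
    (hf : ∀ z, (∀ i, z ≠ ((vicsekCells N).c : ℤ) • (vicsekCells N).P i) →
      (vicsekCells N).subdividedLap f z = 0) :
    ∃ q : Option (Fin N → Bool) → Option (Fin N → Bool) → ℝ,
      (∀ k i, q k i = f ((vicsekCells N).child 0 k + (vicsekCells N).P i)) ∧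
      (∀ k, q k k = f (((vicsekCells N).c : ℤ) • (vicsekCells N).P k)) ∧
      (∀ k, (vicsekCells N).subdividedLap f (((vicsekCells N).c : ℤ) • (vicsekCells N).P k) =
        (vicsekCells N).cellLap (q k) k) ∧
      (∀ ε, 3 * q (some ε) none = 2 * q (some ε) (some ε) + q none none) ∧
      (∀ ε, 3 * q none (some ε) = q (some ε) (some ε) + 2 * q none none) ∧
      (∀ ε, q (some ε) (some fun x => !ε x) = q none (some ε)) ∧
      ∀ ε ε', ε' ≠ ε → ε' ≠ (fun x => !ε x) → q (some ε) (some ε') = q (some ε) none := by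
  classical
  set q : Option (Fin N → Bool) → Option (Fin N → Bool) → ℝ := fun k i =>
    f ((vicsekCells N).child 0 k + (vicsekCells N).P i) with hq
  have hlap : ∀ k i s, (∀ k' i', (vicsekCells N).child 0 k' + (vicsekCells N).P i' =
      (vicsekCells N).child 0 k + (vicsekCells N).P i ↔ (k', i') ∈ s) →
      (vicsekCells N).subdividedLap f ((vicsekCells N).child 0 k + (vicsekCells N).P i) =
        ∑ r ∈ s, (vicsekCells N).cellLap (q r.1) r.2 := fun k i s hs =>
    CellData.subdividedLap_eq_sum f s hs
  have x₀ : Fin N := ⟨0, Nat.pos_of_ne_zero hN⟩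
  have hnot : ∀ ε : Fin N → Bool, (fun x => !ε x) ≠ ε := fun ε h => by
    simpa using congrFun h x₀
  have hcorner : ∀ k, (vicsekCells N).subdividedLap f
      (((vicsekCells N).c : ℤ) • (vicsekCells N).P k) = (vicsekCells N).cellLap (q k) k := by
    intro k
    rw [smul_P, hlap k k {(k, k)}, Finset.sum_singleton]
    intro k' i'
    rw [child_add_eq_iff hN, Finset.mem_singleton, Prod.mk.injEq]
    refine or_iff_left ?_
    rintro (⟨ε, -, -, h1, h2⟩ | ⟨ε, h1, h2, -⟩)
    · exact absurd (h1.symm.trans h2) (by simp)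
    · exact hnot ε (Option.some_injective _ (h2.symm.trans h1))
  have hzero : ∀ k i, k ≠ i → (vicsekCells N).subdividedLap f
      ((vicsekCells N).child 0 k + (vicsekCells N).P i) = 0 := by
    intro k i hki
    refine hf _ fun j hj => ?_
    rw [smul_P, child_add_eq_iff hN] at hj
    rcases hj with ⟨rfl, rfl⟩ | ⟨ε, -, -, h1, h2⟩ | ⟨ε, h1, h2, -⟩
    · exact hki rfl
    · exact absurd (h1.symm.trans h2) (by simp)
    · exact hnot ε (Option.some_injective _ (h2.symm.trans h1))
  have hfree : ∀ ε ε', ε' ≠ ε → ε' ≠ (fun x => !ε x) →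
      q (some ε) (some ε') = q (some ε) none := by
    intro ε ε' h1 h2
    have h := hzero (some ε) (some ε') (fun h => h1 (Option.some_injective _ h).symm)
    rw [hlap _ _ {(some ε, some ε')}, Finset.sum_singleton, cellLap_some] at h
    · linarith
    · intro k' i'
      rw [child_add_eq_iff hN, Finset.mem_singleton, Prod.mk.injEq]
      refine or_iff_left ?_
      rintro (⟨δ, -, -, h3, -⟩ | ⟨δ, h3, h4, -⟩)
      · exact absurd h3 (by simp)
      · obtain rfl := Option.some_injective _ h3
        exact h2 (Option.some_injective _ h4)
  have hjoin : ∀ ε, q (some ε) (some fun x => !ε x) = q none (some ε) := fun ε => by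
    simp only [hq, child_add_eq]
  have hcentre : ∀ ε, q (some ε) (some ε) + q none (some ε) = 2 * q (some ε) none := by
    intro ε
    have h := hzero (some ε) none (by simp)
    rw [hlap _ _ {(some ε, none)}, Finset.sum_singleton, cellLap_none,
      Fintype.sum_eq_add ε (fun x => !ε x) (hnot ε).symm, hjoin] at h
    · linarith
    · rintro ε' ⟨h1, h2⟩
      rw [hfree ε ε' h1 h2, sub_self]
    · intro k' i'
      rw [child_add_eq_iff hN, Finset.mem_singleton, Prod.mk.injEq]
      refine or_iff_left ?_
      rintro (⟨δ, -, -, h3, -⟩ | ⟨δ, -, h4, -⟩)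
      · exact absurd h3 (by simp)
      · exact absurd h4 (by simp)
  have hjunction : ∀ ε, q (some ε) none + q none none = 2 * q none (some ε) := by
    intro ε
    have h := hzero none (some ε) (by simp)
    rw [hlap _ _ {(some ε, some fun x => !ε x), (none, some ε)},
      Finset.sum_pair (by simp), cellLap_some, cellLap_some, hjoin] at h
    · linarith
    · intro k' i'
      rw [child_add_eq_iff hN]
      simp only [Finset.mem_insert, Finset.mem_singleton, Prod.mk.injEq]
      constructor
      · rintro (h | ⟨δ, h1, h2, -, h3⟩ | ⟨δ, h1, -⟩)
        · exact Or.inr h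
        · obtain rfl := Option.some_injective _ h3
          exact Or.inl ⟨h1, h2⟩
        · exact absurd h1 (by simp)
      · rintro (⟨h1, h2⟩ | h)
        · exact Or.inr (Or.inl ⟨ε, h1, h2, trivial, rfl⟩)
        · exact Or.inl h
  refine ⟨q, fun _ _ => rfl, fun k => by rw [smul_P], hcorner, fun ε => ?_, fun ε => ?_, hjoin,
    hfree⟩
  · linarith [hcentre ε, hjunction ε]
  · linarith [hcentre ε, hjunction ε]

theorem isHarmonicStructure (hN : N ≠ 0) : (vicsekCells N).IsHarmonicStructure (1 / 3) where
  two_le := by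
    change 2 ≤ 3
    norm_num
  rho_pos := by norm_num
  rho_lt := by norm_num
  eq_of_dvd := by
    intro i j h
    change ∀ x, (3 : ℤ) ∣ _ at h
    have h0 := h ⟨0, Nat.pos_of_ne_zero hN⟩
    rcases i with _ | ε <;> rcases j with _ | ε' <;> simp only [P_none, P_some] at h h0
    · rfl
    · split_ifs at h0 <;> omega
    · split_ifs at h0 <;> omega
    · refine congrArg some (funext fun x => ?_)
      have hx := h x
      cases h1 : ε x <;> cases h2 : ε' x <;> simp [h1, h2] at hx ⊢
  exists_zero := ⟨some fun _ => false, by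
    ext x
    simp [P_some]⟩
  exists_adj := ⟨none, some fun _ => false, adj_none_some _⟩
  diam i j := by
    rcases i with _ | ε <;> rcases j with _ | ε'
    · exact Or.inl rfl
    · exact Or.inr (Or.inl (adj_none_some _))
    · exact Or.inr (Or.inl (adj_some_none _))
    · exact Or.inr (Or.inr ⟨none, adj_some_none _, adj_none_some _⟩)
  chain f M h := by
    have key : ∀ ε, |f (((vicsekCells N).c : ℤ) • (vicsekCells N).P (some ε)) -
        f (((vicsekCells N).c : ℤ) • (vicsekCells N).P none)| ≤ (vicsekCells N).c * M := by
      intro ε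
      have h1 := abs_le.1 (h (some ε) _ _ (adj_some_none ε))
      have h2 := abs_le.1 (h (some ε) _ _ (adj_none_some fun x => !ε x))
      have h3 := abs_le.1 (h none _ _ (adj_some_none ε))
      rw [child_add_eq] at h2
      rw [smul_P, smul_P]
      change _ ≤ ((3 : ℕ) : ℝ) * M
      push_cast
      rw [abs_le]
      constructor <;> linarith
    intro i j hij
    rcases i with _ | ε <;> rcases j with _ | ε'
    · exact absurd hij (SimpleGraph.irrefl _)
    · rw [abs_sub_comm]
      exact key ε'
    · exact key ε
    · exact absurd hij (not_adj_some_some _ _)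
  sep n a a' ha ha' hne b hb b' hb' i j h := sep ha ha' hne hb hb' h
  edge_unique b b' hb hb' i j k l hij hkl h1 h2 := by
    have hpar := (dvd_of_isPosition hb).1
    have hpar' := (dvd_of_isPosition hb').1
    ext x
    have h3 := congrFun h1 x
    have h4 := congrFun h2 x
    have h5 := hpar x
    have h6 := hpar' x
    simp only [Pi.add_apply] at h3 h4
    rcases i with _ | ε <;> rcases k with _ | κ
    · exact add_right_cancel h3
    · rw [P_none, P_some] at h3
      split_ifs at h3 <;> omega
    · rw [P_none, P_some] at h3
      split_ifs at h3 <;> omega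
    · rcases j with _ | ε'
      · rcases l with _ | κ'
        · exact add_right_cancel h4
        · exact absurd hkl (not_adj_some_some _ _)
      · exact absurd hij (not_adj_some_some _ _)
  lap_eq f hf i := by
    obtain ⟨q, -, h1, h2, h3, h4, -⟩ := extension hN hf
    rw [h2]
    rcases i with _ | ε
    · simp only [cellLap_none, ← h1]
      rw [Finset.mul_sum]
      refine Finset.sum_congr rfl fun ε _ => ?_
      linarith [h4 ε]
    · simp only [cellLap_some, ← h1]
      linarith [h3 ε]
  contract f hf M hM := by
    obtain ⟨q, h0, h1, -, h3, h4, h5, h6⟩ := extension hN hf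
    have hM' : ∀ ε, |q (some ε) (some ε) - q none none| ≤ M := fun ε => by
      rw [h1, h1]
      exact hM _ _ (adj_some_none ε)
    have key : ∀ k ε, |q k (some ε) - q k none| ≤ 1 / 3 * M := by
      intro k ε'
      rw [abs_le]
      rcases k with _ | ε
      · have := abs_le.1 (hM' ε')
        have := h4 ε'
        constructor <;> linarith
      · have := abs_le.1 (hM' ε)
        have := h3 ε
        have := h4 ε
        rcases eq_or_ne ε' ε with rfl | hne
        · constructor <;> linarith
        rcases eq_or_ne ε' (fun x => !ε x) with rfl | hne'
        · rw [h5]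
          constructor <;> linarith
        · rw [h6 ε ε' hne hne']
          constructor <;> linarith
    intro k i j hij
    rw [← h0, ← h0]
    rcases i with _ | ε <;> rcases j with _ | ε'
    · exact absurd hij (SimpleGraph.irrefl _)
    · rw [abs_sub_comm]
      exact key k ε'
    · exact key k ε
    · exact absurd hij (not_adj_some_some _ _)

end vicsekCells

/-- The passage from integer coordinates to the coordinates of the cube `[0, 2/√N]ᴺ`. -/
def vicsekEmbedding (N : ℕ) : (Fin N → ℤ) →+ (Fin N → ℝ) where
  toFun z x := z x / √N
  map_zero' := by
    ext x
    simp
  map_add' z w := by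
    ext x
    simp [add_div]

theorem vicsekGraph_generalizedReverseHolder {N : ℕ} (hN : N ≠ 0) :
    (vicsekGraph N).GeneralizedReverseHolder (scalePhi (Real.log (2 ^ N + 1) / Real.log 3))
      (scalePsi (Real.log (3 * (2 ^ N + 1)) / Real.log 3)) := by
  have hS := vicsekCells.isHarmonicStructure hN
  have hsqrt : √(N : ℝ) ≠ 0 := (Real.sqrt_pos.2 (by positivity)).ne'
  have hinj : Function.Injective (vicsekEmbedding N) := by
    intro z w h
    ext x
    have hx : (z x : ℝ) / √N = w x / √N := congrFun h x
    exact_mod_cast (div_left_inj' hsqrt).1 hx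
  have hJ : ∀ i, vicsekEmbedding N ((vicsekCells N).P i) = vicsekPoint N i := by
    rintro (_ | ε) <;> ext x
    · simp [vicsekEmbedding, vicsekCells.P_none, vicsekPoint]
    · simp only [vicsekEmbedding, vicsekPoint, AddMonoidHom.coe_mk, ZeroHom.coe_mk,
        vicsekCells.P_some]
      split_ifs <;> simp
  have hp : Function.Injective (vicsekPoint N) := fun i j h => by
    rw [← hJ, ← hJ] at h
    exact hS.P_injective (hinj h)
  obtain ⟨X, hX⟩ := CellData.exists_isCellGraph (S := vicsekCells N) (c := 3)
    (f := vicsekMap N) (p := vicsekPoint N)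
    (E := range fun ε => (vicsekPoint N (some ε), vicsekPoint N none))
    (J := vicsekEmbedding N) (by simp [vicsekCells]) (by norm_num) hinj hS.P_injective
    (fun i x => by
      ext k
      simp only [vicsekMap, Pi.add_apply, Pi.smul_apply, smul_eq_mul]
      ring)
    hJ
    (by
      rintro _ ⟨ε, rfl⟩
      exact ⟨_, _, rfl⟩)
    (by
      intro i j
      have hE : ∀ i j, (vicsekPoint N i, vicsekPoint N j) ∈
          (range fun ε => (vicsekPoint N (some ε), vicsekPoint N none)) ↔
          i ≠ none ∧ j = none := by
        intro i j
        constructor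
        · rintro ⟨ε, h⟩
          rw [Prod.mk.injEq] at h
          rw [← hp h.1, ← hp h.2]
          simp
        · rintro ⟨h1, rfl⟩
          obtain ⟨ε, rfl⟩ := Option.ne_none_iff_exists'.1 h1
          exact ⟨ε, rfl⟩
      rw [hE, hE]
      rcases i with _ | ε <;> rcases j with _ | ε' <;>
        simp [vicsekCells.adj_none_some, vicsekCells.adj_some_none,
          vicsekCells.not_adj_some_some])
  have hX' : (vicsekCells N).IsCellGraph (vicsekGraph N) X := hX
  refine hX'.generalizedReverseHolder hS ?_
  have h3 : Real.log 3 ≠ 0 := (Real.log_pos (by norm_num)).ne'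
  have h2 : (2 : ℝ) ^ N + 1 ≠ 0 := by positivity
  change ((3 : ℕ) : ℝ) ^ _ = _
  rw [← sub_div, ← Real.log_div h2 (by positivity), Nat.cast_ofNat,
    Real.rpow_def_of_pos (by norm_num), mul_div_cancel₀ _ h3, Real.exp_log (by positivity)]
  field_simp

end

theorem mainTheorem3 :
    (∀ N : ℕ, 2 ≤ N →
      (vicsekGraph N).GeneralizedReverseHolder
        (scalePhi (Real.log (2 ^ N + 1) / Real.log 3))
        (scalePsi (Real.log (3 * (2 ^ N + 1)) / Real.log 3))) ∧
    sierpinskiGraph.GeneralizedReverseHolder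
      (scalePhi (Real.log 3 / Real.log 2))
      (scalePsi (Real.log 5 / Real.log 2)) := by
  exact ⟨fun _ hN => vicsekGraph_generalizedReverseHolder (by omega),
    sierpinskiGraph_generalizedReverseHolder⟩
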